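/- Let $r,s\ge1$ be integers, and let $0\le\alpha\le r$ and $0\le\beta\le s$ be integers with $\gcd(\alpha,r)=\gcd(\beta,s)=1$. The tent $T=S_0\cup S_1\cup S_2\cup S_3$ with sides $S_1=\frac1r(\alpha,1)$ and $S_3=\frac1s(\beta,1)$ is the reducible affine surface over $\mathbb C$ obtained from the planes $S_0=\mathbb A^2_{\langle x_0,y_0\rangle}$ and $S_2=\mathbb A^2_{\langle \xi,\eta\rangle}$, the quotient $S_1$ of $\mathbb A^2_{\langle u,v\rangle}$ by $(u,v)\mapsto(\varepsilon^\alpha u,\varepsilon v)$ with $\varepsilon=e^{2\pi i/r}$, and the quotient $S_3$ of $\mathbb A^2_{\langle u,v\rangle}$ by $(u,v)\mapsto(\varepsilon^\beta u,\varepsilon v)$ with $\varepsilon=e^{2\pi i/s}$, by glueing them transversally along their coordinate axes by means of $x_0=u^r$, $\xi=v^r$ on $S_1$ and $y_0=u^s$, $\eta=v^s$ on $S_3$. Its top axes are the $\xi$-axis and the $\eta$-axis. A toric deformation of $T$ is a normal affine toric $4$-fold $V=\operatorname{Spec}\mathbb C[\mathbb M\cap\sigma]$ ($\mathbb M\cong\mathbb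 Z^4$, $\sigma\subset\mathbb M_{\mathbb R}$ a rational polyhedral cone of dimension $4$), with two monomials $A,B$ that form a regular sequence, and a closed embedding $T\subset V$ with image $A=B=0$, such that every monomial on $V$ restricts to a scalar multiple (possibly zero) of a monomial on each $S_j$. It smooths the top axes if $(B=0)\subset V$ is smooth along the $\xi$-axis outside the origin and $(A=0)\subset V$ is smooth along the $\eta$-axis outside the origin. Two toric deformations are isomorphic if there is an isomorphism of their total spaces that is the identity on $T$, takes monomials to scalar multiples of monomials, and takes $A$ to a nonzero multiple of $A$ and $B$ to a nonzero multiple of $B$. **Theorem.** (i) The isomorphism classes of toric deformations $T\subset V_{AB}$ that smooth the top axes correspond one-to-one with the matrices $$\begin{pmatrix} r&a\\b&s\end{pmatrix}\in \mathrm{SL}(2,\mathbb Z)\quad\text{with } a,b\ge0,\quad a\equiv\alpha \bmod r,\quad b\equiv\beta\bmod s.$$ The deformation belongs to the matrix if, writing $x_0,y_0,\xi,\eta\in\mathbb M$ for the monomials on $V_{AB}$ that restrict to nonzero multiples of the coordinates of these names on $T$, the monomials $\xi,\eta,A,B$ form a basis of $\mathbb M$, one has $x_0=(A\eta^{-1})^r\xi^a$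 and $y_0=\eta^b(B\xi^{-1})^s$, and $\sigma$ is spanned by $\xi,\eta,A,B,x_0,y_0$. (ii) If $(r,s)\ne(1,1)$, these matrices are given precisely by the pairs $(a,b)$ with $$\text{either}\quad a=\alpha\mid rs-1,\quad b=\frac{rs-1}\alpha\quad\text{and}\quad b\equiv\beta\bmod s,$$ $$\text{or}\quad b=\beta\mid rs-1,\quad a=\frac{rs-1}\beta\quad\text{and}\quad a\equiv\alpha\bmod r.$$ There are thus at most two of them, and each of the numbers $0$, $1$, $2$ of solutions occurs for suitable $(r,\alpha,s,\beta)$ with $(r,s)\neq(1,1)$. -/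

import Mathlib

noncomputable section

namespace Tent

open MvPolynomial

/-- The polynomial ring in two variables over `ℂ`. -/
abbrev Poly2 : Type := MvPolynomial (Fin 2) ℂ

/-- The chosen generator of the action `1/r (α,1)` of `ℤ/r` on the plane with coordinates `u, v`:
`u ↦ ε ^ α * u`, `v ↦ ε * v` with `ε = exp (2πi/r)`, as an endomorphism of `ℂ[u,v]`. -/
def cyclicAction (r α : ℕ) : Poly2 →ₐ[ℂ] Poly2 :=
  aeval ![C (Complex.exp (2 * Real.pi * Complex.I / r) ^ α) * X 0,
    C (Complex.exp (2 * Real.pi * Complex.I / r)) * X 1]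

/-- Restriction of `f(u,v)` to the axis `v = 0`, reparametrised as `t ↦ (t ^ n, 0)`. -/
def restrFst (n : ℕ) : Poly2 →ₐ[ℂ] Polynomial ℂ := aeval ![Polynomial.X ^ n, 0]

/-- Restriction of `f(u,v)` to the axis `u = 0`, reparametrised as `t ↦ (0, t ^ n)`. -/
def restrSnd (n : ℕ) : Poly2 →ₐ[ℂ] Polynomial ℂ := aeval ![0, Polynomial.X ^ n]

/-- The coordinate ring of the tent `T = S₀ ∪ S₁ ∪ S₂ ∪ S₃` with sides `S₁ = 1/r (α,1)` and
`S₃ = 1/s (β,1)`, obtained by glueing four affine toric surfaces in a cycle along their axes.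
An element is a quadruple `(f₀, f₁, f₂, f₃)` of regular functions on the four surfaces:

* `S₀` is the plane with coordinates `(x₀, y₀)`;
* `S₁` is the quotient of the `(u,v)`-plane by `1/r (α,1)`, with axes `x₀ = u ^ r`, `ξ = v ^ r`;
* `S₂` is the plane with coordinates `(ξ, η)`;
* `S₃` is the quotient of the `(u,v)`-plane by `1/s (β,1)`, with axes `y₀ = u ^ s`, `η = v ^ s`,

such that the functions agree along the `x₀`-, `ξ`-, `η`- and `y₀`-axes. -/
def tentRing (r α s β : ℕ) : Subalgebra ℂ (Fin 4 → Poly2) where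
  carrier := {f |
    cyclicAction r α (f 1) = f 1 ∧
    cyclicAction s β (f 3) = f 3 ∧
    restrFst 1 (f 1) = restrFst r (f 0) ∧
    restrSnd 1 (f 1) = restrFst r (f 2) ∧
    restrSnd 1 (f 3) = restrSnd s (f 2) ∧
    restrFst 1 (f 3) = restrSnd s (f 0)}
  mul_mem' := by
    rintro f g ⟨h1, h2, h3, h4, h5, h6⟩ ⟨k1, k2, k3, k4, k5, k6⟩
    simp only [Set.mem_ofPred_eq, Pi.mul_apply, map_mul]
    exact ⟨by rw [h1, k1], by rw [h2, k2], by rw [h3, k3], by rw [h4, k4], by rw [h5, k5],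
      by rw [h6, k6]⟩
  add_mem' := by
    rintro f g ⟨h1, h2, h3, h4, h5, h6⟩ ⟨k1, k2, k3, k4, k5, k6⟩
    simp only [Set.mem_ofPred_eq, Pi.add_apply, map_add]
    exact ⟨by rw [h1, k1], by rw [h2, k2], by rw [h3, k3], by rw [h4, k4], by rw [h5, k5],
      by rw [h6, k6]⟩
  algebraMap_mem' := by
    intro c
    simp only [Set.mem_ofPred_eq, Pi.algebraMap_apply, AlgHom.commutes, and_self]

/-- The coordinate function `x₀` on the tent. -/
def coordX0 (r : ℕ) : Fin 4 → Poly2 := ![X 0, X 0 ^ r, 0, 0]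

/-- The coordinate function `ξ` on the tent. -/
def coordXi (r : ℕ) : Fin 4 → Poly2 := ![0, X 1 ^ r, X 0, 0]

/-- The coordinate function `η` on the tent. -/
def coordEta (s : ℕ) : Fin 4 → Poly2 := ![0, 0, X 1, X 1 ^ s]

/-- The coordinate function `y₀` on the tent. -/
def coordY0 (s : ℕ) : Fin 4 → Poly2 := ![X 1, 0, 0, X 0 ^ s]

/-- The value of a function on the tent at the point of the `ξ`-axis where `ξ = t`. -/
def evalXiAxis (t : ℂ) (f : Fin 4 → Poly2) : ℂ := eval ![t, 0] (f 2)

/-- The value of a function on the tent at the point of the `η`-axis where `η = t`. -/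
def evalEtaAxis (t : ℂ) (f : Fin 4 → Poly2) : ℂ := eval ![0, t] (f 2)

/-- The monomial lattice `𝕄 = ℤ⁴`. -/
abbrev Lattice : Type := Fin 4 → ℤ

/-- The embedding `𝕄 → 𝕄_ℝ = ℝ⁴`. -/
def toReal (m : Lattice) : Fin 4 → ℝ := fun i => (m i : ℝ)

/-- The monoid `𝕄 ∩ σ` of lattice points of a cone. -/
def latticePoints (σ : PointedCone ℝ (Fin 4 → ℝ)) : AddSubmonoid Lattice where
  carrier := {m | toReal m ∈ σ}
  zero_mem' := by
    have h : toReal 0 = 0 := by funext i; simp [toReal]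
    simp [h]
  add_mem' := by
    intro m n hm hn
    have h : toReal (m + n) = toReal m + toReal n := by funext i; simp [toReal]
    simpa only [Set.mem_ofPred_eq, h] using σ.add_mem hm hn

/-- The coordinate ring `ℂ[𝕄 ∩ σ]` of the affine toric variety `V_{𝕄,σ}`. -/
abbrev toricRing (σ : PointedCone ℝ (Fin 4 → ℝ)) : Type :=
  AddMonoidAlgebra ℂ (latticePoints σ)

/-- The monomial in `ℂ[𝕄 ∩ σ]` with a given exponent. -/
def mono {σ : PointedCone ℝ (Fin 4 → ℝ)} (p : latticePoints σ) : toricRing σ :=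
  AddMonoidAlgebra.single p 1

/-- The affine scheme `Spec S` is smooth over `ℂ` at the complex point `x : S → ℂ`. -/
def SmoothAtPoint {S : Type*} [CommRing S] [Algebra ℂ S] (x : S →ₐ[ℂ] ℂ) : Prop :=
  haveI : (RingHom.ker x).IsPrime := RingHom.ker_isPrime x
  Algebra.IsSmoothAt ℂ (RingHom.ker x)

/-- A toric deformation `T ⊂ V` of the tent `T` over the plane with coordinates `A, B`:
the total space `V = Spec ℂ[𝕄 ∩ σ]` is a (normal) affine toric 4-fold, `A, B` are monomials forming
a regular sequence on `V`, and `T ⊂ V` is the closed subscheme `A = B = 0`. The embedding is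
equivariant on every component `S_j` of `T`, that is, every monomial on `V` restricts to a scalar
multiple (possibly zero) of a monomial on `S_j`. As `A, B` are monomials, `T` is a union of
toric strata of `V`. -/
structure ToricDeformation (r α s β : ℕ) where
  /-- the monomial cone of `V` -/
  cone : PointedCone ℝ (Fin 4 → ℝ)
  rational : ∃ G : Finset Lattice, cone = PointedCone.hull ℝ (toReal '' (G : Set Lattice))
  fullDim : Submodule.span ℝ (cone : Set (Fin 4 → ℝ)) = ⊤
  /-- exponent of the parameter `A` -/
  A : latticePoints cone
  /-- exponent of the parameter `B` -/
  B : latticePoints cone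
  /-- the restriction of functions from `V` to `T` -/
  restrict : toricRing cone →ₐ[ℂ] tentRing r α s β
  restrict_surjective : Function.Surjective restrict
  ker_restrict : RingHom.ker restrict = Ideal.span {mono A, mono B}
  regular : RingTheory.Sequence.IsRegular (toricRing cone) [mono A, mono B]
  equivariant : ∀ (p : latticePoints cone) (j : Fin 4), ∃ (m : Fin 2 →₀ ℕ) (c : ℂ),
    (restrict (mono p) : Fin 4 → Poly2) j = monomial m c

namespace ToricDeformation

variable {r α s β : ℕ}

/-- The parameter `A` smooths the `ξ`-axis: the total space of the one-parameter deformation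
`(B = 0) ⊂ V` of `T` is smooth over `ℂ` at every point of the `ξ`-axis other than the origin. -/
def SmoothsXi (D : ToricDeformation r α s β) : Prop :=
  ∀ t : ℂ, t ≠ 0 → ∀ x : (toricRing D.cone ⧸ Ideal.span {mono D.B}) →ₐ[ℂ] ℂ,
    (∀ f : toricRing D.cone, x (Ideal.Quotient.mk _ f) = evalXiAxis t (D.restrict f)) →
    SmoothAtPoint x

/-- The parameter `B` smooths the `η`-axis: the total space of the one-parameter deformation
`(A = 0) ⊂ V` of `T` is smooth over `ℂ` at every point of the `η`-axis other than the origin. -/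
def SmoothsEta (D : ToricDeformation r α s β) : Prop :=
  ∀ t : ℂ, t ≠ 0 → ∀ x : (toricRing D.cone ⧸ Ideal.span {mono D.A}) →ₐ[ℂ] ℂ,
    (∀ f : toricRing D.cone, x (Ideal.Quotient.mk _ f) = evalEtaAxis t (D.restrict f)) →
    SmoothAtPoint x

/-- Isomorphism of toric deformations of `T`: an isomorphism of the total spaces that maps
monomials to scalar multiples of monomials, in particular the parameters `A, B` to nonzero scalar
multiples of the parameters `A, B`, and that is the identity on `T`. -/
def Iso (D D' : ToricDeformation r α s β) : Prop :=
  ∃ φ : toricRing D.cone ≃ₐ[ℂ] toricRing D'.cone,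
    (∀ p, ∃ (q : latticePoints D'.cone) (c : ℂ), φ (mono p) = c • mono q) ∧
    (∃ c : ℂ, c ≠ 0 ∧ φ (mono D.A) = c • mono D'.A) ∧
    (∃ c : ℂ, c ≠ 0 ∧ φ (mono D.B) = c • mono D'.B) ∧
    ∀ f, D'.restrict (φ f) = D.restrict f

/-- The monomial on `V` with exponent `p` restricts on `T` to the function `f`, up to a nonzero
scalar. -/
def Lifts (D : ToricDeformation r α s β) (p : latticePoints D.cone) (f : Fin 4 → Poly2) : Prop :=
  ∃ c : ℂ, c ≠ 0 ∧ (D.restrict (mono p) : Fin 4 → Poly2) = c • f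

/-- The deformation `T ⊂ V` is `T ⊂ V_{AB}` for the matrix `(r a; b s)`: there are monomials
`x₀, y₀, ξ, η` on `V` restricting to the coordinates of the same name on `T`, such that
`ξ, η, A, B` is a basis of `𝕄`, the relations
`x₀ = (A η⁻¹) ^ r ξ ^ a` and `y₀ = η ^ b (B ξ⁻¹) ^ s` hold in `𝕄` (written additively), and
the monomial cone of `V` is spanned by `ξ, η, A, B, x₀, y₀`. -/
def HasMatrix (D : ToricDeformation r α s β) (g : Matrix.SpecialLinearGroup (Fin 2) ℤ) : Prop :=
  ∃ x₀ y₀ ξ η : latticePoints D.cone,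
    D.Lifts x₀ (coordX0 r) ∧ D.Lifts y₀ (coordY0 s) ∧
    D.Lifts ξ (coordXi r) ∧ D.Lifts η (coordEta s) ∧
    LinearIndependent ℤ ![(ξ : Lattice), η, D.A, D.B] ∧
    Submodule.span ℤ {(ξ : Lattice), (η : Lattice), (D.A : Lattice), (D.B : Lattice)} = ⊤ ∧
    (x₀ : Lattice) = g 0 0 • ((D.A : Lattice) - η) + g 0 1 • (ξ : Lattice) ∧
    (y₀ : Lattice) = g 1 0 • (η : Lattice) + g 1 1 • ((D.B : Lattice) - ξ) ∧
    D.cone = PointedCone.hull ℝ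
      (toReal '' {(ξ : Lattice), (η : Lattice), (D.A : Lattice), (D.B : Lattice),
        (x₀ : Lattice), (y₀ : Lattice)})

end ToricDeformation

/-- The toric deformations of `T` that smooth its top axes, `A` smoothing the `ξ`-axis and `B`
smoothing the `η`-axis. -/
abbrev TopSmoothing (r α s β : ℕ) : Type :=
  {D : ToricDeformation r α s β // D.SmoothsXi ∧ D.SmoothsEta}

/-- The matrices `(r a; b s)` in `SL(2,ℤ)` with `a, b ≥ 0`, `a ≡ α mod r` and `b ≡ β mod s`. -/
def matrices (r α s β : ℕ) : Set (Matrix.SpecialLinearGroup (Fin 2) ℤ) :=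
  {g | g 0 0 = r ∧ g 1 1 = s ∧ 0 ≤ g 0 1 ∧ 0 ≤ g 1 0 ∧
    g 0 1 ≡ α [ZMOD r] ∧ g 1 0 ≡ β [ZMOD s]}

end Tent

end

/-! ### Coefficients of functions on the tent -/

noncomputable section

namespace Tent

open MvPolynomial

/-! Necessity of the matrix. The monomials of `V` that do not vanish on `S_j` form a face of `𝕄 ∩
σ`. Since the restriction to `T` is onto and its kernel is the monomial ideal `(A, B)`, such a
monomial is determined by its exponent on `S_j` (`expo_injective`), and every monomial function on
`S_j` arises. In particular the axis coordinates lift to unique monomials `x₀, y₀, ξ, η`. A monomial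
off the face of `S₀` becomes divisible by `A` or `B` after multiplication with `x₀ y₀`. Together
with Gordan's lemma this writes every monomial as `x₀^m y₀^n A^i B^j` with integers `m, n` and `i, j
≥ 0`, so `x₀, y₀, A, B` is a basis of `𝕄` (`exists_bottom_decomposition`).

Along the `ξ`-axis `T` consists of `S₁` and `S₂` crossing transversally. If `w` is the monomial `u
v^(2r-α)` of `S₁`, then `w η` vanishes on `T`. Smoothness of `(B = 0)` makes this product nonzero to
second order, which leaves only `w η = A ξ^n` (`SmoothsXi.relation`). Eliminating `w` by `w^r = x₀
ξ^(2r-α)` gives `x₀ = (A η⁻¹)^r ξ^a` with `a = rn - 2r + α`; the `η`-axis gives `y₀` and `b` in the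
same way. Hence `ξ, η, A, B` is a basis too, and the base change has determinant `±(rs - ab)`. The
exponents of `A` and `B` in the bottom decompositions of `ξ` and `η` are nonnegative; this fixes the
sign and gives `a, b ≥ 0` (`int_det_of_inverse`).

Uniqueness. The cone is spanned by the six monomials, so the matrix determines it in the basis `ξ,
η, A, B`. The scalars by which two embeddings of `T` differ are absorbed by a character of `𝕄`
(`Frame.iso`). Conversely an isomorphism over `T` respects the six monomials up to scalars, hence
the matrix.

Existence. The cone of a matrix is cut out by six linear forms: three are `1` on `A` and `0` on `B`,
three the other way round. A lattice point from which neither `A` nor `B` can be subtracted lies on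
one of four two-dimensional faces (`FacetIneq.face_or_sub`), and these are glued like the components
of `T`. Once `ξ` is inverted, all monomials have nonnegative exponents in `η`, `A η⁻¹ ξ^a` and `B`,
whence smoothness.

Part (ii) holds because `ab = rs - 1 < rs` forces `a < r` or `b < s`, and a small entry is
determined by its residue. -/

/-- The exponent vector `(i, k)`. -/
def expVec (i k : ℕ) : Fin 2 →₀ ℕ := Finsupp.single 0 i + Finsupp.single 1 k

@[simp] lemma expVec_zero (i k : ℕ) : expVec i k 0 = i := by simp [expVec]

@[simp] lemma expVec_one (i k : ℕ) : expVec i k 1 = k := by simp [expVec]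

lemma expVec_ext {m n : Fin 2 →₀ ℕ} (h0 : m 0 = n 0) (h1 : m 1 = n 1) : m = n := by
  ext i; fin_cases i <;> assumption

lemma expVec_eta (m : Fin 2 →₀ ℕ) : expVec (m 0) (m 1) = m := expVec_ext (by simp) (by simp)

lemma monomial_expVec (i k : ℕ) (c : ℂ) :
    (monomial (expVec i k) c : Poly2) = C c * X 0 ^ i * X 1 ^ k := by
  rw [expVec, C_mul_X_pow_eq_monomial, X_pow_eq_monomial, monomial_mul, mul_one]

lemma restrFst_monomial (n : ℕ) (m : Fin 2 →₀ ℕ) (c : ℂ) :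
    restrFst n (monomial m c) =
      if m 1 = 0 then Polynomial.monomial (n * m 0) c else 0 := by
  rw [← expVec_eta m, monomial_expVec, restrFst]
  simp only [map_mul, map_pow, aeval_X, algHom_C, expVec_zero, expVec_one]
  split_ifs with h
  · simp [h, ← pow_mul, Polynomial.C_mul_X_pow_eq_monomial]
  · simp [h]

lemma restrSnd_monomial (n : ℕ) (m : Fin 2 →₀ ℕ) (c : ℂ) :
    restrSnd n (monomial m c) =
      if m 0 = 0 then Polynomial.monomial (n * m 1) c else 0 := by
  rw [← expVec_eta m, monomial_expVec, restrSnd]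
  simp only [map_mul, map_pow, aeval_X, algHom_C, expVec_zero, expVec_one]
  split_ifs with h
  · simp [h, ← pow_mul, Polynomial.C_mul_X_pow_eq_monomial]
  · simp [h]

lemma coeff_restrFst {n : ℕ} (hn : 1 ≤ n) (k : ℕ) (f : Poly2) :
    (restrFst n f).coeff (n * k) = coeff (expVec k 0) f := by
  induction f using MvPolynomial.monomial_add_induction_on with
  | C a =>
    rw [← MvPolynomial.monomial_zero', restrFst_monomial, coeff_monomial]
    simp only [Finsupp.coe_zero, Pi.zero_apply, if_true, mul_zero, Polynomial.coeff_monomial]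
    have : (0 = n * k) ↔ ((0 : Fin 2 →₀ ℕ) = expVec k 0) := by
      constructor
      · intro h; apply expVec_ext <;> simp
        rcases mul_eq_zero.1 h.symm with h | h <;> omega
      · intro h
        have := DFunLike.congr_fun h 0
        simp at this; simp [← this]
    simp [this]
  | monomial_add m c f _ _ ih =>
    rw [map_add, Polynomial.coeff_add, ih, coeff_add, restrFst_monomial, coeff_monomial]
    congr 1
    by_cases h : m 1 = 0
    · have : (n * m 0 = n * k) ↔ (m = expVec k 0) := by
        constructor
        · intro h'; exact expVec_ext (by simpa using Nat.eq_of_mul_eq_mul_left hn h') (by simpa)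
        · rintro rfl; simp
      simp [h, Polynomial.coeff_monomial, this]
    · have : m ≠ expVec k 0 := by rintro rfl; simp at h
      simp [h, this]

lemma coeff_restrSnd {n : ℕ} (hn : 1 ≤ n) (k : ℕ) (f : Poly2) :
    (restrSnd n f).coeff (n * k) = coeff (expVec 0 k) f := by
  induction f using MvPolynomial.monomial_add_induction_on with
  | C a =>
    rw [← MvPolynomial.monomial_zero', restrSnd_monomial, coeff_monomial]
    simp only [Finsupp.coe_zero, Pi.zero_apply, if_true, mul_zero, Polynomial.coeff_monomial]
    have : (0 = n * k) ↔ ((0 : Fin 2 →₀ ℕ) = expVec 0 k) := by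
      constructor
      · intro h; apply expVec_ext <;> simp
        rcases mul_eq_zero.1 h.symm with h | h <;> omega
      · intro h
        have := DFunLike.congr_fun h 1
        simp at this; simp [← this]
    simp [this]
  | monomial_add m c f _ _ ih =>
    rw [map_add, Polynomial.coeff_add, ih, coeff_add, restrSnd_monomial, coeff_monomial]
    congr 1
    by_cases h : m 0 = 0
    · have : (n * m 1 = n * k) ↔ (m = expVec 0 k) := by
        constructor
        · intro h'; exact expVec_ext (by simpa) (by simpa using Nat.eq_of_mul_eq_mul_left hn h')
        · rintro rfl; simp
      simp [h, Polynomial.coeff_monomial, this]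
    · have : m ≠ expVec 0 k := by rintro rfl; simp at h
      simp [h, this]

lemma cyclicAction_monomial (r α : ℕ) (m : Fin 2 →₀ ℕ) (c : ℂ) :
    cyclicAction r α (monomial m c) =
      monomial m (Complex.exp (2 * Real.pi * Complex.I / r) ^ (α * m 0 + m 1) * c) := by
  rw [← expVec_eta m, monomial_expVec, monomial_expVec, cyclicAction]
  simp only [map_mul, map_pow, aeval_X, algHom_C, expVec_zero, expVec_one, algebraMap_eq,
    Matrix.cons_val_zero, Matrix.cons_val_one]
  ring

lemma coeff_cyclicAction (r α : ℕ) (m : Fin 2 →₀ ℕ) (f : Poly2) :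
    coeff m (cyclicAction r α f) =
      Complex.exp (2 * Real.pi * Complex.I / r) ^ (α * m 0 + m 1) * coeff m f := by
  induction f using MvPolynomial.induction_on' with
  | monomial n c =>
    rw [cyclicAction_monomial, coeff_monomial, coeff_monomial]
    split_ifs with h
    · rw [h]
    · simp
  | add p q hp hq => rw [map_add, coeff_add, hp, hq, coeff_add, mul_add]

lemma exp_pow_eq_one {r : ℕ} (hr : 1 ≤ r) (k : ℕ) :
    Complex.exp (2 * Real.pi * Complex.I / r) ^ k = 1 ↔ r ∣ k :=
  (Complex.isPrimitiveRoot_exp r (by omega)).pow_eq_one_iff_dvd k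

/-- The exponents of the monomials that are regular functions on the component `S_j`. -/
def Invariant (r α s β : ℕ) (j : Fin 4) (m : Fin 2 →₀ ℕ) : Prop :=
  (j = 1 → r ∣ α * m 0 + m 1) ∧ (j = 3 → s ∣ β * m 0 + m 1)

/-- The degrees of the axis coordinates in terms of the plane coordinates of `S_j`. -/
def axisDeg (r s : ℕ) (j : Fin 4) : ℕ := ![1, r, 1, s] j

section

variable {r α s β : ℕ}

/-- Monomials are eigenvectors of the cyclic actions, so an invariant function involves only those
with eigenvalue `1`. -/
lemma invariant_of_coeff_ne_zero (hr : 1 ≤ r) (hs : 1 ≤ s) {f : Fin 4 → Poly2}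
    (hf : f ∈ tentRing r α s β) {j : Fin 4} {m : Fin 2 →₀ ℕ} (h : coeff m (f j) ≠ 0) :
    Invariant r α s β j m := by
  obtain ⟨h1, h3, -⟩ := hf
  constructor
  · rintro rfl
    have := congrArg (coeff m) h1
    rw [coeff_cyclicAction] at this
    exact (exp_pow_eq_one hr _).1 (mul_right_cancel₀ h (by rw [this, one_mul]))
  · rintro rfl
    have := congrArg (coeff m) h3
    rw [coeff_cyclicAction] at this
    exact (exp_pow_eq_one hs _).1 (mul_right_cancel₀ h (by rw [this, one_mul]))

lemma cyclicAction_monomial_of_dvd (hr : 1 ≤ r) {m : Fin 2 →₀ ℕ} (h : r ∣ α * m 0 + m 1)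
    (c : ℂ) : cyclicAction r α (monomial m c) = monomial m c := by
  rw [cyclicAction_monomial, (exp_pow_eq_one hr _).2 h, one_mul]

/-- A monomial divisible by both coordinates vanishes on both axes and hence extends by zero to the
other components. These functions isolate a single component of the tent. -/
lemma single_mem_tentRing (hr : 1 ≤ r) (hs : 1 ≤ s) {j : Fin 4} {m : Fin 2 →₀ ℕ}
    (hm : Invariant r α s β j m) (h0 : 1 ≤ m 0) (h1 : 1 ≤ m 1) (c : ℂ) :
    (Pi.single j (monomial m c) : Fin 4 → Poly2) ∈ tentRing r α s β := by
  have h0' : m 0 ≠ 0 := by omega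
  have h1' : m 1 ≠ 0 := by omega
  obtain ⟨k1, k3⟩ := hm
  refine ⟨?_, ?_, ?_, ?_, ?_, ?_⟩ <;> fin_cases j <;>
    simp [restrFst_monomial, restrSnd_monomial, h0', h1']
  · exact cyclicAction_monomial_of_dvd hr (k1 rfl) c
  · exact cyclicAction_monomial_of_dvd hs (k3 rfl) c

lemma X_pow_eq_monomial_expVec_left (n : ℕ) : (X 0 ^ n : Poly2) = monomial (expVec n 0) 1 := by
  simp [monomial_expVec]

lemma X_pow_eq_monomial_expVec_right (n : ℕ) : (X 1 ^ n : Poly2) = monomial (expVec 0 n) 1 := by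
  simp [monomial_expVec]

lemma cyclicAction_X_zero_pow (hr : 1 ≤ r) : cyclicAction r α (X 0 ^ r) = X 0 ^ r := by
  rw [X_pow_eq_monomial_expVec_left]
  exact cyclicAction_monomial_of_dvd hr (by simp) 1

lemma cyclicAction_X_one_pow (hr : 1 ≤ r) : cyclicAction r α (X 1 ^ r) = X 1 ^ r := by
  rw [X_pow_eq_monomial_expVec_right]
  exact cyclicAction_monomial_of_dvd hr (by simp) 1

lemma coordX0_mem (hr : 1 ≤ r) : coordX0 r ∈ tentRing r α s β := by
  have hr' : r ≠ 0 := by omega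
  refine ⟨?_, ?_, ?_, ?_, ?_, ?_⟩ <;>
    simp [coordX0, restrFst, restrSnd, cyclicAction_X_zero_pow hr, hr']

lemma coordXi_mem (hr : 1 ≤ r) : coordXi r ∈ tentRing r α s β := by
  have hr' : r ≠ 0 := by omega
  refine ⟨?_, ?_, ?_, ?_, ?_, ?_⟩ <;>
    simp [coordXi, restrFst, restrSnd, cyclicAction_X_one_pow hr, hr']

lemma coordEta_mem (hs : 1 ≤ s) : coordEta s ∈ tentRing r α s β := by
  have hs' : s ≠ 0 := by omega
  refine ⟨?_, ?_, ?_, ?_, ?_, ?_⟩ <;>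
    simp [coordEta, restrFst, restrSnd, cyclicAction_X_one_pow hs, hs']

lemma coordY0_mem (hs : 1 ≤ s) : coordY0 s ∈ tentRing r α s β := by
  have hs' : s ≠ 0 := by omega
  refine ⟨?_, ?_, ?_, ?_, ?_, ?_⟩ <;>
    simp [coordY0, restrFst, restrSnd, cyclicAction_X_zero_pow hs, hs']

/-- The glueing conditions, read off coefficient by coefficient; likewise for the three other axes.
-/
lemma coeff_x₀_axis (hr : 1 ≤ r) {f : Fin 4 → Poly2} (hf : f ∈ tentRing r α s β) (k : ℕ) :
    coeff (expVec (r * k) 0) (f 1) = coeff (expVec k 0) (f 0) := by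
  rw [← coeff_restrFst hr k (f 0), ← hf.2.2.1, ← coeff_restrFst le_rfl, one_mul]

lemma coeff_ξ_axis (hr : 1 ≤ r) {f : Fin 4 → Poly2} (hf : f ∈ tentRing r α s β) (k : ℕ) :
    coeff (expVec 0 (r * k)) (f 1) = coeff (expVec k 0) (f 2) := by
  rw [← coeff_restrFst hr k (f 2), ← hf.2.2.2.1, ← coeff_restrSnd le_rfl, one_mul]

lemma coeff_η_axis (hs : 1 ≤ s) {f : Fin 4 → Poly2} (hf : f ∈ tentRing r α s β) (k : ℕ) :
    coeff (expVec 0 (s * k)) (f 3) = coeff (expVec 0 k) (f 2) := by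
  rw [← coeff_restrSnd hs k (f 2), ← hf.2.2.2.2.1, ← coeff_restrSnd le_rfl, one_mul]

lemma coeff_y₀_axis (hs : 1 ≤ s) {f : Fin 4 → Poly2} (hf : f ∈ tentRing r α s β) (k : ℕ) :
    coeff (expVec (s * k) 0) (f 3) = coeff (expVec 0 k) (f 0) := by
  rw [← coeff_restrSnd hs k (f 0), ← hf.2.2.2.2.2, ← coeff_restrFst le_rfl, one_mul]

end

end Tent

end

/-! ### Monomials of a deformation and the components of the tent -/

noncomputable section

namespace Tent

open MvPolynomial

section Mono

variable {σ : PointedCone ℝ (Fin 4 → ℝ)}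

lemma mono_add (p q : latticePoints σ) : (mono (p + q) : toricRing σ) = mono p * mono q := by
  simp [mono]

lemma mono_zero : (mono 0 : toricRing σ) = 1 := rfl

lemma mono_nsmul (n : ℕ) (p : latticePoints σ) : (mono (n • p) : toricRing σ) = mono p ^ n := by
  induction n with
  | zero => rw [zero_nsmul, mono_zero, pow_zero]
  | succ n ih => rw [succ_nsmul, mono_add, ih, pow_succ]

lemma sum_coeff_mono (f : toricRing σ) :
    f = ∑ p ∈ f.coeff.support, f.coeff p • mono p := by
  conv_lhs => rw [← AddMonoidAlgebra.sum_coeff_single f]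
  refine Finset.sum_congr rfl fun p _ => ?_
  simp [mono]

lemma algHom_ext_mono {R : Type*} [CommRing R] [Algebra ℂ R] {f g : toricRing σ →ₐ[ℂ] R}
    (h : ∀ p, f (mono p) = g (mono p)) : f = g := by
  refine AlgHom.ext fun x => ?_
  rw [sum_coeff_mono x]
  simp [h]

lemma eq_of_smul_mono_eq {p q : latticePoints σ} {c d : ℂ} (hc : c ≠ 0)
    (h : c • (mono p : toricRing σ) = d • mono q) : p = q := by
  by_contra hpq
  have := congrArg (fun f => AddMonoidAlgebra.coeff f p) h
  simp [mono, Ne.symm hpq, hc] at this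

lemma mem_span_pair {A B : latticePoints σ} {f : toricRing σ} :
    f ∈ Ideal.span {mono A, mono B} ↔
      ∀ p ∈ f.coeff.support, (∃ q, p = A + q) ∨ ∃ q, p = B + q := by
  have : ({mono A, mono B} : Set (toricRing σ)) =
      AddMonoidAlgebra.of' ℂ (latticePoints σ) '' {A, B} := by
    rw [Set.image_pair]; rfl
  rw [this, AddMonoidAlgebra.mem_ideal_span_of'_image]
  simp [add_comm]

lemma mem_span_singleton {B : latticePoints σ} {f : toricRing σ} :
    f ∈ Ideal.span {mono B} ↔ ∀ p ∈ f.coeff.support, ∃ q, p = B + q := by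
  have : ({mono B} : Set (toricRing σ)) =
      AddMonoidAlgebra.of' ℂ (latticePoints σ) '' {B} := by
    rw [Set.image_singleton]; rfl
  rw [this, AddMonoidAlgebra.mem_ideal_span_of'_image]
  simp [add_comm]

lemma support_mono (p : latticePoints σ) :
    (mono p : toricRing σ).coeff.support = {p} := by
  simp [mono]

end Mono

namespace ToricDeformation

variable {r α s β : ℕ} (D : ToricDeformation r α s β)

/-- The restriction of a monomial to the component `S_j`. -/
def comp (p : latticePoints D.cone) (j : Fin 4) : Poly2 :=
  (D.restrict (mono p) : Fin 4 → Poly2) j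

/-- The monomial does not vanish on `S_j`. -/
def OnFace (j : Fin 4) (p : latticePoints D.cone) : Prop := D.comp p j ≠ 0

/-- The exponent of the restriction of a monomial to `S_j`. -/
def expo (j : Fin 4) (p : latticePoints D.cone) : Fin 2 →₀ ℕ := (D.equivariant p j).choose

/-- The coefficient of the restriction of a monomial to `S_j`. -/
def coef (j : Fin 4) (p : latticePoints D.cone) : ℂ := (D.equivariant p j).choose_spec.choose

lemma comp_eq (p : latticePoints D.cone) (j : Fin 4) :
    D.comp p j = monomial (D.expo j p) (D.coef j p) :=
  (D.equivariant p j).choose_spec.choose_spec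

variable {D}

lemma onFace_iff {j : Fin 4} {p : latticePoints D.cone} : D.OnFace j p ↔ D.coef j p ≠ 0 := by
  rw [OnFace, comp_eq, Ne, monomial_eq_zero]

lemma comp_mem (p : latticePoints D.cone) : D.comp p ∈ tentRing r α s β :=
  (D.restrict (mono p)).2

lemma comp_add (p q : latticePoints D.cone) (j : Fin 4) :
    D.comp (p + q) j = D.comp p j * D.comp q j := by
  simp only [comp, mono_add, map_mul]; rfl

lemma comp_zero (j : Fin 4) : D.comp 0 j = 1 := by
  simp only [comp, mono_zero, map_one]; rfl

/-- The polynomial ring is a domain; therefore the monomials that survive on a component form a face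
of the monoid. -/
lemma onFace_add {j : Fin 4} {p q : latticePoints D.cone} :
    D.OnFace j (p + q) ↔ D.OnFace j p ∧ D.OnFace j q := by
  simp only [OnFace, comp_add, mul_ne_zero_iff]

lemma onFace_zero (j : Fin 4) : D.OnFace j 0 := by
  simp [OnFace, comp_zero]

lemma onFace_nsmul {j : Fin 4} {p : latticePoints D.cone} (h : D.OnFace j p) (n : ℕ) :
    D.OnFace j (n • p) := by
  induction n with
  | zero => simpa using onFace_zero j
  | succ n ih => rw [succ_nsmul]; exact onFace_add.2 ⟨ih, h⟩

lemma onFace_of_nsmul {j : Fin 4} {p : latticePoints D.cone} {n : ℕ} (hn : n ≠ 0)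
    (h : D.OnFace j (n • p)) : D.OnFace j p := by
  obtain ⟨n, rfl⟩ := Nat.exists_eq_succ_of_ne_zero hn
  rw [succ_nsmul] at h
  exact (onFace_add.1 h).2

lemma monomial_data {m n : Fin 2 →₀ ℕ} {c d : ℂ} (hc : c ≠ 0)
    (h : (monomial m c : Poly2) = monomial n d) : m = n ∧ c = d := by
  rcases monomial_eq_monomial_iff _ _ _ _ |>.1 h with h | h
  · exact h
  · exact absurd h.1 hc

lemma expo_coef_of_comp_eq {j : Fin 4} {p : latticePoints D.cone} {m : Fin 2 →₀ ℕ} {c : ℂ}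
    (hc : c ≠ 0) (h : D.comp p j = monomial m c) :
    D.OnFace j p ∧ D.expo j p = m ∧ D.coef j p = c := by
  rw [comp_eq] at h
  obtain ⟨h1, h2⟩ := monomial_data hc h.symm
  exact ⟨onFace_iff.2 (h2 ▸ hc), h1.symm, h2.symm⟩

lemma expo_coef_add {j : Fin 4} {p q : latticePoints D.cone} (hp : D.OnFace j p)
    (hq : D.OnFace j q) : D.expo j (p + q) = D.expo j p + D.expo j q ∧
      D.coef j (p + q) = D.coef j p * D.coef j q := by
  refine (expo_coef_of_comp_eq (mul_ne_zero (onFace_iff.1 hp) (onFace_iff.1 hq)) ?_).2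
  rw [comp_add, comp_eq, comp_eq, monomial_mul]

lemma expo_add {j : Fin 4} {p q : latticePoints D.cone} (hp : D.OnFace j p)
    (hq : D.OnFace j q) : D.expo j (p + q) = D.expo j p + D.expo j q :=
  (expo_coef_add hp hq).1

lemma coef_add {j : Fin 4} {p q : latticePoints D.cone} (hp : D.OnFace j p)
    (hq : D.OnFace j q) : D.coef j (p + q) = D.coef j p * D.coef j q :=
  (expo_coef_add hp hq).2

lemma expo_zero (j : Fin 4) : D.expo j 0 = 0 :=
  (expo_coef_of_comp_eq (c := 1) one_ne_zero (by rw [comp_zero]; rfl)).2.1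

lemma coef_zero (j : Fin 4) : D.coef j 0 = 1 :=
  (expo_coef_of_comp_eq (m := 0) one_ne_zero (by rw [comp_zero]; rfl)).2.2

lemma expo_nsmul {j : Fin 4} {p : latticePoints D.cone} (hp : D.OnFace j p) (n : ℕ) :
    D.expo j (n • p) = n • D.expo j p := by
  induction n with
  | zero => simp [expo_zero]
  | succ n ih => rw [succ_nsmul, expo_add (onFace_nsmul hp n) hp, ih, succ_nsmul]

/-- A monomial vanishes on the whole tent precisely if it lies in the kernel, and membership in the
monomial ideal `(A, B)` is divisibility by `A` or by `B`. -/
lemma exists_onFace_iff {p : latticePoints D.cone} :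
    (∃ j, D.OnFace j p) ↔ ¬ ((∃ q, p = D.A + q) ∨ ∃ q, p = D.B + q) := by
  have h : D.restrict (mono p) = 0 ↔ mono p ∈ RingHom.ker D.restrict := Iff.rfl
  rw [D.ker_restrict, mem_span_pair, support_mono] at h
  simp only [Finset.mem_singleton, forall_eq] at h
  rw [← h, ← not_forall_not]
  simp only [OnFace, not_not, Subtype.ext_iff, funext_iff]
  rfl

lemma not_onFace_A (j : Fin 4) (q : latticePoints D.cone) : ¬ D.OnFace j (D.A + q) := fun h =>
  exists_onFace_iff.1 ⟨j, h⟩ (.inl ⟨q, rfl⟩)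

lemma not_onFace_B (j : Fin 4) (q : latticePoints D.cone) : ¬ D.OnFace j (D.B + q) := fun h =>
  exists_onFace_iff.1 ⟨j, h⟩ (.inr ⟨q, rfl⟩)

lemma restrict_apply (f : toricRing D.cone) (j : Fin 4) :
    (D.restrict f : Fin 4 → Poly2) j =
      ∑ p ∈ f.coeff.support, monomial (D.expo j p) (f.coeff p * D.coef j p) := by
  conv_lhs => rw [sum_coeff_mono f]
  simp only [map_sum, map_smul, AddSubmonoidClass.coe_finsetSum, Finset.sum_apply]
  refine Finset.sum_congr rfl fun p _ => ?_
  change f.coeff p • D.comp p j = _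
  rw [comp_eq, smul_monomial, smul_eq_mul]

lemma coeff_restrict_eq_zero {f : toricRing D.cone} (hf : D.restrict f = 0)
    {j : Fin 4} {p : latticePoints D.cone} (hp : D.OnFace j p) : f.coeff p = 0 := by
  by_contra h
  have : f ∈ RingHom.ker D.restrict := hf
  rw [D.ker_restrict, mem_span_pair] at this
  exact exists_onFace_iff.1 ⟨j, hp⟩ (this p (by simpa using h))

lemma exists_restrict_eq_single (hr : 1 ≤ r) (hs : 1 ≤ s) {j : Fin 4} {m : Fin 2 →₀ ℕ}
    (hm : Invariant r α s β j m) (h0 : 1 ≤ m 0) (h1 : 1 ≤ m 1) :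
    ∃ f : toricRing D.cone,
      (D.restrict f : Fin 4 → Poly2) = Pi.single j (monomial m 1) := by
  obtain ⟨f, hf⟩ := D.restrict_surjective ⟨_, single_mem_tentRing hr hs hm h0 h1 1⟩
  exact ⟨f, by rw [hf]⟩

/-- If the exponents agreed, a combination `g` of the two monomials would vanish on `S_j`. Its
product with a function `f` living on `S_j` only would vanish on all of `T`, so no monomial of `g *
f` could survive on a component. An extremal monomial of `f` produces one that does. -/
lemma expo_ne_of_lt (hr : 1 ≤ r) (hs : 1 ≤ s) {j : Fin 4} {p q : latticePoints D.cone}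
    (hp : D.OnFace j p) (hq : D.OnFace j q) {i : Fin 4} (hi : (q : Lattice) i < (p : Lattice) i) :
    D.expo j p ≠ D.expo j q := by
  intro hpq
  classical
  have hrs : 1 ≤ r * s := Nat.mul_pos hr hs
  -- The exponent `(rs, rs)` is invariant for both cyclic actions, so it serves for all `j` at once.
  obtain ⟨f, hf⟩ := D.exists_restrict_eq_single hr hs (j := j) (m := expVec (r * s) (r * s))
    ⟨fun _ => by simpa using ⟨α * s + s, by ring⟩, fun _ => by simpa using ⟨β * r + r, by ring⟩⟩
    (by simpa using hrs) (by simpa using hrs)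
  have hne : (f.coeff.support.filter (D.OnFace j)).Nonempty := by
    by_contra h
    rw [Finset.not_nonempty_iff_eq_empty, Finset.filter_eq_empty_iff] at h
    have h2 := congrFun hf j
    rw [restrict_apply, Finset.sum_eq_zero, Pi.single_eq_same] at h2
    · exact one_ne_zero (monomial_eq_zero.1 h2.symm)
    · intro k hk
      have := h hk
      rw [onFace_iff, not_not] at this
      rw [this, mul_zero, map_zero]
  -- With `k` maximal in the coordinate `i`, where `p` exceeds `q`, the monomial `p + k` cannot come
  -- from `q` times a monomial of `f` on the face: that one would have a larger coordinate.
  obtain ⟨k, hk, hmax⟩ := Finset.exists_max_image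
    (f.coeff.support.filter (D.OnFace j)) (fun k => (k : Lattice) i) hne
  rw [Finset.mem_filter, Finsupp.mem_support_iff] at hk
  set g : toricRing D.cone := D.coef j q • mono p - D.coef j p • mono q with hg
  have hgf : D.restrict (g * f) = 0 := by
    ext1; funext j'
    rw [map_mul, MulMemClass.coe_mul, hf, Pi.mul_apply]
    by_cases hj : j' = j
    · subst hj
      have : (D.restrict g : Fin 4 → Poly2) j' = 0 := by
        rw [hg, map_sub, map_smul, map_smul]
        change D.coef j' q • D.comp p j' - D.coef j' p • D.comp q j' = 0
        rw [comp_eq, comp_eq, hpq, smul_monomial, smul_monomial, smul_eq_mul, smul_eq_mul,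
          mul_comm, sub_self]
      rw [this, zero_mul]; rfl
    · rw [Pi.single_eq_of_ne hj, mul_zero]; rfl
  have h0 := coeff_restrict_eq_zero hgf (onFace_add.2 ⟨hp, hk.2⟩)
  have e1 : (mono p * f).coeff (p + k) = f.coeff k := by
    rw [mono, AddMonoidAlgebra.coeff_single_mul_add, one_mul]
  have e2 : (mono q * f).coeff (p + k) = 0 := by
    by_cases h : ∃ k', q + k' = p + k
    · obtain ⟨k', hk'⟩ := h
      rw [← hk', mono, AddMonoidAlgebra.coeff_single_mul_add, one_mul]
      by_contra hne
      have hF : D.OnFace j (q + k') := hk' ▸ onFace_add.2 ⟨hp, hk.2⟩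
      have := hmax k' (by
        rw [Finset.mem_filter, Finsupp.mem_support_iff]
        exact ⟨hne, (onFace_add.1 hF).2⟩)
      have h3 : (q : Lattice) i + (k' : Lattice) i = (p : Lattice) i + (k : Lattice) i :=
        congrFun (congrArg Subtype.val hk') i
      omega
    · push Not at h
      rw [mono, AddMonoidAlgebra.coeff_single_mul_of_forall_add_ne _ _ h]
  rw [hg, sub_mul, smul_mul_assoc, smul_mul_assoc, AddMonoidAlgebra.coeff_sub, Finsupp.sub_apply,
    AddMonoidAlgebra.coeff_smul_apply, AddMonoidAlgebra.coeff_smul_apply, e1, e2] at h0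
  simp only [smul_eq_mul, mul_zero, sub_zero, mul_eq_zero] at h0
  exact h0.elim (onFace_iff.1 hq) hk.1

lemma expo_injective (hr : 1 ≤ r) (hs : 1 ≤ s) {j : Fin 4} {p q : latticePoints D.cone}
    (hp : D.OnFace j p) (hq : D.OnFace j q) (h : D.expo j p = D.expo j q) : p = q := by
  by_contra hne
  obtain ⟨i, hi⟩ := Function.ne_iff.1 (fun h' => hne (Subtype.ext h') : (p : Lattice) ≠ q)
  rcases lt_or_gt_of_ne hi with hi | hi
  · exact expo_ne_of_lt hr hs hq hp hi h.symm
  · exact expo_ne_of_lt hr hs hp hq hi h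

/-- By injectivity of the exponents no other monomial contributes to this coefficient. -/
lemma coeff_restrict (hr : 1 ≤ r) (hs : 1 ≤ s) {j : Fin 4} {p : latticePoints D.cone}
    (hp : D.OnFace j p) (f : toricRing D.cone) :
    coeff (D.expo j p) ((D.restrict f : Fin 4 → Poly2) j) = f.coeff p * D.coef j p := by
  classical
  rw [restrict_apply, coeff_sum, Finset.sum_eq_single p]
  · simp
  · intro q _ hqp
    rw [coeff_monomial]
    split_ifs with h
    · by_cases hq : D.OnFace j q
      · exact absurd (expo_injective hr hs hq hp h) hqp
      · rw [onFace_iff, not_not] at hq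
        rw [hq, mul_zero]
    · rfl
  · intro h
    rw [Finsupp.notMem_support_iff] at h
    simp [h]

lemma exists_expo_eq (F : tentRing r α s β) {j : Fin 4} {m : Fin 2 →₀ ℕ}
    (h : coeff m ((F : Fin 4 → Poly2) j) ≠ 0) :
    ∃ p : latticePoints D.cone, D.OnFace j p ∧ D.expo j p = m := by
  classical
  obtain ⟨f, rfl⟩ := D.restrict_surjective F
  rw [restrict_apply, coeff_sum] at h
  obtain ⟨p, -, hp⟩ := Finset.exists_ne_zero_of_sum_ne_zero h
  rw [coeff_monomial] at hp
  split_ifs at hp with h'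
  · exact ⟨p, onFace_iff.2 (right_ne_zero_of_mul hp), h'⟩
  · exact absurd rfl hp

/-- Both coefficients are nonzero multiples of the coefficient of one and the same monomial in a
lift of `F` to `V`. -/
lemma coeff_ne_zero_of_onFace (hr : 1 ≤ r) (hs : 1 ≤ s) (F : tentRing r α s β) {j j' : Fin 4}
    {p : latticePoints D.cone} (hp : D.OnFace j p) (hp' : D.OnFace j' p)
    (h : coeff (D.expo j p) ((F : Fin 4 → Poly2) j) ≠ 0) :
    coeff (D.expo j' p) ((F : Fin 4 → Poly2) j') ≠ 0 := by
  obtain ⟨f, rfl⟩ := D.restrict_surjective F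
  rw [coeff_restrict hr hs hp] at h
  rw [coeff_restrict hr hs hp']
  exact mul_ne_zero (left_ne_zero_of_mul h) (onFace_iff.1 hp')

lemma invariant_expo (hr : 1 ≤ r) (hs : 1 ≤ s) {j : Fin 4} {p : latticePoints D.cone}
    (hp : D.OnFace j p) : Invariant r α s β j (D.expo j p) := by
  refine invariant_of_coeff_ne_zero hr hs (D.comp_mem p) ?_
  rw [comp_eq, coeff_monomial, if_pos rfl]
  exact onFace_iff.1 hp

/-- A monomial that is not a power of an axis coordinate lives on one component only. -/
lemma eq_of_onFace_of_interior (hr : 1 ≤ r) (hs : 1 ≤ s) {j j' : Fin 4}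
    {p : latticePoints D.cone} (hp : D.OnFace j p) (h0 : 1 ≤ D.expo j p 0)
    (h1 : 1 ≤ D.expo j p 1) (hp' : D.OnFace j' p) : j' = j := by
  by_contra hne
  have := coeff_ne_zero_of_onFace hr hs
    ⟨_, single_mem_tentRing hr hs (invariant_expo hr hs hp) h0 h1 1⟩ hp hp' (by simp)
  simp [Pi.single_eq_of_ne hne] at this

lemma exists_expo_eq_of_interior (hr : 1 ≤ r) (hs : 1 ≤ s) {j : Fin 4} {m : Fin 2 →₀ ℕ}
    (hm : Invariant r α s β j m) (h0 : 1 ≤ m 0) (h1 : 1 ≤ m 1) :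
    ∃ p : latticePoints D.cone, D.OnFace j p ∧ D.expo j p = m ∧ ∀ j', D.OnFace j' p → j' = j := by
  obtain ⟨p, hp, rfl⟩ := D.exists_expo_eq ⟨_, single_mem_tentRing hr hs hm h0 h1 1⟩
    (j := j) (m := m) (by simp)
  exact ⟨p, hp, rfl, fun j' => eq_of_onFace_of_interior hr hs hp h0 h1⟩

end ToricDeformation

end Tent

end

/-! ### Pairs of tangent vectors and their second-order lifts -/

noncomputable section

namespace Tent

open MvPolynomial

section Jets

/-- The ring `ℂ[ε₁, ε₂] / (ε₁², ε₂²)`. -/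
def DoubleDual : Type := TrivSqZeroExt (DualNumber ℂ) (DualNumber ℂ)

instance : CommRing DoubleDual :=
  inferInstanceAs (CommRing (TrivSqZeroExt (DualNumber ℂ) (DualNumber ℂ)))

instance : Algebra ℂ DoubleDual :=
  inferInstanceAs (Algebra ℂ (TrivSqZeroExt (DualNumber ℂ) (DualNumber ℂ)))

namespace DoubleDual

/-- The constant coefficient. -/
def c (z : DoubleDual) : ℂ := TrivSqZeroExt.fst (TrivSqZeroExt.fst z)

/-- The coefficient of `ε₁`. -/
def c₁ (z : DoubleDual) : ℂ := TrivSqZeroExt.snd (TrivSqZeroExt.fst z)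

/-- The coefficient of `ε₂`. -/
def c₂ (z : DoubleDual) : ℂ := TrivSqZeroExt.fst (TrivSqZeroExt.snd z)

/-- The coefficient of `ε₁ ε₂`. -/
def c₁₂ (z : DoubleDual) : ℂ := TrivSqZeroExt.snd (TrivSqZeroExt.snd z)

lemma ext {z w : DoubleDual} (h : z.c = w.c) (h1 : z.c₁ = w.c₁) (h2 : z.c₂ = w.c₂)
    (h3 : z.c₁₂ = w.c₁₂) : z = w :=
  TrivSqZeroExt.ext (TrivSqZeroExt.ext h h1) (TrivSqZeroExt.ext h2 h3)

lemma c_mul (z w : DoubleDual) : (z * w).c = z.c * w.c := rfl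

lemma c₁_mul (z w : DoubleDual) : (z * w).c₁ = z.c * w.c₁ + z.c₁ * w.c := rfl

lemma c₂_mul (z w : DoubleDual) : (z * w).c₂ = z.c * w.c₂ + z.c₂ * w.c := rfl

lemma c₁₂_mul (z w : DoubleDual) :
    (z * w).c₁₂ = z.c * w.c₁₂ + z.c₁ * w.c₂ + z.c₂ * w.c₁ + z.c₁₂ * w.c := by
  have h : (z * w).c₁₂ = z.c * w.c₁₂ + z.c₁ * w.c₂ + (z.c₂ * w.c₁ + z.c₁₂ * w.c) := rfl
  rw [h, add_assoc]
  ring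

end DoubleDual

open DoubleDual

/-- The ring `ℂ[ε₁, ε₂] / (ε₁, ε₂)²`. -/
abbrev TwoDual : Type := TrivSqZeroExt ℂ (ℂ × ℂ)

/-- The quotient by `ε₁ ε₂`. -/
def dropMixed : DoubleDual →ₐ[ℂ] TwoDual where
  toFun z := (z.c, z.c₁, z.c₂)
  map_one' := rfl
  map_zero' := rfl
  map_add' _ _ := rfl
  map_mul' z w := by
    rw [c_mul, c₁_mul, c₂_mul]
    refine TrivSqZeroExt.ext ?_ (Prod.ext ?_ ?_)
    · simp [TrivSqZeroExt.fst]; rfl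
    · simp [TrivSqZeroExt.snd]; rfl
    · simp [TrivSqZeroExt.snd]; rfl
  commutes' _ := rfl

lemma dropMixed_apply (z : DoubleDual) : dropMixed z = (z.c, z.c₁, z.c₂) := rfl

lemma dropMixed_surjective : Function.Surjective dropMixed := fun z =>
  ⟨((z.fst, z.snd.1), (z.snd.2, 0)), rfl⟩

lemma dropMixed_eq_zero {z : DoubleDual} :
    dropMixed z = 0 ↔ z.c = 0 ∧ z.c₁ = 0 ∧ z.c₂ = 0 := by
  rw [dropMixed_apply]
  exact ⟨fun h => ⟨congrArg Prod.fst h, congrArg (fun y : TwoDual => y.2.1) h,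
    congrArg (fun y : TwoDual => y.2.2) h⟩, fun ⟨h1, h2, h3⟩ => by rw [h1, h2, h3]; rfl⟩

/-- The kernel is spanned by `ε₁ ε₂`, whose square is zero; so formally smooth algebras lift along
`dropMixed`. -/
lemma isNilpotent_ker_dropMixed :
    IsNilpotent (RingHom.ker (dropMixed : DoubleDual →+* TwoDual)) := by
  refine ⟨2, ?_⟩
  rw [pow_two, Ideal.zero_eq_bot, eq_bot_iff, Ideal.mul_le]
  intro z hz w hw
  obtain ⟨h1, h2, h3⟩ := dropMixed_eq_zero.1 hz
  obtain ⟨k1, k2, k3⟩ := dropMixed_eq_zero.1 hw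
  rw [Ideal.mem_bot]
  refine DoubleDual.ext ?_ ?_ ?_ ?_
  · rw [c_mul, h1, zero_mul]; rfl
  · rw [c₁_mul, h1, h2, zero_mul, zero_mul, add_zero]; rfl
  · rw [c₂_mul, h1, h3, zero_mul, zero_mul, add_zero]; rfl
  · rw [c₁₂_mul, h1, h2, h3, k1]; simp; rfl

/-- Tangent maps to `ℂ[ε₁, ε₂] / (ε₁, ε₂)²` from a ring with a formally smooth localization lift to
`ℂ[ε₁, ε₂] / (ε₁², ε₂²)`. -/
lemma exists_lift_dropMixed {S : Type*} [CommRing S] [Algebra ℂ S] (M : Submonoid S)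
    (L : Type*) [CommRing L] [Algebra S L] [Algebra ℂ L] [IsScalarTower ℂ S L]
    [IsLocalization M L] [Algebra.FormallySmooth ℂ L] (Φ : S →ₐ[ℂ] TwoDual)
    (hunit : ∀ y : M, IsUnit (Φ y)) :
    ∃ φ : S →+* DoubleDual, ∀ f, dropMixed (φ f) = Φ f := by
  let Φ' : L →ₐ[ℂ] TwoDual := IsLocalization.liftAlgHom (M := M) (f := Φ) hunit
  obtain ⟨Ψ, hΨ⟩ : ∃ Ψ : L →ₐ[ℂ] DoubleDual, ∀ f, dropMixed (Ψ f) = Φ' f :=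
    ⟨Algebra.FormallySmooth.liftOfSurjective Φ' dropMixed dropMixed_surjective
      isNilpotent_ker_dropMixed, fun f => Algebra.FormallySmooth.liftOfSurjective_apply Φ' dropMixed
      dropMixed_surjective isNilpotent_ker_dropMixed f⟩
  refine ⟨(Ψ : L →+* DoubleDual).comp (algebraMap S L), fun f => (hΨ _).trans ?_⟩
  exact IsLocalization.lift_eq _ f

/-- At a smooth point of `Spec S`, two functions whose differentials are dual to a pair of
tangent vectors have a product that is nonzero to second order; so the product is not zero, and a
function vanishing along both tangent vectors divides it only with a cofactor nonzero at
the point. -/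
lemma mul_ne_zero_of_smoothAtPoint {S : Type*} [CommRing S] [Algebra ℂ S] {x : S →ₐ[ℂ] ℂ}
    (hx : SmoothAtPoint x) (Φ : S →ₐ[ℂ] TwoDual) (hΦ : ∀ f, (Φ f).fst = x f) {u v : S} {c d : ℂ}
    (hc : c ≠ 0) (hd : d ≠ 0) (hu : Φ u = (0, c, 0)) (hv : Φ v = (0, 0, d)) :
    u * v ≠ 0 ∧ ∀ a p, Φ a = 0 → u * v = a * p → x p ≠ 0 := by
  have : (RingHom.ker x).IsPrime := RingHom.ker_isPrime x
  have : Algebra.FormallySmooth ℂ (Localization.AtPrime (RingHom.ker x)) := hx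
  obtain ⟨φ, key⟩ := exists_lift_dropMixed (RingHom.ker x).primeCompl
    (Localization.AtPrime (RingHom.ker x)) Φ fun y =>
      TrivSqZeroExt.isUnit_iff_isUnit_fst.2 (by rw [hΦ]; exact isUnit_iff_ne_zero.2 y.2)
  have key1 : ∀ f, (φ f).c = (Φ f).fst := fun f => by rw [← key f]; rfl
  have key2 : ∀ f, (φ f).c₁ = (Φ f).snd.1 := fun f => by rw [← key f]; rfl
  have key3 : ∀ f, (φ f).c₂ = (Φ f).snd.2 := fun f => by rw [← key f]; rfl
  have huv : (φ (u * v)).c₁₂ = c * d := by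
    rw [map_mul, c₁₂_mul, key1, key2, key3, key1, key2, key3, hu, hv]
    simp [TrivSqZeroExt.fst, TrivSqZeroExt.snd]
  have hcd : c * d ≠ 0 := mul_ne_zero hc hd
  refine ⟨fun h => hcd ?_, fun a p ha h hp => hcd ?_⟩
  · rw [← huv, h, map_zero]; rfl
  -- Since `Φ a = 0`, the lift of `a` is a multiple of `ε₁ ε₂`, and multiplication by `p` only sees
  -- the value of `p` at the point.
  · rw [← huv, h, map_mul, c₁₂_mul, key1 a, key2 a, key3 a, key1 p, ha, hΦ, hp]
    simp

/-- Two tangent vectors at the same point. -/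
def pairJets {R : Type*} [CommRing R] [Algebra ℂ R] (a b : R →ₐ[ℂ] DualNumber ℂ)
    (h : ∀ f, (a f).fst = (b f).fst) : R →ₐ[ℂ] TwoDual where
  toFun f := ((a f).fst, (a f).snd, (b f).snd)
  map_one' := by simp; rfl
  map_zero' := by simp; rfl
  map_add' f g := by simp; rfl
  map_mul' f g := by
    refine TrivSqZeroExt.ext ?_ (Prod.ext ?_ ?_)
    · simp [TrivSqZeroExt.fst]; rfl
    · simp [TrivSqZeroExt.fst, TrivSqZeroExt.snd]; rfl
    · have h1 := h f
      have h2 := h g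
      simp only [TrivSqZeroExt.fst] at h1 h2
      simp [TrivSqZeroExt.fst, TrivSqZeroExt.snd, h1, h2]; rfl
  commutes' c := by
    simp only [AlgHom.commutes]
    rfl

/-- The tangent vector `∂/∂u` at the point `(0, 1)`. -/
def jetFst : Poly2 →ₐ[ℂ] DualNumber ℂ := aeval ![DualNumber.eps, 1]

/-- The tangent vector `∂/∂v` at the point `(1, 0)`. -/
def jetSnd : Poly2 →ₐ[ℂ] DualNumber ℂ := aeval ![1, DualNumber.eps]

lemma fst_jetFst (f : Poly2) : (jetFst f).fst = eval ![0, 1] f := by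
  have : (TrivSqZeroExt.fstHom ℂ ℂ ℂ).comp jetFst = aeval ![0, 1] := by
    ext i; fin_cases i <;> simp [jetFst]
  exact DFunLike.congr_fun this f

lemma fst_jetSnd (f : Poly2) : (jetSnd f).fst = eval ![1, 0] f := by
  have : (TrivSqZeroExt.fstHom ℂ ℂ ℂ).comp jetSnd = aeval ![1, 0] := by
    ext i; fin_cases i <;> simp [jetSnd]
  exact DFunLike.congr_fun this f

lemma jetFst_monomial (i k : ℕ) (c : ℂ) :
    jetFst (monomial (expVec i k) c) = c • DualNumber.eps ^ i := by
  rw [monomial_expVec, jetFst]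
  simp [Algebra.smul_def]

lemma jetSnd_monomial (i k : ℕ) (c : ℂ) :
    jetSnd (monomial (expVec i k) c) = c • DualNumber.eps ^ k := by
  rw [monomial_expVec, jetSnd]
  simp [Algebra.smul_def]

lemma eval_restrFst (n : ℕ) (t : ℂ) (f : Poly2) :
    (restrFst n f).eval t = eval ![t ^ n, 0] f := by
  have : (Polynomial.aeval t).comp (restrFst n) = aeval ![t ^ n, 0] := by
    ext i; fin_cases i <;> simp [restrFst]
  exact DFunLike.congr_fun this f

lemma eval_restrSnd (n : ℕ) (t : ℂ) (f : Poly2) :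
    (restrSnd n f).eval t = eval ![0, t ^ n] f := by
  have : (Polynomial.aeval t).comp (restrSnd n) = aeval ![0, t ^ n] := by
    ext i; fin_cases i <;> simp [restrSnd]
  exact DFunLike.congr_fun this f

variable {r α s β : ℕ}

/-- The projection of the tent ring to the polynomials on the component `S_j`. -/
def tentProj (j : Fin 4) : tentRing r α s β →ₐ[ℂ] Poly2 :=
  (Pi.evalAlgHom ℂ _ j).comp (tentRing r α s β).val

/-- The two tangent directions of the tent at the point `1` of the `ξ`-axis. -/
def jetXi : tentRing r α s β →ₐ[ℂ] TwoDual :=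
  pairJets (jetFst.comp (tentProj 1)) (jetSnd.comp (tentProj 2)) fun f => by
    have := congrArg (Polynomial.eval 1) f.2.2.2.2.1
    rw [eval_restrSnd, eval_restrFst, one_pow, one_pow] at this
    simpa [fst_jetFst, fst_jetSnd, tentProj] using this

/-- The two tangent directions of the tent at the point `1` of the `η`-axis. -/
def jetEta : tentRing r α s β →ₐ[ℂ] TwoDual :=
  pairJets (jetFst.comp (tentProj 3)) (jetFst.comp (tentProj 2)) fun f => by
    have := congrArg (Polynomial.eval 1) f.2.2.2.2.2.1
    rw [eval_restrSnd, eval_restrSnd, one_pow, one_pow] at this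
    simpa [fst_jetFst, tentProj] using this

lemma jetXi_apply (f : tentRing r α s β) :
    jetXi f = (eval ![1, 0] ((f : Fin 4 → Poly2) 2), (jetFst ((f : Fin 4 → Poly2) 1)).snd,
      (jetSnd ((f : Fin 4 → Poly2) 2)).snd) := by
  have := congrArg (Polynomial.eval 1) f.2.2.2.2.1
  rw [eval_restrSnd, eval_restrFst, one_pow, one_pow] at this
  rw [← this, ← fst_jetFst]
  rfl

lemma jetEta_apply (f : tentRing r α s β) :
    jetEta f = (eval ![0, 1] ((f : Fin 4 → Poly2) 2), (jetFst ((f : Fin 4 → Poly2) 3)).snd,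
      (jetFst ((f : Fin 4 → Poly2) 2)).snd) := by
  have := congrArg (Polynomial.eval 1) f.2.2.2.2.2.1
  rw [eval_restrSnd, eval_restrSnd, one_pow, one_pow] at this
  rw [← this, ← fst_jetFst]
  rfl

end Jets

end Tent

end

/-! ### Axis monomials and the relations forced by smoothness -/

noncomputable section

namespace Tent

open MvPolynomial

namespace ToricDeformation

variable {r α s β : ℕ} {D : ToricDeformation r α s β}

/-- Along the common axis the glueing forces a nonzero coefficient on the neighbouring component,
and a restricted monomial has only one term. The next three lemmas treat the other axes. -/
lemma comp_eq_of_onFace_zero (hr : 1 ≤ r) {p : latticePoints D.cone} {k : ℕ}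
    (hp : D.OnFace 0 p) (h : D.expo 0 p = expVec k 0) :
    D.comp p 1 = monomial (expVec (r * k) 0) (D.coef 0 p) := by
  have h1 := coeff_x₀_axis hr (D.comp_mem p) k
  rw [comp_eq D p 0, h, coeff_monomial, if_pos rfl, comp_eq, coeff_monomial] at h1
  split_ifs at h1 with h2
  · rw [comp_eq, h2, h1]
  · exact absurd h1.symm (onFace_iff.1 hp)

lemma comp_eq_of_onFace_zero' (hs : 1 ≤ s) {p : latticePoints D.cone} {k : ℕ}
    (hp : D.OnFace 0 p) (h : D.expo 0 p = expVec 0 k) :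
    D.comp p 3 = monomial (expVec (s * k) 0) (D.coef 0 p) := by
  have h1 := coeff_y₀_axis hs (D.comp_mem p) k
  rw [comp_eq D p 0, h, coeff_monomial, if_pos rfl, comp_eq, coeff_monomial] at h1
  split_ifs at h1 with h2
  · rw [comp_eq, h2, h1]
  · exact absurd h1.symm (onFace_iff.1 hp)

lemma comp_eq_of_onFace_two (hr : 1 ≤ r) {p : latticePoints D.cone} {k : ℕ}
    (hp : D.OnFace 2 p) (h : D.expo 2 p = expVec k 0) :
    D.comp p 1 = monomial (expVec 0 (r * k)) (D.coef 2 p) := by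
  have h1 := coeff_ξ_axis hr (D.comp_mem p) k
  rw [comp_eq D p 2, h, coeff_monomial, if_pos rfl, comp_eq, coeff_monomial] at h1
  split_ifs at h1 with h2
  · rw [comp_eq, h2, h1]
  · exact absurd h1.symm (onFace_iff.1 hp)

lemma comp_eq_of_onFace_two' (hs : 1 ≤ s) {p : latticePoints D.cone} {k : ℕ}
    (hp : D.OnFace 2 p) (h : D.expo 2 p = expVec 0 k) :
    D.comp p 3 = monomial (expVec 0 (s * k)) (D.coef 2 p) := by
  have h1 := coeff_η_axis hs (D.comp_mem p) k
  rw [comp_eq D p 2, h, coeff_monomial, if_pos rfl, comp_eq, coeff_monomial] at h1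
  split_ifs at h1 with h2
  · rw [comp_eq, h2, h1]
  · exact absurd h1.symm (onFace_iff.1 hp)

/-- With an axis coordinate for `F`, this shows that a monomial lifting it on one component vanishes
wherever the coordinate does. -/
lemma comp_eq_zero_of_coeff (hr : 1 ≤ r) (hs : 1 ≤ s) {F : Fin 4 → Poly2}
    (hF : F ∈ tentRing r α s β) {j j' : Fin 4} {p : latticePoints D.cone} (hp : D.OnFace j p)
    (h : coeff (D.expo j p) (F j) ≠ 0) (h' : F j' = 0) : D.comp p j' = 0 := by
  by_contra hp'
  exact coeff_ne_zero_of_onFace hr hs ⟨F, hF⟩ hp hp' h (by simp [h'])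

lemma exists_lifts_coordX0 (hr : 1 ≤ r) (hs : 1 ≤ s) (D : ToricDeformation r α s β) :
    ∃ p, D.Lifts p (coordX0 r) := by
  have hF : coordX0 r ∈ tentRing r α s β := coordX0_mem hr
  have h0 : coordX0 r 0 = monomial (expVec 1 0) 1 := by simp [coordX0, monomial_expVec]
  obtain ⟨p, hp, hm⟩ := D.exists_expo_eq ⟨_, hF⟩ (j := 0) (m := expVec 1 0) (by simp [h0])
  have hne : coeff (D.expo 0 p) (coordX0 r 0) ≠ 0 := by simp [hm, h0]
  refine ⟨p, D.coef 0 p, onFace_iff.1 hp, funext fun j => ?_⟩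
  change D.comp p j = D.coef 0 p • coordX0 r j
  fin_cases j
  · change D.comp p 0 = D.coef 0 p • coordX0 r 0
    rw [comp_eq, hm, h0, smul_monomial, smul_eq_mul, mul_one]
  · change D.comp p 1 = D.coef 0 p • X 0 ^ r
    rw [comp_eq_of_onFace_zero hr hp hm, X_pow_eq_monomial_expVec_left, smul_monomial, smul_eq_mul,
      mul_one, mul_one]
  · exact (comp_eq_zero_of_coeff hr hs hF hp hne rfl).trans (smul_zero _).symm
  · exact (comp_eq_zero_of_coeff hr hs hF hp hne rfl).trans (smul_zero _).symm

lemma exists_lifts_coordY0 (hr : 1 ≤ r) (hs : 1 ≤ s) (D : ToricDeformation r α s β) :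
    ∃ p, D.Lifts p (coordY0 s) := by
  have hF : coordY0 s ∈ tentRing r α s β := coordY0_mem hs
  have h0 : coordY0 s 0 = monomial (expVec 0 1) 1 := by simp [coordY0, monomial_expVec]
  obtain ⟨p, hp, hm⟩ := D.exists_expo_eq ⟨_, hF⟩ (j := 0) (m := expVec 0 1) (by simp [h0])
  have hne : coeff (D.expo 0 p) (coordY0 s 0) ≠ 0 := by simp [hm, h0]
  refine ⟨p, D.coef 0 p, onFace_iff.1 hp, funext fun j => ?_⟩
  change D.comp p j = D.coef 0 p • coordY0 s j
  fin_cases j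
  · change D.comp p 0 = D.coef 0 p • coordY0 s 0
    rw [comp_eq, hm, h0, smul_monomial, smul_eq_mul, mul_one]
  · exact (comp_eq_zero_of_coeff hr hs hF hp hne rfl).trans (smul_zero _).symm
  · exact (comp_eq_zero_of_coeff hr hs hF hp hne rfl).trans (smul_zero _).symm
  · change D.comp p 3 = D.coef 0 p • X 0 ^ s
    rw [comp_eq_of_onFace_zero' hs hp hm, X_pow_eq_monomial_expVec_left, smul_monomial, smul_eq_mul,
      mul_one, mul_one]

lemma exists_lifts_coordXi (hr : 1 ≤ r) (hs : 1 ≤ s) (D : ToricDeformation r α s β) :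
    ∃ p, D.Lifts p (coordXi r) := by
  have hF : coordXi r ∈ tentRing r α s β := coordXi_mem hr
  have h0 : coordXi r 2 = monomial (expVec 1 0) 1 := by simp [coordXi, monomial_expVec]
  obtain ⟨p, hp, hm⟩ := D.exists_expo_eq ⟨_, hF⟩ (j := 2) (m := expVec 1 0) (by simp [h0])
  have hne : coeff (D.expo 2 p) (coordXi r 2) ≠ 0 := by simp [hm, h0]
  refine ⟨p, D.coef 2 p, onFace_iff.1 hp, funext fun j => ?_⟩
  change D.comp p j = D.coef 2 p • coordXi r j
  fin_cases j
  · exact (comp_eq_zero_of_coeff hr hs hF hp hne rfl).trans (smul_zero _).symm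
  · change D.comp p 1 = D.coef 2 p • X 1 ^ r
    rw [comp_eq_of_onFace_two hr hp hm, X_pow_eq_monomial_expVec_right, smul_monomial, smul_eq_mul,
      mul_one, mul_one]
  · change D.comp p 2 = D.coef 2 p • coordXi r 2
    rw [comp_eq, hm, h0, smul_monomial, smul_eq_mul, mul_one]
  · exact (comp_eq_zero_of_coeff hr hs hF hp hne rfl).trans (smul_zero _).symm

lemma exists_lifts_coordEta (hr : 1 ≤ r) (hs : 1 ≤ s) (D : ToricDeformation r α s β) :
    ∃ p, D.Lifts p (coordEta s) := by
  have hF : coordEta s ∈ tentRing r α s β := coordEta_mem hs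
  have h0 : coordEta s 2 = monomial (expVec 0 1) 1 := by simp [coordEta, monomial_expVec]
  obtain ⟨p, hp, hm⟩ := D.exists_expo_eq ⟨_, hF⟩ (j := 2) (m := expVec 0 1) (by simp [h0])
  have hne : coeff (D.expo 2 p) (coordEta s 2) ≠ 0 := by simp [hm, h0]
  refine ⟨p, D.coef 2 p, onFace_iff.1 hp, funext fun j => ?_⟩
  change D.comp p j = D.coef 2 p • coordEta s j
  fin_cases j
  · exact (comp_eq_zero_of_coeff hr hs hF hp hne rfl).trans (smul_zero _).symm
  · exact (comp_eq_zero_of_coeff hr hs hF hp hne rfl).trans (smul_zero _).symm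
  · change D.comp p 2 = D.coef 2 p • coordEta s 2
    rw [comp_eq, hm, h0, smul_monomial, smul_eq_mul, mul_one]
  · change D.comp p 3 = D.coef 2 p • X 1 ^ s
    rw [comp_eq_of_onFace_two' hs hp hm, X_pow_eq_monomial_expVec_right, smul_monomial, smul_eq_mul,
      mul_one, mul_one]

/-- The monomials on the total space lifting the four axis coordinates of the tent. -/
structure Axes (D : ToricDeformation r α s β) where
  x₀ : latticePoints D.cone
  y₀ : latticePoints D.cone
  ξ : latticePoints D.cone
  η : latticePoints D.cone
  hx₀ : D.Lifts x₀ (coordX0 r)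
  hy₀ : D.Lifts y₀ (coordY0 s)
  hξ : D.Lifts ξ (coordXi r)
  hη : D.Lifts η (coordEta s)

lemma nonempty_axes (hr : 1 ≤ r) (hs : 1 ≤ s) (D : ToricDeformation r α s β) :
    Nonempty D.Axes := by
  obtain ⟨x₀, hx₀⟩ := D.exists_lifts_coordX0 hr hs
  obtain ⟨y₀, hy₀⟩ := D.exists_lifts_coordY0 hr hs
  obtain ⟨ξ, hξ⟩ := D.exists_lifts_coordXi hr hs
  obtain ⟨η, hη⟩ := D.exists_lifts_coordEta hr hs
  exact ⟨⟨x₀, y₀, ξ, η, hx₀, hy₀, hξ, hη⟩⟩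

lemma Lifts.onFace {p : latticePoints D.cone} {F : Fin 4 → Poly2} (h : D.Lifts p F) {j : Fin 4}
    {m : Fin 2 →₀ ℕ} (hm : F j = monomial m 1) : D.OnFace j p ∧ D.expo j p = m := by
  obtain ⟨c, hc, h⟩ := h
  have : D.comp p j = monomial m c := by
    rw [comp, h, Pi.smul_apply, hm, smul_monomial, smul_eq_mul, mul_one]
  obtain ⟨h1, h2, -⟩ := expo_coef_of_comp_eq hc this
  exact ⟨h1, h2⟩

lemma Lifts.not_onFace {p : latticePoints D.cone} {F : Fin 4 → Poly2} (h : D.Lifts p F) {j : Fin 4}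
    (hm : F j = 0) : ¬ D.OnFace j p := by
  obtain ⟨c, -, h⟩ := h
  rw [OnFace, not_not, comp, h, Pi.smul_apply, hm, smul_zero]

lemma Lifts.coef_eq {p : latticePoints D.cone} {F : Fin 4 → Poly2} (h : D.Lifts p F) {j j' : Fin 4}
    {m m' : Fin 2 →₀ ℕ} (hm : F j = monomial m 1) (hm' : F j' = monomial m' 1) :
    D.coef j p = D.coef j' p := by
  obtain ⟨c, hc, h⟩ := h
  have h1 : D.comp p j = monomial m c := by
    rw [comp, h, Pi.smul_apply, hm, smul_monomial, smul_eq_mul, mul_one]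
  have h2 : D.comp p j' = monomial m' c := by
    rw [comp, h, Pi.smul_apply, hm', smul_monomial, smul_eq_mul, mul_one]
  rw [(expo_coef_of_comp_eq hc h1).2.2, (expo_coef_of_comp_eq hc h2).2.2]

lemma Lifts.unique (hr : 1 ≤ r) (hs : 1 ≤ s) {p q : latticePoints D.cone} {F : Fin 4 → Poly2}
    (hp : D.Lifts p F) (hq : D.Lifts q F) {j : Fin 4} {m : Fin 2 →₀ ℕ} (hm : F j = monomial m 1) :
    p = q :=
  expo_injective hr hs (hp.onFace hm).1 (hq.onFace hm).1
    ((hp.onFace hm).2.trans (hq.onFace hm).2.symm)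

section CoordMonomials

variable (r s : ℕ)

lemma coordX0_zero : coordX0 r 0 = monomial (expVec 1 0) 1 := by simp [coordX0, monomial_expVec]

lemma coordX0_one : coordX0 r 1 = monomial (expVec r 0) 1 := by simp [coordX0, monomial_expVec]

lemma coordY0_zero : coordY0 s 0 = monomial (expVec 0 1) 1 := by simp [coordY0, monomial_expVec]

lemma coordY0_three : coordY0 s 3 = monomial (expVec s 0) 1 := by simp [coordY0, monomial_expVec]

lemma coordXi_two : coordXi r 2 = monomial (expVec 1 0) 1 := by simp [coordXi, monomial_expVec]

lemma coordXi_one : coordXi r 1 = monomial (expVec 0 r) 1 := by simp [coordXi, monomial_expVec]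

lemma coordEta_two : coordEta s 2 = monomial (expVec 0 1) 1 := by simp [coordEta, monomial_expVec]

lemma coordEta_three : coordEta s 3 = monomial (expVec 0 s) 1 := by
  simp [coordEta, monomial_expVec]

end CoordMonomials

namespace Axes

variable (a : D.Axes)

/-- The axis coordinate of `S_j` with plane exponent `(n, 0)`. -/
def fst (j : Fin 4) : latticePoints D.cone := ![a.x₀, a.x₀, a.ξ, a.y₀] j

/-- The axis coordinate of `S_j` with plane exponent `(0, n)`. -/
def snd (j : Fin 4) : latticePoints D.cone := ![a.y₀, a.ξ, a.η, a.η] j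

lemma fst_spec (j : Fin 4) :
    D.OnFace j (a.fst j) ∧ D.expo j (a.fst j) = expVec (axisDeg r s j) 0 := by
  fin_cases j
  · exact a.hx₀.onFace (coordX0_zero r)
  · exact a.hx₀.onFace (coordX0_one r)
  · exact a.hξ.onFace (coordXi_two r)
  · exact a.hy₀.onFace (coordY0_three s)

lemma snd_spec (j : Fin 4) :
    D.OnFace j (a.snd j) ∧ D.expo j (a.snd j) = expVec 0 (axisDeg r s j) := by
  fin_cases j
  · exact a.hy₀.onFace (coordY0_zero s)
  · exact a.hξ.onFace (coordXi_one r)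
  · exact a.hη.onFace (coordEta_two s)
  · exact a.hη.onFace (coordEta_three s)

lemma onFace_combination (j : Fin 4) (i k : ℕ) : D.OnFace j (i • a.fst j + k • a.snd j) :=
  onFace_add.2 ⟨onFace_nsmul (a.fst_spec j).1 i, onFace_nsmul (a.snd_spec j).1 k⟩

lemma expo_combination (j : Fin 4) (i k : ℕ) :
    D.expo j (i • a.fst j + k • a.snd j) = expVec (axisDeg r s j * i) (axisDeg r s j * k) := by
  rw [expo_add (onFace_nsmul (a.fst_spec j).1 i) (onFace_nsmul (a.snd_spec j).1 k),
    expo_nsmul (a.fst_spec j).1, expo_nsmul (a.snd_spec j).1, (a.fst_spec j).2, (a.snd_spec j).2]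
  apply expVec_ext <;> simp [mul_comm]

/-- The monomials on both sides have the same exponent on `S_j`. The factor is `r` on `S₁` and `s`
on `S₃` because the axis coordinates there are `r`th and `s`th powers. -/
lemma axisDeg_smul (hr : 1 ≤ r) (hs : 1 ≤ s) {j : Fin 4} {p : latticePoints D.cone}
    (hp : D.OnFace j p) :
    axisDeg r s j • p = D.expo j p 0 • a.fst j + D.expo j p 1 • a.snd j := by
  refine expo_injective hr hs (onFace_nsmul hp _) (a.onFace_combination j _ _) ?_
  rw [expo_nsmul hp, a.expo_combination]
  apply expVec_ext <;> simp

lemma eq_combination (hr : 1 ≤ r) (hs : 1 ≤ s) {j : Fin 4} (hj : axisDeg r s j = 1)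
    {p : latticePoints D.cone} (hp : D.OnFace j p) :
    p = D.expo j p 0 • a.fst j + D.expo j p 1 • a.snd j := by
  rw [← a.axisDeg_smul hr hs hp, hj, one_smul]

lemma not_onFace_x₀_add_y₀ {j : Fin 4} (hj : j ≠ 0) : ¬ D.OnFace j (a.x₀ + a.y₀) := by
  rw [onFace_add]
  rintro ⟨h1, h2⟩
  fin_cases j
  · exact hj rfl
  · exact a.hy₀.not_onFace rfl h2
  · exact a.hy₀.not_onFace rfl h2
  · exact a.hx₀.not_onFace rfl h1

end Axes

lemma onFace_of_eval_ne_zero {p : latticePoints D.cone} {j : Fin 4} {v : Fin 2 → ℂ}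
    (h : eval v (D.comp p j) ≠ 0) : D.OnFace j p := fun h0 => h (by rw [h0, map_zero])

/-- At the point `ξ = 1` the monomials `w` and `η` are transversal coordinates of the branches `S₁`
and `S₂`, each vanishing on the other branch. Their product vanishes on `T`, so it is divisible by
`A` or `B`. Smoothness of `(B = 0)` excludes `B`, and makes the cofactor of `A` nonzero at the
point, so that it must be a power of `ξ`. -/
lemma SmoothsXi.relation (hr : 1 ≤ r) (hs : 1 ≤ s) (hα : α ≤ r) (hD : D.SmoothsXi) (a : D.Axes) :
    ∃ (w : latticePoints D.cone) (n : ℕ), D.OnFace 1 w ∧ D.expo 1 w = expVec 1 (2 * r - α) ∧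
      D.A + n • a.ξ = w + a.η := by
  -- The exponent `2r - α`, rather than `r - α`, is positive even for `α = r`, so that `w` lives on
  -- `S₁` only.
  obtain ⟨w, hw, hwe, hw'⟩ := D.exists_expo_eq_of_interior hr hs (j := 1)
    (m := expVec 1 (2 * r - α)) ⟨fun _ => by simp; exact ⟨2, by omega⟩, fun h => by simp at h⟩
    (by simp) (by simp; omega)
  have hη2 := a.hη.onFace (coordEta_two s)
  have hS : ∀ p ∈ Ideal.span {(mono D.B : toricRing D.cone)}, D.restrict p = 0 := fun p hp => by
    have : p ∈ RingHom.ker D.restrict := by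
      rw [D.ker_restrict]; exact Ideal.span_mono (by simp) hp
    exact this
  have hA : D.restrict (mono D.A) = 0 := by
    have : mono D.A ∈ RingHom.ker D.restrict := by
      rw [D.ker_restrict]; exact Ideal.subset_span (by simp)
    exact this
  let ρ := Ideal.Quotient.liftₐ (Ideal.span {(mono D.B : toricRing D.cone)}) D.restrict hS
  let Φ := (jetXi (r := r) (α := α) (s := s) (β := β)).comp ρ
  let x := (TrivSqZeroExt.fstHom ℂ ℂ (ℂ × ℂ)).comp Φ
  have hΦ : ∀ f, Φ (Ideal.Quotient.mk _ f) = jetXi (D.restrict f) := fun f => rfl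
  have hx : ∀ f, x (Ideal.Quotient.mk _ f) = eval ![1, 0] ((D.restrict f : Fin 4 → Poly2) 2) :=
    fun f => by
      change (Φ (Ideal.Quotient.mk _ f)).fst = _
      rw [hΦ, jetXi_apply]; rfl
  have hw2 : D.comp w 2 = 0 := by
    by_contra h; simpa using hw' 2 h
  have hη1 : D.comp a.η 1 = 0 := by
    by_contra h; exact a.hη.not_onFace rfl h
  have huw : Φ (Ideal.Quotient.mk _ (mono w)) = (0, D.coef 1 w, 0) := by
    rw [hΦ, jetXi_apply]
    change (eval ![1, 0] (D.comp w 2), (jetFst (D.comp w 1)).snd, (jetSnd (D.comp w 2)).snd) = _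
    rw [hw2, comp_eq, hwe, jetFst_monomial]
    simp
  have huη : Φ (Ideal.Quotient.mk _ (mono a.η)) = (0, 0, D.coef 2 a.η) := by
    rw [hΦ, jetXi_apply]
    change (eval ![1, 0] (D.comp a.η 2), (jetFst (D.comp a.η 1)).snd,
      (jetSnd (D.comp a.η 2)).snd) = _
    rw [hη1, comp_eq, hη2.2, jetSnd_monomial, monomial_expVec]
    simp
  obtain ⟨hne, hdiv⟩ := mul_ne_zero_of_smoothAtPoint
    (hD 1 one_ne_zero x fun f => by rw [hx, evalXiAxis]) Φ (fun f => rfl)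
    (onFace_iff.1 hw) (onFace_iff.1 hη2.1) huw huη
  have hnot : ¬ ∃ j, D.OnFace j (w + a.η) := by
    rintro ⟨j, hj⟩
    obtain ⟨h1, h2⟩ := onFace_add.1 hj
    obtain rfl := hw' j h1
    exact a.hη.not_onFace rfl h2
  rw [exists_onFace_iff, not_not] at hnot
  -- Divisibility by `B` would make the product zero on `(B = 0)`. In the case of `A`, a nonzero
  -- value of `q` at a point with `η = 0` leaves no factor `η` in `q` on `S₂`.
  rcases hnot with ⟨q, hq⟩ | ⟨q, hq⟩
  · have := hdiv (Ideal.Quotient.mk _ (mono D.A)) (Ideal.Quotient.mk _ (mono q))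
      (by rw [hΦ, hA, map_zero]) (by rw [← map_mul, ← map_mul, ← mono_add, ← mono_add, hq])
    rw [hx] at this
    have hq2 : D.OnFace 2 q := onFace_of_eval_ne_zero this
    have hq0 : D.expo 2 q 1 = 0 := by
      by_contra h
      apply this
      change eval ![1, 0] (D.comp q 2) = 0
      rw [comp_eq, ← expVec_eta (D.expo 2 q), monomial_expVec]
      simp [h]
    refine ⟨w, D.expo 2 q 0, hw, hwe, ?_⟩
    have := a.eq_combination hr hs rfl hq2
    rw [hq0, zero_smul, add_zero] at this
    rw [hq]
    congr 1
    exact this.symm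
  · exact absurd (by
      rw [← map_mul, ← mono_add, hq, mono_add, Ideal.Quotient.eq_zero_iff_mem]
      exact Ideal.mul_mem_right _ _ (Ideal.subset_span rfl)) hne

/-- The same argument at the point `η = 1`, where `S₃` and `S₂` cross and the roles of `A` and `B`
are exchanged. -/
lemma SmoothsEta.relation (hr : 1 ≤ r) (hs : 1 ≤ s) (hβ : β ≤ s) (hD : D.SmoothsEta) (a : D.Axes) :
    ∃ (w : latticePoints D.cone) (n : ℕ), D.OnFace 3 w ∧ D.expo 3 w = expVec 1 (2 * s - β) ∧
      D.B + n • a.η = w + a.ξ := by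
  obtain ⟨w, hw, hwe, hw'⟩ := D.exists_expo_eq_of_interior hr hs (j := 3)
    (m := expVec 1 (2 * s - β)) ⟨fun h => by simp at h, fun _ => by simp; exact ⟨2, by omega⟩⟩
    (by simp) (by simp; omega)
  have hξ2 := a.hξ.onFace (coordXi_two r)
  have hS : ∀ p ∈ Ideal.span {(mono D.A : toricRing D.cone)}, D.restrict p = 0 := fun p hp => by
    have : p ∈ RingHom.ker D.restrict := by
      rw [D.ker_restrict]; exact Ideal.span_mono (by simp) hp
    exact this
  have hB : D.restrict (mono D.B) = 0 := by
    have : mono D.B ∈ RingHom.ker D.restrict := by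
      rw [D.ker_restrict]; exact Ideal.subset_span (by simp)
    exact this
  let ρ := Ideal.Quotient.liftₐ (Ideal.span {(mono D.A : toricRing D.cone)}) D.restrict hS
  let Φ := (jetEta (r := r) (α := α) (s := s) (β := β)).comp ρ
  let x := (TrivSqZeroExt.fstHom ℂ ℂ (ℂ × ℂ)).comp Φ
  have hΦ : ∀ f, Φ (Ideal.Quotient.mk _ f) = jetEta (D.restrict f) := fun f => rfl
  have hx : ∀ f, x (Ideal.Quotient.mk _ f) = eval ![0, 1] ((D.restrict f : Fin 4 → Poly2) 2) :=
    fun f => by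
      change (Φ (Ideal.Quotient.mk _ f)).fst = _
      rw [hΦ, jetEta_apply]; rfl
  have hw2 : D.comp w 2 = 0 := by
    by_contra h; simpa using hw' 2 h
  have hξ3 : D.comp a.ξ 3 = 0 := by
    by_contra h; exact a.hξ.not_onFace rfl h
  have huw : Φ (Ideal.Quotient.mk _ (mono w)) = (0, D.coef 3 w, 0) := by
    rw [hΦ, jetEta_apply]
    change (eval ![0, 1] (D.comp w 2), (jetFst (D.comp w 3)).snd, (jetFst (D.comp w 2)).snd) = _
    rw [hw2, comp_eq, hwe, jetFst_monomial]
    simp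
  have huξ : Φ (Ideal.Quotient.mk _ (mono a.ξ)) = (0, 0, D.coef 2 a.ξ) := by
    rw [hΦ, jetEta_apply]
    change (eval ![0, 1] (D.comp a.ξ 2), (jetFst (D.comp a.ξ 3)).snd,
      (jetFst (D.comp a.ξ 2)).snd) = _
    rw [hξ3, comp_eq, hξ2.2, jetFst_monomial, monomial_expVec]
    simp
  obtain ⟨hne, hdiv⟩ := mul_ne_zero_of_smoothAtPoint
    (hD 1 one_ne_zero x fun f => by rw [hx, evalEtaAxis]) Φ (fun f => rfl)
    (onFace_iff.1 hw) (onFace_iff.1 hξ2.1) huw huξ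
  have hnot : ¬ ∃ j, D.OnFace j (w + a.ξ) := by
    rintro ⟨j, hj⟩
    obtain ⟨h1, h2⟩ := onFace_add.1 hj
    obtain rfl := hw' j h1
    exact a.hξ.not_onFace rfl h2
  rw [exists_onFace_iff, not_not] at hnot
  rcases hnot with ⟨q, hq⟩ | ⟨q, hq⟩
  · exact absurd (by
      rw [← map_mul, ← mono_add, hq, mono_add, Ideal.Quotient.eq_zero_iff_mem]
      exact Ideal.mul_mem_right _ _ (Ideal.subset_span rfl)) hne
  · have := hdiv (Ideal.Quotient.mk _ (mono D.B)) (Ideal.Quotient.mk _ (mono q))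
      (by rw [hΦ, hB, map_zero]) (by rw [← map_mul, ← map_mul, ← mono_add, ← mono_add, hq])
    rw [hx] at this
    have hq2 : D.OnFace 2 q := onFace_of_eval_ne_zero this
    have hq0 : D.expo 2 q 0 = 0 := by
      by_contra h
      apply this
      change eval ![0, 1] (D.comp q 2) = 0
      rw [comp_eq, ← expVec_eta (D.expo 2 q), monomial_expVec]
      simp [h]
    refine ⟨w, D.expo 2 q 1, hw, hwe, ?_⟩
    have := a.eq_combination hr hs rfl hq2
    rw [hq0, zero_smul, zero_add] at this
    rw [hq]
    congr 1
    exact this.symm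

end ToricDeformation

end Tent

end

/-! ### Gordan's lemma, lattice bases and faces of monoids -/

noncomputable section

namespace Tent

section Lattice

lemma toReal_add (m n : Lattice) : toReal (m + n) = toReal m + toReal n := by
  funext i; simp [toReal]

lemma toReal_nsmul (k : ℕ) (m : Lattice) : toReal (k • m) = (k : ℝ) • toReal m := by
  funext i; simp [toReal]

lemma toReal_sum {ι : Type*} (t : Finset ι) (f : ι → Lattice) :
    toReal (∑ i ∈ t, f i) = ∑ i ∈ t, toReal (f i) := by
  funext i; simp [toReal]

variable {σ : PointedCone ℝ (Fin 4 → ℝ)}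

lemma mem_latticePoints {m : Lattice} : m ∈ latticePoints σ ↔ toReal m ∈ σ := Iff.rfl

lemma smul_mem_cone {c : ℝ} (hc : 0 ≤ c) {v : Fin 4 → ℝ} (hv : v ∈ σ) : c • v ∈ σ :=
  σ.smul_mem hc hv

lemma mem_cone_of_nsmul {k : ℕ} (hk : k ≠ 0) {m : Lattice} (h : toReal (k • m) ∈ σ) :
    toReal m ∈ σ := by
  have := smul_mem_cone (c := (k : ℝ)⁻¹) (by positivity) h
  rwa [toReal_nsmul, smul_smul, inv_mul_cancel₀ (by exact_mod_cast hk), one_smul] at this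

/-- **Gordan's lemma** for the lattice points of a rational polyhedral cone. -/
lemma exists_finite_closure_eq_top
    (h : ∃ G : Finset Lattice, σ = PointedCone.hull ℝ (toReal '' (G : Set Lattice))) :
    ∃ H : Set (latticePoints σ), H.Finite ∧ AddSubmonoid.closure H = ⊤ := by
  obtain ⟨G, hG⟩ := h
  have hmem : ∀ g ∈ G, toReal g ∈ σ := fun g hg => by
    rw [hG]; exact Submodule.subset_span ⟨g, hg, rfl⟩
  set K : Lattice := fun i => ∑ g : G, |(g : Lattice) i| with hK
  have hfin : (Set.Icc (-K) K).Finite := Set.finite_Icc _ _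
  refine ⟨Subtype.val ⁻¹' Set.Icc (-K) K, hfin.preimage Subtype.val_injective.injOn, ?_⟩
  rw [eq_top_iff]
  rintro ⟨p, hp⟩ -
  have hp' : toReal p ∈ PointedCone.hull ℝ (toReal '' (G : Set Lattice)) := by rw [← hG]; exact hp
  rw [Submodule.mem_span_image_finset_iff_exists_fun] at hp'
  obtain ⟨c, hc⟩ := hp'
  have hc' : ∑ g, (c g : ℝ) • toReal g = toReal p := hc
  -- Splitting the coefficients into integral and fractional parts leaves a remainder in the box
  -- bounded by `K`. The generators of the cone lie in the same box, so its finitely many lattice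
  -- points suffice.
  set q : Lattice := p - ∑ g, ⌊(c g : ℝ)⌋₊ • (g : Lattice) with hq
  have hqr : toReal q = ∑ g, ((c g : ℝ) - ⌊(c g : ℝ)⌋₊) • toReal g := by
    have : toReal q + ∑ g, (⌊(c g : ℝ)⌋₊ : ℝ) • toReal g = toReal p := by
      simp_rw [← toReal_nsmul]
      rw [← toReal_sum, ← toReal_add, hq, sub_add_cancel]
    simp_rw [sub_smul]
    rw [Finset.sum_sub_distrib, hc', ← this, add_sub_cancel_right]
  have hfl : ∀ g, 0 ≤ (c g : ℝ) - ⌊(c g : ℝ)⌋₊ ∧ (c g : ℝ) - ⌊(c g : ℝ)⌋₊ ≤ 1 := fun g =>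
    ⟨sub_nonneg.2 (Nat.floor_le (c g).2), by
      have := Nat.lt_floor_add_one (c g : ℝ); linarith⟩
  have hqσ : q ∈ latticePoints σ := by
    rw [mem_latticePoints, hqr]
    exact Submodule.sum_mem _ fun g _ => smul_mem_cone (hfl g).1 (hmem g g.2)
  have hqK : ∀ i, |q i| ≤ K i := fun i => by
    have h1 : (q i : ℝ) = ∑ g, ((c g : ℝ) - ⌊(c g : ℝ)⌋₊) * ((g : Lattice) i : ℝ) := by
      have := congrFun hqr i
      simpa [toReal] using this
    have h2 : |(q i : ℝ)| ≤ ∑ g : G, |((g : Lattice) i : ℝ)| := by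
      rw [h1]
      refine (Finset.abs_sum_le_sum_abs _ _).trans (Finset.sum_le_sum fun g _ => ?_)
      rw [abs_mul, abs_of_nonneg (hfl g).1]
      exact mul_le_of_le_one_left (abs_nonneg _) (hfl g).2
    rw [hK]
    exact_mod_cast h2
  have hdec : (⟨p, hp⟩ : latticePoints σ) =
      ⟨q, hqσ⟩ + ∑ g : G, ⌊(c g : ℝ)⌋₊ • (⟨g, hmem g g.2⟩ : latticePoints σ) := by
    apply Subtype.ext
    rw [AddSubmonoid.coe_add, AddSubmonoid.coe_finsetSum]
    simp only [AddSubmonoidClass.coe_nsmul]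
    rw [hq, sub_add_cancel]
  rw [hdec]
  refine add_mem (AddSubmonoid.subset_closure ?_) (sum_mem fun g _ => nsmul_mem
    (AddSubmonoid.subset_closure ?_) _)
  · exact ⟨fun i => (abs_le.1 (hqK i)).1, fun i => (abs_le.1 (hqK i)).2⟩
  · have : ∀ i, |(g : Lattice) i| ≤ K i := fun i =>
      Finset.single_le_sum (f := fun g : G => |(g : Lattice) i|)
        (fun _ _ => abs_nonneg _) (Finset.mem_univ g)
    exact ⟨fun i => (abs_le.1 (this i)).1, fun i => (abs_le.1 (this i)).2⟩

/-- Adding a large multiple of the sum of the generators moves any lattice point into the cone,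
since the generators span the real space. -/
lemma span_latticePoints_eq_top
    (h : ∃ G : Finset Lattice, σ = PointedCone.hull ℝ (toReal '' (G : Set Lattice)))
    (hfull : Submodule.span ℝ (σ : Set (Fin 4 → ℝ)) = ⊤) :
    Submodule.span ℤ (latticePoints σ : Set Lattice) = ⊤ := by
  obtain ⟨G, hG⟩ := h
  have hmem : ∀ g ∈ G, toReal g ∈ σ := fun g hg => by
    rw [hG]; exact Submodule.subset_span ⟨g, hg, rfl⟩
  rw [eq_top_iff]
  rintro m -
  have hm : toReal m ∈ Submodule.span ℝ (toReal '' (G : Set Lattice)) := by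
    have h1 : Submodule.span ℝ (σ : Set (Fin 4 → ℝ)) ≤
        Submodule.span ℝ (toReal '' (G : Set Lattice)) := by
      rw [Submodule.span_le, hG]
      exact PointedCone.hull_le_span ℝ _
    exact h1 (hfull ▸ Submodule.mem_top)
  rw [Submodule.mem_span_image_finset_iff_exists_fun] at hm
  obtain ⟨c, hc⟩ := hm
  obtain ⟨N, hN⟩ : ∃ N : ℕ, ∀ g : G, 0 ≤ c g + N := by
    refine ⟨∑ g : G, ⌈|c g|⌉₊, fun g => ?_⟩
    have h1 : ⌈|c g|⌉₊ ≤ ∑ g : G, ⌈|c g|⌉₊ :=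
      Finset.single_le_sum (f := fun g => ⌈|c g|⌉₊) (fun _ _ => Nat.zero_le _) (Finset.mem_univ g)
    have h2 : |c g| ≤ ⌈|c g|⌉₊ := Nat.le_ceil _
    have h3 : ((⌈|c g|⌉₊ : ℕ) : ℝ) ≤ ((∑ g : G, ⌈|c g|⌉₊ : ℕ) : ℝ) := by exact_mod_cast h1
    have := neg_abs_le (c g)
    linarith
  have h0 : ∑ g : G, (g : Lattice) ∈ latticePoints σ := sum_mem fun g _ => hmem g g.2
  have h1 : m + N • ∑ g : G, (g : Lattice) ∈ latticePoints σ := by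
    rw [mem_latticePoints, toReal_add, toReal_nsmul, toReal_sum, ← hc, Finset.smul_sum,
      ← Finset.sum_add_distrib]
    refine Submodule.sum_mem _ fun g _ => ?_
    rw [← add_smul]
    exact smul_mem_cone (hN g) (hmem g g.2)
  have : m = (m + N • ∑ g : G, (g : Lattice)) - N • ∑ g : G, (g : Lattice) := by abel
  rw [this]
  exact sub_mem (Submodule.subset_span h1) (nsmul_mem (Submodule.subset_span h0) N)

/-- A surjective endomorphism of `ℤ⁴` is injective. -/
lemma linearIndependent_of_span_eq_top {v : Fin 4 → Lattice}
    (h : Submodule.span ℤ (Set.range v) = ⊤) : LinearIndependent ℤ v := by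
  rw [Fintype.linearIndependent_iff]
  have hinj : Function.Injective (Fintype.linearCombination ℤ v) := by
    apply OrzechProperty.injective_of_surjective_endomorphism
    rw [← LinearMap.range_eq_top, Fintype.range_linearCombination, h]
  intro g hg i
  exact congrFun (hinj (by rw [Fintype.linearCombination_apply, hg, map_zero]) : g = 0) i

lemma range_vec4 {M : Type*} (a b c d : M) : Set.range ![a, b, c, d] = {a, b, c, d} := by
  simp_rw [Matrix.range_cons, Matrix.range_empty, Set.singleton_union, insert_empty_eq]

lemma eq_zero_of_linearIndependent {a b c d : Lattice} (h : LinearIndependent ℤ ![a, b, c, d])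
    {i j k l : ℤ} (h0 : i • a + j • b + k • c + l • d = 0) : i = 0 ∧ j = 0 ∧ k = 0 ∧ l = 0 := by
  have := Fintype.linearIndependent_iff.1 h ![i, j, k, l] (by
    simpa [Fin.sum_univ_four] using h0)
  exact ⟨this 0, this 1, this 2, this 3⟩

end Lattice

section Monoid

/-- Let `P` be a finitely generated cancellative monoid with a face `F` such that for each element
off `F`, after adding some `f ∈ F`, one of `A`, `B ∉ F` can be subtracted. Then up to `F` each
element of `P` is a combination of `A` and `B`. -/
lemma exists_eq_add_of_face {P : Type*} [AddCommMonoid P] [IsCancelAdd P] {H : Set P}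
    (hH : H.Finite) (hHtop : AddSubmonoid.closure H = ⊤) (F : AddSubmonoid P)
    (hF : ∀ p q, p + q ∈ F → p ∈ F) {f A B : P} (hf : f ∈ F) (hA : A ∉ F) (hB : B ∉ F)
    (step : ∀ p ∉ F, (∃ q, p + f = A + q) ∨ ∃ q, p + f = B + q) (p : P) :
    ∃ q ∈ F, ∃ k i j : ℕ, p + k • f = q + i • A + j • B := by
  let G : AddSubmonoid P :=
    { carrier := {p | ∃ q ∈ F, ∃ k i j : ℕ, p + k • f = q + i • A + j • B}
      zero_mem' := ⟨0, F.zero_mem, 0, 0, 0, by simp⟩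
      add_mem' := by
        rintro p p' ⟨q, hq, k, i, j, h⟩ ⟨q', hq', k', i', j', h'⟩
        refine ⟨q + q', F.add_mem hq hq', k + k', i + i', j + j', ?_⟩
        rw [add_smul, add_smul, add_smul, add_add_add_comm, h, h']
        abel }
  -- `R h' h` says that modulo `F` the element `h'` divides `h` with a cofactor involving `A` or
  -- `B`. As `F` is a face and `A, B ∉ F`, this is a strict order, hence well-founded on the finite
  -- set `H`.
  let R : P → P → Prop := fun h' h => ∃ (k : ℕ) (c p' : P), (c = A ∨ c = B) ∧
    h + k • f = c + h' + p'
  have : IsStrictOrder P R :=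
    { irrefl := by
        rintro h ⟨k, c, p', hc, hh⟩
        have h1 : k • f = c + p' := by
          apply add_left_cancel (a := h)
          rw [hh]; abel
        have h2 : c ∈ F := hF c p' (h1 ▸ F.nsmul_mem hf k)
        rcases hc with rfl | rfl
        exacts [hA h2, hB h2]
      trans := by
        rintro h'' h' h ⟨k', c', p'', _, hh'⟩ ⟨k, c, p', hc, hh⟩
        refine ⟨k + k', c, c' + p' + p'', hc, ?_⟩
        rw [add_smul, ← add_assoc, hh]
        calc c + h' + p' + k' • f = c + (h' + k' • f) + p' := by abel
          _ = _ := by rw [hh']; abel }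
  have hHG : H ⊆ G := fun h hh => by
    refine (hH.wellFoundedOn (r := R)).induction hh fun h _ ih => ?_
    by_cases hhF : h ∈ F
    · exact ⟨h, hhF, 0, 0, 0, by simp⟩
    -- All generators occurring in `p'` are smaller than `h`, so the induction hypothesis applies to
    -- each of them.
    have hsum : ∀ c p' : P, (c = A ∨ c = B) → h + f = c + p' → p' ∈ G := fun c p' hc hp' => by
      obtain ⟨l, hl, rfl⟩ := AddSubmonoid.exists_multiset_of_mem_closure
        (hHtop ▸ AddSubmonoid.mem_top p' : p' ∈ AddSubmonoid.closure H)
      classical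
      refine AddSubmonoid.multiset_sum_mem _ _ fun y hy => ih y (hl y hy) ?_
      refine ⟨1, c, (l.erase y).sum, hc, ?_⟩
      rw [one_smul, hp', add_assoc, Multiset.sum_erase hy]
    rcases step h hhF with ⟨q, hq⟩ | ⟨q, hq⟩
    · obtain ⟨q', hq', k, i, j, h'⟩ := hsum A q (.inl rfl) hq
      refine ⟨q', hq', k + 1, i + 1, j, ?_⟩
      rw [add_smul, one_smul, add_comm (k • f), ← add_assoc, hq, add_assoc, h', add_smul, one_smul]
      abel
    · obtain ⟨q', hq', k, i, j, h'⟩ := hsum B q (.inr rfl) hq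
      refine ⟨q', hq', k + 1, i, j + 1, ?_⟩
      rw [add_smul, one_smul, add_comm (k • f), ← add_assoc, hq, add_assoc, h', add_smul, one_smul]
      abel
  have : G = ⊤ := by rw [eq_top_iff, ← hHtop, AddSubmonoid.closure_le]; exact hHG
  exact (this ▸ AddSubmonoid.mem_top p : p ∈ G)

end Monoid

end Tent

end

/-! ### The bottom basis, the spanning monomials and the determinant -/

noncomputable section

namespace Tent

/-- The hypotheses express the coordinates of `ξ` and `η` with respect to `x₀, y₀, A, B`, so `ab -
rs` is a unit. The nonnegative exponents `i, j, j'` make `m, n, n'` nonpositive. From `n(ab - rs) =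
r > 0` the unit is `-1`, and then `b = -m` and `a = -n'`. -/
lemma int_det_of_inverse {r s a b m n i j m' n' j' : ℤ} (hr : 1 ≤ r) (hs : 1 ≤ s)
    (hi : 0 ≤ i) (hj : 0 ≤ j) (hj' : 0 ≤ j')
    (h1 : m * a - n * s - 1 = 0) (h2 : -(m * r) + n * b = 0) (h3 : m * r + i = 0)
    (h4 : n * s + j = 0) (h1' : m' * a - n' * s = 0) (h2' : -(m' * r) + n' * b - 1 = 0)
    (h4' : n' * s + j' = 0) :
    r * s - a * b = 1 ∧ 0 ≤ a ∧ 0 ≤ b := by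
  have hm : m ≤ 0 := by nlinarith
  have hn : n ≤ 0 := by nlinarith
  have hn' : n' ≤ 0 := by nlinarith
  have e1 : n * (a * b - r * s) = r := by linear_combination a * h2 + r * h1
  have e2 : m * (a * b - r * s) = b := by linear_combination b * h1 + s * h2
  have e3 : n' * (a * b - r * s) = a := by linear_combination a * h2' + r * h1'
  have hneg : a * b - r * s < 0 := by
    by_contra h
    nlinarith
  have hunit : (a * b - r * s) * (m * n' - m' * n) = 1 := by
    linear_combination (-(m' * r) + n' * b) * h1 + h2' - (-(m * r) + n * b) * h1'
  rcases Int.eq_one_or_neg_one_of_mul_eq_one hunit with h | h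
  · omega
  · rw [h] at e2 e3
    exact ⟨by linarith, by linarith, by linarith⟩

namespace ToricDeformation

variable {r α s β : ℕ} {D : ToricDeformation r α s β}

/-- The face of monomials that do not vanish on `S_j`. -/
def faceSubmonoid (D : ToricDeformation r α s β) (j : Fin 4) :
    AddSubmonoid (latticePoints D.cone) where
  carrier := {p | D.OnFace j p}
  zero_mem' := onFace_zero j
  add_mem' hp hq := onFace_add.2 ⟨hp, hq⟩

lemma not_onFace_A' (j : Fin 4) : ¬ D.OnFace j D.A := by simpa using D.not_onFace_A j 0

lemma not_onFace_B' (j : Fin 4) : ¬ D.OnFace j D.B := by simpa using D.not_onFace_B j 0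

namespace Axes

variable (c : D.Axes)

/-- The monomial `x₀ y₀` survives on `S₀` only. So its product with a monomial off the face of `S₀`
vanishes on `T` and is divisible by `A` or `B`, which is the input of `exists_eq_add_of_face`. On
the face itself all monomials are products of powers of `x₀` and `y₀`. -/
lemma exists_bottom_decomposition (hr : 1 ≤ r) (hs : 1 ≤ s) (p : latticePoints D.cone) :
    ∃ (m n : ℤ) (i j : ℕ), (p : Lattice) =
      m • (c.x₀ : Lattice) + n • (c.y₀ : Lattice) + (i : ℤ) • (D.A : Lattice)
        + (j : ℤ) • (D.B : Lattice) := by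
  obtain ⟨H, hH, hHtop⟩ := exists_finite_closure_eq_top D.rational
  have hf : D.OnFace 0 (c.x₀ + c.y₀) :=
    onFace_add.2 ⟨(c.fst_spec 0).1, (c.snd_spec 0).1⟩
  obtain ⟨q, hq, k, i, j, h⟩ := exists_eq_add_of_face hH hHtop (D.faceSubmonoid 0)
    (fun p q h => (onFace_add.1 h).1) (f := c.x₀ + c.y₀) (A := D.A) (B := D.B) hf
    (not_onFace_A' 0) (not_onFace_B' 0) (fun p hp => by
      by_contra hcon
      rw [← exists_onFace_iff] at hcon
      obtain ⟨j, hj⟩ := hcon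
      obtain ⟨hj1, hj2⟩ := onFace_add.1 hj
      by_cases hj0 : j = 0
      · subst hj0; exact hp hj1
      · exact c.not_onFace_x₀_add_y₀ hj0 hj2) p
  refine ⟨D.expo 0 q 0 - k, D.expo 0 q 1 - k, i, j, ?_⟩
  have h1 : (q : Lattice) = D.expo 0 q 0 • (c.x₀ : Lattice) + D.expo 0 q 1 • (c.y₀ : Lattice) :=
    congrArg Subtype.val (c.eq_combination hr hs rfl hq)
  have h2 : (p : Lattice) + k • ((c.x₀ : Lattice) + c.y₀) =
      q + i • (D.A : Lattice) + j • (D.B : Lattice) := congrArg Subtype.val h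
  rw [h1] at h2
  rw [eq_sub_of_add_eq h2]
  simp only [sub_smul, natCast_zsmul, smul_add]
  abel

lemma span_bottom_eq_top (hr : 1 ≤ r) (hs : 1 ≤ s) :
    Submodule.span ℤ {(c.x₀ : Lattice), (c.y₀ : Lattice), (D.A : Lattice), (D.B : Lattice)} = ⊤ := by
  rw [eq_top_iff, ← span_latticePoints_eq_top D.rational D.fullDim, Submodule.span_le]
  intro p hp
  obtain ⟨m, n, i, j, h⟩ := c.exists_bottom_decomposition hr hs ⟨p, hp⟩
  change p = _ at h
  rw [h]
  refine add_mem (add_mem (add_mem ?_ ?_) ?_) ?_ <;>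
    exact Submodule.smul_mem _ _ (Submodule.subset_span (by simp))

lemma linearIndependent_bottom (hr : 1 ≤ r) (hs : 1 ≤ s) :
    LinearIndependent ℤ ![(c.x₀ : Lattice), c.y₀, D.A, D.B] :=
  linearIndependent_of_span_eq_top (by rw [range_vec4, c.span_bottom_eq_top hr hs])

/-- Every monomial is a product of powers of `A` and `B` with a monomial not vanishing on the
tent. -/
lemma exists_eq_add_onFace (c : D.Axes) (hr : 1 ≤ r) (hs : 1 ≤ s) (p : latticePoints D.cone) :
    ∃ (q : latticePoints D.cone) (i j : ℕ), p = q + i • D.A + j • D.B ∧ ∃ l, D.OnFace l q := by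
  obtain ⟨m, n, i, j, h⟩ := c.exists_bottom_decomposition hr hs p
  obtain ⟨N, hN⟩ : ∃ N, N = i + j := ⟨_, rfl⟩
  induction N using Nat.strong_induction_on generalizing p m n i j with
  | _ N ih =>
    by_cases hp : ∃ l, D.OnFace l p
    · exact ⟨p, 0, 0, by simp, hp⟩
    rw [exists_onFace_iff, not_not] at hp
    rcases hp with ⟨q, rfl⟩ | ⟨q, rfl⟩
    · obtain ⟨m', n', i', j', h'⟩ := c.exists_bottom_decomposition hr hs q
      have h1 : (D.A : Lattice) + q = ((D.A + q : latticePoints D.cone) : Lattice) := rfl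
      rw [h, h'] at h1
      -- Exponents in a basis are unique, so removing `A` lowers `i` by one and keeps `j`; the sum
      -- `i + j` decreases and remains a natural number.
      obtain ⟨-, -, e3, e4⟩ := eq_zero_of_linearIndependent (c.linearIndependent_bottom hr hs)
        (i := m - m') (j := n - n') (k := i - i' - 1) (l := j - j') (by
          simp only [sub_smul, one_smul]
          rw [← sub_eq_zero] at h1
          rw [← neg_eq_zero, ← h1]
          abel)
      obtain ⟨q', k, l, hq', hl⟩ := ih (i' + j') (by omega) q m' n' i' j' h' rfl
      refine ⟨q', k + 1, l, ?_, hl⟩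
      rw [hq', add_smul, one_smul]
      abel
    · obtain ⟨m', n', i', j', h'⟩ := c.exists_bottom_decomposition hr hs q
      have h1 : (D.B : Lattice) + q = ((D.B + q : latticePoints D.cone) : Lattice) := rfl
      rw [h, h'] at h1
      obtain ⟨-, -, e3, e4⟩ := eq_zero_of_linearIndependent (c.linearIndependent_bottom hr hs)
        (i := m - m') (j := n - n') (k := i - i') (l := j - j' - 1) (by
          simp only [sub_smul, one_smul]
          rw [← sub_eq_zero] at h1
          rw [← neg_eq_zero, ← h1]
          abel)
      obtain ⟨q', k, l, hq', hl⟩ := ih (i' + j') (by omega) q m' n' i' j' h' rfl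
      refine ⟨q', k, l + 1, ?_, hl⟩
      rw [hq', add_smul, one_smul]
      abel

/-- The monomials that generate the cone of the deformation. -/
def generators : Set (latticePoints D.cone) := {c.ξ, c.η, D.A, D.B, c.x₀, c.y₀}

/-- After removing powers of `A` and `B`, a monomial survives on some component, and there
`axisDeg_smul` writes a multiple of it in axis monomials. Passing to a multiple is harmless for the
cone. -/
lemma exists_nsmul_mem_closure (hr : 1 ≤ r) (hs : 1 ≤ s) (p : latticePoints D.cone) :
    ∃ N : ℕ, N ≠ 0 ∧ N • p ∈ AddSubmonoid.closure c.generators := by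
  obtain ⟨q, i, j, rfl, l, hl⟩ := c.exists_eq_add_onFace hr hs p
  have hfst : c.fst l ∈ AddSubmonoid.closure c.generators := by
    refine AddSubmonoid.subset_closure ?_
    fin_cases l <;> simp [fst, generators]
  have hsnd : c.snd l ∈ AddSubmonoid.closure c.generators := by
    refine AddSubmonoid.subset_closure ?_
    fin_cases l <;> simp [snd, generators]
  have hA : D.A ∈ AddSubmonoid.closure c.generators :=
    AddSubmonoid.subset_closure (by simp [generators])
  have hB : D.B ∈ AddSubmonoid.closure c.generators :=
    AddSubmonoid.subset_closure (by simp [generators])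
  refine ⟨axisDeg r s l, ?_, ?_⟩
  · fin_cases l <;> simp [axisDeg] <;> omega
  · rw [smul_add, smul_add, c.axisDeg_smul hr hs hl]
    exact add_mem (add_mem (add_mem (nsmul_mem hfst _) (nsmul_mem hsnd _))
      (nsmul_mem (nsmul_mem hA _) _)) (nsmul_mem (nsmul_mem hB _) _)

lemma cone_eq_hull (hr : 1 ≤ r) (hs : 1 ≤ s) :
    D.cone = PointedCone.hull ℝ
      (toReal '' {(c.ξ : Lattice), (c.η : Lattice), (D.A : Lattice), (D.B : Lattice),
        (c.x₀ : Lattice), (c.y₀ : Lattice)}) := by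
  apply le_antisymm
  · obtain ⟨G, hG⟩ := D.rational
    conv_lhs => rw [hG]
    rw [PointedCone.hull, Submodule.span_le]
    rintro _ ⟨g, hg, rfl⟩
    have hgσ : g ∈ latticePoints D.cone := by
      rw [mem_latticePoints, hG]; exact Submodule.subset_span ⟨g, hg, rfl⟩
    obtain ⟨N, hN, hmem⟩ := c.exists_nsmul_mem_closure hr hs ⟨g, hgσ⟩
    refine mem_cone_of_nsmul hN ?_
    have key : ∀ p ∈ AddSubmonoid.closure c.generators,
        toReal (p : Lattice) ∈ PointedCone.hull ℝ
          (toReal '' {(c.ξ : Lattice), (c.η : Lattice), (D.A : Lattice), (D.B : Lattice),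
            (c.x₀ : Lattice), (c.y₀ : Lattice)}) := by
      intro p hp
      induction hp using AddSubmonoid.closure_induction with
      | mem x hx =>
        refine Submodule.subset_span ⟨x, ?_, rfl⟩
        simp only [generators, Set.mem_insert_iff, Set.mem_singleton_iff] at hx
        rcases hx with rfl | rfl | rfl | rfl | rfl | rfl <;> simp
      | zero => exact mem_latticePoints.1 (zero_mem _)
      | add x y _ _ hx hy =>
        exact mem_latticePoints.1 (add_mem (mem_latticePoints.2 hx) (mem_latticePoints.2 hy))
    exact key _ hmem
  · rw [PointedCone.hull, Submodule.span_le]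
    rintro _ ⟨x, hx, rfl⟩
    simp only [Set.mem_insert_iff, Set.mem_singleton_iff] at hx
    rcases hx with rfl | rfl | rfl | rfl | rfl | rfl
    exacts [c.ξ.2, c.η.2, D.A.2, D.B.2, c.x₀.2, c.y₀.2]

end Axes

/-- The axis monomials of a deformation that smooths the top axes, together with the monomials
cutting out the transversal directions along these axes, and the relations between them. -/
structure Frame (D : ToricDeformation r α s β) (a b : ℤ) extends Axes D where
  w₁ : latticePoints D.cone
  w₃ : latticePoints D.cone
  n₁ : ℕ
  n₃ : ℕ
  onFace_w₁ : D.OnFace 1 w₁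
  expo_w₁ : D.expo 1 w₁ = expVec 1 (2 * r - α)
  add_n₁ : D.A + n₁ • ξ = w₁ + η
  onFace_w₃ : D.OnFace 3 w₃
  expo_w₃ : D.expo 3 w₃ = expVec 1 (2 * s - β)
  add_n₃ : D.B + n₃ • η = w₃ + ξ
  a_eq : a = r * n₁ - 2 * r + α
  b_eq : b = s * n₃ - 2 * s + β
  x₀_eq : (x₀ : Lattice) = (r : ℤ) • ((D.A : Lattice) - η) + a • (ξ : Lattice)
  y₀_eq : (y₀ : Lattice) = b • (η : Lattice) + (s : ℤ) • ((D.B : Lattice) - ξ)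
  span_eq_top : Submodule.span ℤ {(ξ : Lattice), (η : Lattice), (D.A : Lattice), (D.B : Lattice)} = ⊤
  det_eq : r * s - a * b = 1
  a_nonneg : 0 ≤ a
  b_nonneg : 0 ≤ b

lemma Frame.linearIndependent {a b : ℤ} (F : D.Frame a b) :
    LinearIndependent ℤ ![(F.ξ : Lattice), F.η, D.A, D.B] :=
  linearIndependent_of_span_eq_top (by rw [range_vec4, F.span_eq_top])

/-- The monomials `w₁` and `w₃` are eliminated between the smoothing relations and their expressions
on `S₁` and `S₃`. The two bases `x₀, y₀, A, B` and `ξ, η, A, B` are then compared. -/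
lemma exists_frame (hr : 1 ≤ r) (hs : 1 ≤ s) (hα : α ≤ r) (hβ : β ≤ s)
    (hξ : D.SmoothsXi) (hη : D.SmoothsEta) : ∃ a b, Nonempty (D.Frame a b) := by
  obtain ⟨c⟩ := D.nonempty_axes hr hs
  obtain ⟨w₁, n₁, hw₁, hwe₁, hA⟩ := hξ.relation hr hs hα c
  obtain ⟨w₃, n₃, hw₃, hwe₃, hB⟩ := hη.relation hr hs hβ c
  have hA' : (w₁ : Lattice) = (D.A : Lattice) + n₁ • (c.ξ : Lattice) - c.η :=
    eq_sub_of_add_eq (congrArg Subtype.val hA.symm)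
  have hB' : (w₃ : Lattice) = (D.B : Lattice) + n₃ • (c.η : Lattice) - c.ξ :=
    eq_sub_of_add_eq (congrArg Subtype.val hB.symm)
  -- On `S₁` one has `r w₁ = x₀ + (2r - α) ξ`, while the smoothing relation reads `w₁ = A + n₁ ξ -
  -- η`.
  have hx : (c.x₀ : Lattice) = (r : ℤ) • ((D.A : Lattice) - c.η)
      + ((r : ℤ) * n₁ - 2 * r + α) • (c.ξ : Lattice) := by
    have h := congrArg Subtype.val (c.axisDeg_smul hr hs hw₁)
    rw [hwe₁] at h
    simp only [expVec_zero, expVec_one, one_smul] at h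
    have h' : (r : ℤ) • (w₁ : Lattice) = (c.x₀ : Lattice) + ((2 * r - α : ℕ) : ℤ) • (c.ξ : Lattice) := by
      simp only [natCast_zsmul]; exact h
    rw [hA', Nat.cast_sub (by omega)] at h'
    rw [← sub_eq_iff_eq_add] at h'
    rw [← h']
    push_cast
    module
  have hy : (c.y₀ : Lattice) = ((s : ℤ) * n₃ - 2 * s + β) • (c.η : Lattice)
      + (s : ℤ) • ((D.B : Lattice) - c.ξ) := by
    have h := congrArg Subtype.val (c.axisDeg_smul hr hs hw₃)
    rw [hwe₃] at h
    simp only [expVec_zero, expVec_one, one_smul] at h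
    have h' : (s : ℤ) • (w₃ : Lattice) = (c.y₀ : Lattice) + ((2 * s - β : ℕ) : ℤ) • (c.η : Lattice) := by
      simp only [natCast_zsmul]; exact h
    rw [hB', Nat.cast_sub (by omega)] at h'
    rw [← sub_eq_iff_eq_add] at h'
    rw [← h']
    push_cast
    module
  set a : ℤ := (r : ℤ) * n₁ - 2 * r + α with ha
  set b : ℤ := (s : ℤ) * n₃ - 2 * s + β with hb
  have hspan : Submodule.span ℤ
      {(c.ξ : Lattice), (c.η : Lattice), (D.A : Lattice), (D.B : Lattice)} = ⊤ := by
    rw [eq_top_iff, ← c.span_bottom_eq_top hr hs, Submodule.span_le]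
    have h1 : (c.ξ : Lattice) ∈ Submodule.span ℤ
      {(c.ξ : Lattice), (c.η : Lattice), (D.A : Lattice), (D.B : Lattice)} :=
        Submodule.subset_span (by simp)
    have h2 : (c.η : Lattice) ∈ Submodule.span ℤ
      {(c.ξ : Lattice), (c.η : Lattice), (D.A : Lattice), (D.B : Lattice)} :=
        Submodule.subset_span (by simp)
    have h3 : (D.A : Lattice) ∈ Submodule.span ℤ
      {(c.ξ : Lattice), (c.η : Lattice), (D.A : Lattice), (D.B : Lattice)} :=
        Submodule.subset_span (by simp)
    have h4 : (D.B : Lattice) ∈ Submodule.span ℤ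
      {(c.ξ : Lattice), (c.η : Lattice), (D.A : Lattice), (D.B : Lattice)} :=
        Submodule.subset_span (by simp)
    rintro x (rfl | rfl | rfl | rfl)
    · rw [hx]
      exact add_mem (Submodule.smul_mem _ _ (sub_mem h3 h2)) (Submodule.smul_mem _ _ h1)
    · rw [hy]
      exact add_mem (Submodule.smul_mem _ _ h2) (Submodule.smul_mem _ _ (sub_mem h4 h1))
    · exact h3
    · exact h4
  have hli : LinearIndependent ℤ ![(c.ξ : Lattice), c.η, D.A, D.B] :=
    linearIndependent_of_span_eq_top (by rw [range_vec4, hspan])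
  obtain ⟨m, n, i, j, h⟩ := c.exists_bottom_decomposition hr hs c.ξ
  obtain ⟨m', n', i', j', h'⟩ := c.exists_bottom_decomposition hr hs c.η
  -- Substituting `x₀` and `y₀` in the bottom decomposition of `ξ` and comparing coefficients in `ξ,
  -- η, A, B`; then the same for `η`.
  obtain ⟨e1, e2, e3, e4⟩ := eq_zero_of_linearIndependent hli
    (i := m * a - n * s - 1) (j := -(m * r) + n * b) (k := m * r + i) (l := n * s + j) (by
      rw [hx, hy, ← sub_eq_zero, ← neg_eq_zero] at h
      rw [← h]
      module)
  obtain ⟨e1', e2', e3', e4'⟩ := eq_zero_of_linearIndependent hli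
    (i := m' * a - n' * s) (j := -(m' * r) + n' * b - 1) (k := m' * r + i') (l := n' * s + j') (by
      rw [hx, hy, ← sub_eq_zero, ← neg_eq_zero] at h'
      rw [← h']
      module)
  obtain ⟨hdet, ha0, hb0⟩ := int_det_of_inverse (by exact_mod_cast hr) (by exact_mod_cast hs)
    (by positivity) (by positivity) (by positivity) e1 e2 e3 e4 e1' e2' e4'
  exact ⟨a, b, ⟨{ c with
    w₁ := w₁, w₃ := w₃, n₁ := n₁, n₃ := n₃, onFace_w₁ := hw₁, expo_w₁ := hwe₁, add_n₁ := hA,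
    onFace_w₃ := hw₃, expo_w₃ := hwe₃, add_n₃ := hB, a_eq := rfl, b_eq := rfl, x₀_eq := hx,
    y₀_eq := hy, span_eq_top := hspan, det_eq := hdet, a_nonneg := ha0, b_nonneg := hb0 }⟩⟩

end ToricDeformation

end Tent

end

/-! ### Invariance of the matrix and the isomorphism of monomial monoids -/

noncomputable section

namespace Tent

namespace ToricDeformation

variable {r α s β : ℕ} {D D' : ToricDeformation r α s β} {a b : ℤ}

lemma Lifts.map {φ : toricRing D.cone ≃ₐ[ℂ] toricRing D'.cone}
    (hmono : ∀ p, ∃ (q : latticePoints D'.cone) (c : ℂ), φ (mono p) = c • mono q)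
    (hres : ∀ f, D'.restrict (φ f) = D.restrict f) {p : latticePoints D.cone} {F : Fin 4 → Poly2}
    (h : D.Lifts p F) :
    ∃ (q : latticePoints D'.cone) (c : ℂ), c ≠ 0 ∧ φ (mono p) = c • mono q ∧ D'.Lifts q F := by
  obtain ⟨q, c, hq⟩ := hmono p
  obtain ⟨d, hd, hp⟩ := h
  have hc : c ≠ 0 := by
    rintro rfl
    rw [zero_smul, map_eq_zero_iff _ φ.injective] at hq
    have := congrArg AddMonoidAlgebra.coeff hq
    simp [mono] at this
  refine ⟨q, c, hc, hq, c⁻¹ * d, mul_ne_zero (inv_ne_zero hc) hd, ?_⟩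
  have h1 := hres (mono p)
  rw [hq, map_smul] at h1
  have h2 : (c • D'.restrict (mono q) : tentRing r α s β).1 = d • F := by rw [h1, hp]
  change (D'.restrict (mono q)).1 = _
  rw [mul_smul, ← h2]
  change _ = c⁻¹ • c • (D'.restrict (mono q)).1
  rw [smul_smul, inv_mul_cancel₀ hc, one_smul]

/-- An isomorphism over `T` takes lifts of the axis coordinates to lifts, which are unique up to
scalars, and respects `A` and `B`. It therefore carries the relations for `x₀` and `y₀` to those of
`D'`, where `a` and `b` are coordinates in a basis. -/
lemma HasMatrix.unique_of_iso (hr : 1 ≤ r) (hs : 1 ≤ s)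
    {g g' : Matrix.SpecialLinearGroup (Fin 2) ℤ} (hg : g ∈ matrices r α s β)
    (hg' : g' ∈ matrices r α s β) (h : D.HasMatrix g) (h' : D'.HasMatrix g') (hiso : D.Iso D') :
    g = g' := by
  obtain ⟨φ, hmono, ⟨cA, hcA, hA⟩, ⟨cB, hcB, hB⟩, hres⟩ := hiso
  obtain ⟨x₀, y₀, ξ, η, hx₀, hy₀, hξ, hη, -, -, ex, ey, -⟩ := h
  obtain ⟨x₀', y₀', ξ', η', hx₀', hy₀', hξ', hη', hli, -, ex', ey', -⟩ := h'
  obtain ⟨g00, g11, ha, hb, -, -⟩ := hg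
  obtain ⟨g00', g11', ha', hb', -, -⟩ := hg'
  obtain ⟨qx, cx, hcx, hφx, hqx⟩ := hx₀.map hmono hres
  obtain ⟨qy, cy, hcy, hφy, hqy⟩ := hy₀.map hmono hres
  obtain ⟨qξ, cξ, hcξ, hφξ, hqξ⟩ := hξ.map hmono hres
  obtain ⟨qη, cη, hcη, hφη, hqη⟩ := hη.map hmono hres
  rw [hqx.unique hr hs hx₀' (coordX0_zero r)] at hφx
  rw [hqy.unique hr hs hy₀' (coordY0_zero s)] at hφy
  rw [hqξ.unique hr hs hξ' (coordXi_two r)] at hφξ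
  rw [hqη.unique hr hs hη' (coordEta_two s)] at hφη
  obtain ⟨a, ha⟩ := Int.eq_ofNat_of_zero_le ha
  obtain ⟨b, hb⟩ := Int.eq_ofNat_of_zero_le hb
  -- The relations are written without negative exponents so that they hold in the monoid and can be
  -- transported by `φ`.
  have e1 : x₀ + r • η = r • D.A + a • ξ := Subtype.ext (by
    change (x₀ : Lattice) + r • (η : Lattice) = r • (D.A : Lattice) + a • (ξ : Lattice)
    rw [ex, g00, ha]
    module)
  have e2 : y₀ + s • ξ = s • D.B + b • η := Subtype.ext (by
    change (y₀ : Lattice) + s • (ξ : Lattice) = s • (D.B : Lattice) + b • (η : Lattice)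
    rw [ey, g11, hb]
    module)
  have k1 := congrArg (fun p => φ (mono p)) e1
  have k2 := congrArg (fun p => φ (mono p)) e2
  simp only [mono_add, mono_nsmul, map_mul, map_pow, hφx, hφy, hφξ, hφη, hA, hB, smul_pow,
    smul_mul_smul_comm] at k1 k2
  simp only [← mono_nsmul, ← mono_add] at k1 k2
  have k1' : (x₀' : Lattice) + r • (η' : Lattice) = r • (D'.A : Lattice) + a • (ξ' : Lattice) :=
    congrArg Subtype.val (eq_of_smul_mono_eq (mul_ne_zero hcx (pow_ne_zero _ hcη)) k1)
  have k2' : (y₀' : Lattice) + s • (ξ' : Lattice) = s • (D'.B : Lattice) + b • (η' : Lattice) :=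
    congrArg Subtype.val (eq_of_smul_mono_eq (mul_ne_zero hcy (pow_ne_zero _ hcξ)) k2)
  rw [ex', g00', ← sub_eq_zero] at k1'
  rw [ey', g11', ← sub_eq_zero] at k2'
  have l1 := (eq_zero_of_linearIndependent hli (i := g' 0 1 - a) (j := 0) (k := 0) (l := 0)
    (by rw [← k1']; module)).1
  have l2 := (eq_zero_of_linearIndependent hli (i := 0) (j := g' 1 0 - b) (k := 0) (l := 0)
    (by rw [← k2']; module)).2.1
  ext i j
  fin_cases i <;> fin_cases j
  · exact g00.trans g00'.symm
  · exact ha.trans (sub_eq_zero.1 l1).symm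
  · exact hb.trans (sub_eq_zero.1 l2).symm
  · exact g11.trans g11'.symm

namespace Frame

lemma hasMatrix (hr : 1 ≤ r) (hs : 1 ≤ s) (F : D.Frame a b)
    {g : Matrix.SpecialLinearGroup (Fin 2) ℤ} (h00 : g 0 0 = r) (h01 : g 0 1 = a)
    (h10 : g 1 0 = b) (h11 : g 1 1 = s) : D.HasMatrix g :=
  ⟨F.x₀, F.y₀, F.ξ, F.η, F.hx₀, F.hy₀, F.hξ, F.hη, F.linearIndependent, F.span_eq_top,
    by rw [h00, h01, F.x₀_eq], by rw [h10, h11, F.y₀_eq], F.cone_eq_hull hr hs⟩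

/-- The matrix in `SL(2, ℤ)` of a frame. -/
def matrix (F : D.Frame a b) : Matrix.SpecialLinearGroup (Fin 2) ℤ :=
  ⟨!![(r : ℤ), a; b, s], by rw [Matrix.det_fin_two_of, F.det_eq]⟩

lemma matrix_mem (F : D.Frame a b) : F.matrix ∈ matrices r α s β :=
  ⟨rfl, rfl, F.a_nonneg, F.b_nonneg,
    (Int.modEq_iff_dvd.2 ⟨2 - F.n₁, by
      change (α : ℤ) - a = _
      linear_combination -F.a_eq⟩),
    (Int.modEq_iff_dvd.2 ⟨2 - F.n₃, by
      change (β : ℤ) - b = _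
      linear_combination -F.b_eq⟩)⟩

/-- The basis `ξ, η, A, B` of the monomial lattice. -/
def basis (F : D.Frame a b) : Module.Basis (Fin 4) ℤ Lattice :=
  Module.Basis.mk F.linearIndependent (by rw [range_vec4, F.span_eq_top])

lemma basis_apply (F : D.Frame a b) (i : Fin 4) :
    F.basis i = ![(F.ξ : Lattice), F.η, D.A, D.B] i := by
  rw [basis, Module.Basis.mk_apply]

/-- The isomorphism of lattices matching the bases `ξ, η, A, B`. -/
def latticeEquiv (F : D.Frame a b) (F' : D'.Frame a b) : Lattice ≃ₗ[ℤ] Lattice :=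
  F.basis.equiv F'.basis (Equiv.refl _)

variable (F : D.Frame a b) (F' : D'.Frame a b)

lemma latticeEquiv_basis (i : Fin 4) :
    F.latticeEquiv F' (![(F.ξ : Lattice), F.η, D.A, D.B] i) =
      ![(F'.ξ : Lattice), F'.η, D'.A, D'.B] i := by
  rw [← basis_apply, ← basis_apply, latticeEquiv, Module.Basis.equiv_apply, Equiv.refl_apply]

lemma latticeEquiv_ξ : F.latticeEquiv F' F.ξ = F'.ξ := F.latticeEquiv_basis F' 0

lemma latticeEquiv_η : F.latticeEquiv F' F.η = F'.η := F.latticeEquiv_basis F' 1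

lemma latticeEquiv_A : F.latticeEquiv F' D.A = D'.A := F.latticeEquiv_basis F' 2

lemma latticeEquiv_B : F.latticeEquiv F' D.B = D'.B := F.latticeEquiv_basis F' 3

lemma latticeEquiv_x₀ : F.latticeEquiv F' F.x₀ = F'.x₀ := by
  rw [F.x₀_eq, F'.x₀_eq, map_add, map_smul, map_smul, map_sub, latticeEquiv_ξ, latticeEquiv_η,
    latticeEquiv_A]

lemma latticeEquiv_y₀ : F.latticeEquiv F' F.y₀ = F'.y₀ := by
  rw [F.y₀_eq, F'.y₀_eq, map_add, map_smul, map_smul, map_sub, latticeEquiv_ξ, latticeEquiv_η,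
    latticeEquiv_B]

/-- The six generators correspond to each other, because `x₀` and `y₀` are given by the same
formulas; a multiple of any monomial is a sum of generators. -/
lemma latticeEquiv_mem (hr : 1 ≤ r) (hs : 1 ≤ s) (p : latticePoints D.cone) :
    F.latticeEquiv F' p ∈ latticePoints D'.cone := by
  obtain ⟨N, hN, hmem⟩ := F.exists_nsmul_mem_closure hr hs p
  have key : ∀ p ∈ AddSubmonoid.closure F.generators,
      F.latticeEquiv F' p ∈ latticePoints D'.cone := by
    intro p hp
    induction hp using AddSubmonoid.closure_induction with
    | mem x hx =>
      simp only [Axes.generators, Set.mem_insert_iff, Set.mem_singleton_iff] at hx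
      rcases hx with rfl | rfl | rfl | rfl | rfl | rfl
      · rw [latticeEquiv_ξ]; exact F'.ξ.2
      · rw [latticeEquiv_η]; exact F'.η.2
      · rw [latticeEquiv_A]; exact D'.A.2
      · rw [latticeEquiv_B]; exact D'.B.2
      · rw [latticeEquiv_x₀]; exact F'.x₀.2
      · rw [latticeEquiv_y₀]; exact F'.y₀.2
    | zero => rw [AddSubmonoid.coe_zero, map_zero]; exact zero_mem _
    | add x y _ _ hx hy => rw [AddSubmonoid.coe_add, map_add]; exact add_mem hx hy
  have h := key _ hmem
  rw [AddSubmonoidClass.coe_nsmul, map_nsmul] at h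
  exact mem_cone_of_nsmul hN h

/-- The isomorphism of monoids of monomials of two deformations with the same matrix. -/
def monoidEquiv (hr : 1 ≤ r) (hs : 1 ≤ s) : latticePoints D.cone ≃+ latticePoints D'.cone where
  toFun p := ⟨F.latticeEquiv F' p, F.latticeEquiv_mem F' hr hs p⟩
  invFun p := ⟨F'.latticeEquiv F p, F'.latticeEquiv_mem F hr hs p⟩
  left_inv p := Subtype.ext ((F.latticeEquiv F').symm_apply_apply p)
  right_inv p := Subtype.ext ((F.latticeEquiv F').apply_symm_apply p)
  map_add' p q := Subtype.ext (map_add (F.latticeEquiv F') (p : Lattice) q)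

variable (hr : 1 ≤ r) (hs : 1 ≤ s)

lemma monoidEquiv_symm : (F.monoidEquiv F' hr hs).symm = F'.monoidEquiv F hr hs := rfl

lemma monoidEquiv_ξ : F.monoidEquiv F' hr hs F.ξ = F'.ξ := Subtype.ext (F.latticeEquiv_ξ F')

lemma monoidEquiv_η : F.monoidEquiv F' hr hs F.η = F'.η := Subtype.ext (F.latticeEquiv_η F')

lemma monoidEquiv_A : F.monoidEquiv F' hr hs D.A = D'.A := Subtype.ext (F.latticeEquiv_A F')

lemma monoidEquiv_B : F.monoidEquiv F' hr hs D.B = D'.B := Subtype.ext (F.latticeEquiv_B F')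

lemma monoidEquiv_x₀ : F.monoidEquiv F' hr hs F.x₀ = F'.x₀ := Subtype.ext (F.latticeEquiv_x₀ F')

lemma monoidEquiv_y₀ : F.monoidEquiv F' hr hs F.y₀ = F'.y₀ := Subtype.ext (F.latticeEquiv_y₀ F')

lemma monoidEquiv_fst (j : Fin 4) : F.monoidEquiv F' hr hs (F.fst j) = F'.fst j := by
  fin_cases j
  exacts [F.monoidEquiv_x₀ F' hr hs, F.monoidEquiv_x₀ F' hr hs, F.monoidEquiv_ξ F' hr hs,
    F.monoidEquiv_y₀ F' hr hs]

lemma monoidEquiv_snd (j : Fin 4) : F.monoidEquiv F' hr hs (F.snd j) = F'.snd j := by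
  fin_cases j
  exacts [F.monoidEquiv_y₀ F' hr hs, F.monoidEquiv_ξ F' hr hs, F.monoidEquiv_η F' hr hs,
    F.monoidEquiv_η F' hr hs]

/-- A multiple of `p` is a sum of axis monomials of `S_j`, which go to the axis monomials of `S_j`.
The multiple survives on `S_j` with the expected exponent, hence so does the image of `p`. -/
lemma onFace_monoidEquiv {j : Fin 4} {p : latticePoints D.cone} (hp : D.OnFace j p) :
    D'.OnFace j (F.monoidEquiv F' hr hs p) ∧ D'.expo j (F.monoidEquiv F' hr hs p) = D.expo j p := by
  have h0 : axisDeg r s j ≠ 0 := by fin_cases j <;> simp [axisDeg] <;> omega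
  have h := congrArg (F.monoidEquiv F' hr hs) (F.axisDeg_smul hr hs hp)
  rw [map_nsmul, map_add, map_nsmul, map_nsmul, monoidEquiv_fst, monoidEquiv_snd] at h
  have h1 : D'.OnFace j (F.monoidEquiv F' hr hs p) :=
    onFace_of_nsmul h0 (h ▸ F'.onFace_combination j _ _)
  refine ⟨h1, ?_⟩
  have h2 := congrArg (D'.expo j) h
  rw [expo_nsmul h1, F'.expo_combination] at h2
  have e0 := DFunLike.congr_fun h2 0
  have e1 := DFunLike.congr_fun h2 1
  simp only [Finsupp.smul_apply, smul_eq_mul, expVec_zero, expVec_one] at e0 e1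
  exact expVec_ext (mul_left_cancel₀ h0 e0) (mul_left_cancel₀ h0 e1)

lemma onFace_monoidEquiv_iff {j : Fin 4} {p : latticePoints D.cone} :
    D'.OnFace j (F.monoidEquiv F' hr hs p) ↔ D.OnFace j p := by
  refine ⟨fun h => ?_, fun h => (F.onFace_monoidEquiv F' hr hs h).1⟩
  have := (F'.onFace_monoidEquiv F hr hs h).1
  rwa [← monoidEquiv_symm, AddEquiv.symm_apply_apply] at this

/-- A character of a free group takes arbitrary nonzero values on a basis; these are the scalings
available to adjust the embedding of `T`. -/
lemma exists_character (z : Fin 4 → ℂ) (hz : ∀ i, z i ≠ 0) :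
    ∃ χ : Lattice → ℂ, χ 0 = 1 ∧ (∀ m n, χ (m + n) = χ m * χ n) ∧ (∀ m, χ m ≠ 0) ∧
      χ F.ξ = z 0 ∧ χ F.η = z 1 ∧ χ D.A = z 2 ∧ χ D.B = z 3 := by
  let f := F.basis.constr ℤ fun i => Additive.ofMul (Units.mk0 (z i) (hz i))
  have hf : ∀ i, (f (![(F.ξ : Lattice), F.η, D.A, D.B] i)).toMul = Units.mk0 (z i) (hz i) :=
    fun i => by rw [← basis_apply, Module.Basis.constr_basis]; rfl
  refine ⟨fun m => ((f m).toMul : ℂˣ), by simp, fun m n => by simp, fun m => Units.ne_zero _,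
    congrArg Units.val (hf 0), congrArg Units.val (hf 1), congrArg Units.val (hf 2),
    congrArg Units.val (hf 3)⟩

end Frame

end ToricDeformation

end Tent

end

/-! ### Deformations with the same matrix are isomorphic -/

noncomputable section

namespace Tent

/-- The homomorphism of toric rings given by a homomorphism of the monoids of monomials and
a character. -/
def twistedHom {σ σ' : PointedCone ℝ (Fin 4 → ℝ)} (e : latticePoints σ →+ latticePoints σ')
    (χ : latticePoints σ → ℂ) (h0 : χ 0 = 1) (hadd : ∀ m n, χ (m + n) = χ m * χ n) :
    toricRing σ →ₐ[ℂ] toricRing σ' :=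
  AddMonoidAlgebra.lift ℂ (toricRing σ') (latticePoints σ)
    { toFun := fun p => χ p.toAdd • mono (e p.toAdd)
      map_one' := by rw [toAdd_one, h0, map_zero, mono_zero, one_smul]
      map_mul' := fun p q => by rw [toAdd_mul, hadd, map_add, mono_add, smul_mul_smul_comm] }

lemma twistedHom_mono {σ σ' : PointedCone ℝ (Fin 4 → ℝ)} (e : latticePoints σ →+ latticePoints σ')
    (χ : latticePoints σ → ℂ) (h0 : χ 0 = 1) (hadd : ∀ m n, χ (m + n) = χ m * χ n)
    (p : latticePoints σ) : twistedHom e χ h0 hadd (mono p) = χ p • mono (e p) := by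
  rw [twistedHom, mono, AddMonoidAlgebra.lift_single, one_smul]
  rfl

/-- The isomorphism of toric rings given by an isomorphism of the monoids of monomials and
a character. -/
def twistedEquiv {σ σ' : PointedCone ℝ (Fin 4 → ℝ)} (e : latticePoints σ ≃+ latticePoints σ')
    (χ : Lattice → ℂ) (h0 : χ 0 = 1) (hadd : ∀ m n, χ (m + n) = χ m * χ n) (hne : ∀ m, χ m ≠ 0) :
    toricRing σ ≃ₐ[ℂ] toricRing σ' :=
  AlgEquiv.ofAlgHom (twistedHom e (fun p => χ p) h0 fun m n => hadd m n)
    (twistedHom e.symm (fun p => (χ (e.symm p))⁻¹)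
      (by rw [map_zero, AddSubmonoid.coe_zero, h0, inv_one])
      fun m n => by rw [map_add, AddSubmonoid.coe_add, hadd, mul_inv])
    (algHom_ext_mono fun p => by
      rw [AlgHom.comp_apply, twistedHom_mono, map_smul, twistedHom_mono, smul_smul]
      simp [hne])
    (algHom_ext_mono fun p => by
      rw [AlgHom.comp_apply, twistedHom_mono, map_smul, twistedHom_mono, smul_smul]
      simp [hne])

lemma twistedEquiv_mono {σ σ' : PointedCone ℝ (Fin 4 → ℝ)} (e : latticePoints σ ≃+ latticePoints σ')
    (χ : Lattice → ℂ) (h0 : χ 0 = 1) (hadd : ∀ m n, χ (m + n) = χ m * χ n) (hne : ∀ m, χ m ≠ 0)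
    (p : latticePoints σ) : twistedEquiv e χ h0 hadd hne (mono p) = χ p • mono (e p) := by
  change twistedHom (e : latticePoints σ →+ latticePoints σ') (fun p => χ p) h0
    (fun m n => hadd m n) (mono p) = _
  rw [twistedHom_mono]
  rfl

namespace ToricDeformation

variable {r α s β : ℕ} {D D' : ToricDeformation r α s β} {a b : ℤ}

lemma Axes.coef_x₀ (c : D.Axes) : D.coef 1 c.x₀ = D.coef 0 c.x₀ :=
  c.hx₀.coef_eq (coordX0_one r) (coordX0_zero r)

lemma Axes.coef_y₀ (c : D.Axes) : D.coef 3 c.y₀ = D.coef 0 c.y₀ :=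
  c.hy₀.coef_eq (coordY0_three s) (coordY0_zero s)

lemma Axes.coef_ξ (c : D.Axes) : D.coef 1 c.ξ = D.coef 2 c.ξ :=
  c.hξ.coef_eq (coordXi_one r) (coordXi_two r)

lemma Axes.coef_η (c : D.Axes) : D.coef 3 c.η = D.coef 2 c.η :=
  c.hη.coef_eq (coordEta_three s) (coordEta_two s)

namespace Frame

/-- Up to multiples of the `ξ`-axis, the monomials on `S₁` are powers of `w₁`. -/
lemma add_eq_of_onFace_one (hr : 1 ≤ r) (hs : 1 ≤ s) (hα : α ≤ r) (F : D.Frame a b)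
    {p : latticePoints D.cone} (hp : D.OnFace 1 p) :
    ∃ N i t : ℕ, p + N • F.ξ = i • F.w₁ + t • F.ξ := by
  obtain ⟨t, ht⟩ := (invariant_expo hr hs hp).1 rfl
  have hξ : D.OnFace 1 F.ξ := (F.snd_spec 1).1
  have hξe : D.expo 1 F.ξ = expVec 0 r := (F.snd_spec 1).2
  -- For the exponent `(i, k)` of `p` with `αi + k = rt` one has `(i, k + 2ir) = i (1, 2r - α) + t
  -- (0, r)`.
  refine ⟨2 * D.expo 1 p 0, D.expo 1 p 0, t, expo_injective hr hs
    (onFace_add.2 ⟨hp, onFace_nsmul hξ _⟩)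
    (onFace_add.2 ⟨onFace_nsmul F.onFace_w₁ _, onFace_nsmul hξ _⟩) ?_⟩
  rw [expo_add hp (onFace_nsmul hξ _), expo_add (onFace_nsmul F.onFace_w₁ _) (onFace_nsmul hξ _),
    expo_nsmul hξ, expo_nsmul hξ, expo_nsmul F.onFace_w₁, hξe, F.expo_w₁]
  apply expVec_ext
  · simp
  · obtain ⟨k, rfl⟩ := Nat.exists_eq_add_of_le hα
    simp only [Finsupp.add_apply, Finsupp.smul_apply, expVec_one, smul_eq_mul]
    have : 2 * (α + k) - α = α + 2 * k := by omega
    rw [this]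
    zify at ht ⊢
    linear_combination ht

lemma add_eq_of_onFace_three (hr : 1 ≤ r) (hs : 1 ≤ s) (hβ : β ≤ s) (F : D.Frame a b)
    {p : latticePoints D.cone} (hp : D.OnFace 3 p) :
    ∃ N i t : ℕ, p + N • F.η = i • F.w₃ + t • F.η := by
  obtain ⟨t, ht⟩ := (invariant_expo hr hs hp).2 rfl
  have hη : D.OnFace 3 F.η := (F.snd_spec 3).1
  have hηe : D.expo 3 F.η = expVec 0 s := (F.snd_spec 3).2
  refine ⟨2 * D.expo 3 p 0, D.expo 3 p 0, t, expo_injective hr hs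
    (onFace_add.2 ⟨hp, onFace_nsmul hη _⟩)
    (onFace_add.2 ⟨onFace_nsmul F.onFace_w₃ _, onFace_nsmul hη _⟩) ?_⟩
  rw [expo_add hp (onFace_nsmul hη _), expo_add (onFace_nsmul F.onFace_w₃ _) (onFace_nsmul hη _),
    expo_nsmul hη, expo_nsmul hη, expo_nsmul F.onFace_w₃, hηe, F.expo_w₃]
  apply expVec_ext
  · simp
  · obtain ⟨k, rfl⟩ := Nat.exists_eq_add_of_le hβ
    simp only [Finsupp.add_apply, Finsupp.smul_apply, expVec_one, smul_eq_mul]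
    have : 2 * (β + k) - β = β + 2 * k := by omega
    rw [this]
    zify at ht ⊢
    linear_combination ht

section Character

variable (F : D.Frame a b) (F' : D'.Frame a b) (hr : 1 ≤ r) (hs : 1 ≤ s) (χ : Lattice → ℂ)

/-- The twist by the character `χ` is compatible with the restriction to `S_j` of a monomial. -/
def Compatible (j : Fin 4) (p : latticePoints D.cone) : Prop :=
  χ p * D'.coef j (F.monoidEquiv F' hr hs p) = D.coef j p

variable {F F' hr hs χ}

lemma Compatible.add (hadd : ∀ m n, χ (m + n) = χ m * χ n) {j : Fin 4}
    {p q : latticePoints D.cone} (hp : D.OnFace j p) (hq : D.OnFace j q)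
    (h : F.Compatible F' hr hs χ j p) (h' : F.Compatible F' hr hs χ j q) :
    F.Compatible F' hr hs χ j (p + q) := by
  rw [Compatible] at *
  rw [map_add, coef_add (F.onFace_monoidEquiv F' hr hs hp).1 (F.onFace_monoidEquiv F' hr hs hq).1,
    coef_add hp hq, AddSubmonoid.coe_add, hadd, ← h, ← h']
  ring

lemma Compatible.nsmul (h0 : χ 0 = 1) (hadd : ∀ m n, χ (m + n) = χ m * χ n) {j : Fin 4}
    {p : latticePoints D.cone} (hp : D.OnFace j p) (h : F.Compatible F' hr hs χ j p) (n : ℕ) :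
    F.Compatible F' hr hs χ j (n • p) := by
  induction n with
  | zero => simp [Compatible, h0, coef_zero]
  | succ n ih => rw [succ_nsmul]; exact Compatible.add hadd (onFace_nsmul hp n) hp ih h

lemma Compatible.of_add (hadd : ∀ m n, χ (m + n) = χ m * χ n) {j : Fin 4}
    {p q : latticePoints D.cone} (hp : D.OnFace j p) (hq : D.OnFace j q)
    (h : F.Compatible F' hr hs χ j (p + q)) (h' : F.Compatible F' hr hs χ j q) :
    F.Compatible F' hr hs χ j p := by
  rw [Compatible] at *
  rw [map_add, coef_add (F.onFace_monoidEquiv F' hr hs hp).1 (F.onFace_monoidEquiv F' hr hs hq).1,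
    coef_add hp hq, AddSubmonoid.coe_add, hadd, ← h'] at h
  have hne : χ q * D'.coef j (F.monoidEquiv F' hr hs q) ≠ 0 := h' ▸ onFace_iff.1 hq
  refine mul_right_cancel₀ hne (Eq.trans ?_ h)
  ring

end Character

/-- The identification of monomials preserves faces and exponents but may change coefficients.
Prescribing the character on `ξ, η, w₁, w₃` corrects them on `S₁`, `S₂` and `S₃`. On `S₀` nothing
remains to be chosen, since `x₀` and `y₀` are already correct on `S₁` and `S₃`. -/
lemma iso (hr : 1 ≤ r) (hs : 1 ≤ s) (hα : α ≤ r) (hβ : β ≤ s) (F : D.Frame a b)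
    (F' : D'.Frame a b) : D.Iso D' := by
  set e := F.monoidEquiv F' hr hs with he
  have hF : ∀ {j p}, D.OnFace j p → D'.coef j (e p) ≠ 0 := fun hp =>
    onFace_iff.1 (F.onFace_monoidEquiv F' hr hs hp).1
  have hξ2 : D.OnFace 2 F.ξ := (F.fst_spec 2).1
  have hη2 : D.OnFace 2 F.η := (F.snd_spec 2).1
  let zξ := D.coef 2 F.ξ / D'.coef 2 (e F.ξ)
  let zη := D.coef 2 F.η / D'.coef 2 (e F.η)
  let z₁ := D.coef 1 F.w₁ / D'.coef 1 (e F.w₁)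
  let z₃ := D.coef 3 F.w₃ / D'.coef 3 (e F.w₃)
  have hzξ : zξ ≠ 0 := div_ne_zero (onFace_iff.1 hξ2) (hF hξ2)
  have hzη : zη ≠ 0 := div_ne_zero (onFace_iff.1 hη2) (hF hη2)
  have hz₁ : z₁ ≠ 0 := div_ne_zero (onFace_iff.1 F.onFace_w₁) (hF F.onFace_w₁)
  have hz₃ : z₃ ≠ 0 := div_ne_zero (onFace_iff.1 F.onFace_w₃) (hF F.onFace_w₃)
  -- The values at `A` and `B` are forced by `A ξ^n₁ = w₁ η` and `B η^n₃ = w₃ ξ`. The numbers `n₁,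
  -- n₃` of `F` are also valid for `F'`, because the monoid isomorphism preserves products.
  obtain ⟨χ, h0, hadd, hne, hχξ, hχη, hχA, hχB⟩ := F.exists_character
    ![zξ, zη, z₁ * zη / zξ ^ F.n₁, z₃ * zξ / zη ^ F.n₃] (by
      intro i
      fin_cases i
      · exact hzξ
      · exact hzη
      · exact div_ne_zero (mul_ne_zero hz₁ hzη) (pow_ne_zero _ hzξ)
      · exact div_ne_zero (mul_ne_zero hz₃ hzξ) (pow_ne_zero _ hzη))
  replace hχξ : χ F.ξ = zξ := hχξ
  replace hχη : χ F.η = zη := hχη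
  replace hχA : χ D.A = z₁ * zη / zξ ^ F.n₁ := hχA
  replace hχB : χ D.B = z₃ * zξ / zη ^ F.n₃ := hχB
  have hpow : ∀ (n : ℕ) m, χ (n • m) = χ m ^ n := fun n m => by
    induction n with
    | zero => rw [zero_smul, h0, pow_zero]
    | succ n ih => rw [succ_nsmul, hadd, ih, pow_succ]
  have hχ₁ : χ F.w₁ = z₁ := by
    have h : (D.A : Lattice) + F.n₁ • (F.ξ : Lattice) = F.w₁ + F.η := congrArg Subtype.val F.add_n₁
    have := congrArg χ h
    rw [hadd, hadd, hpow, hχξ, hχη, hχA, div_mul_cancel₀ _ (pow_ne_zero _ hzξ)] at this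
    exact (mul_right_cancel₀ hzη this).symm
  have hχ₃ : χ F.w₃ = z₃ := by
    have h : (D.B : Lattice) + F.n₃ • (F.η : Lattice) = F.w₃ + F.ξ := congrArg Subtype.val F.add_n₃
    have := congrArg χ h
    rw [hadd, hadd, hpow, hχξ, hχη, hχB, div_mul_cancel₀ _ (pow_ne_zero _ hzη)] at this
    exact (mul_right_cancel₀ hzξ this).symm
  have c2ξ : F.Compatible F' hr hs χ 2 F.ξ := by
    rw [Compatible, hχξ]; exact div_mul_cancel₀ _ (hF hξ2)
  have c2η : F.Compatible F' hr hs χ 2 F.η := by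
    rw [Compatible, hχη]; exact div_mul_cancel₀ _ (hF hη2)
  have c1ξ : F.Compatible F' hr hs χ 1 F.ξ := by
    rw [Compatible, monoidEquiv_ξ, F'.coef_ξ, F.coef_ξ] at *
    exact c2ξ
  have c3η : F.Compatible F' hr hs χ 3 F.η := by
    rw [Compatible, monoidEquiv_η, F'.coef_η, F.coef_η] at *
    exact c2η
  have c1w : F.Compatible F' hr hs χ 1 F.w₁ := by
    rw [Compatible, hχ₁]; exact div_mul_cancel₀ _ (hF F.onFace_w₁)
  have c3w : F.Compatible F' hr hs χ 3 F.w₃ := by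
    rw [Compatible, hχ₃]; exact div_mul_cancel₀ _ (hF F.onFace_w₃)
  have hξ1 : D.OnFace 1 F.ξ := (F.snd_spec 1).1
  have hη3 : D.OnFace 3 F.η := (F.snd_spec 3).1
  have hx0 : D.OnFace 0 F.x₀ := (F.fst_spec 0).1
  have hy0 : D.OnFace 0 F.y₀ := (F.snd_spec 0).1
  have c1 : ∀ p, D.OnFace 1 p → F.Compatible F' hr hs χ 1 p := fun p hp => by
    obtain ⟨N, i, t, h⟩ := F.add_eq_of_onFace_one hr hs hα hp
    refine Compatible.of_add hadd hp (onFace_nsmul hξ1 N) ?_ (c1ξ.nsmul h0 hadd hξ1 N)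
    rw [h]
    exact Compatible.add hadd (onFace_nsmul F.onFace_w₁ i) (onFace_nsmul hξ1 t)
      (c1w.nsmul h0 hadd F.onFace_w₁ i) (c1ξ.nsmul h0 hadd hξ1 t)
  have c3 : ∀ p, D.OnFace 3 p → F.Compatible F' hr hs χ 3 p := fun p hp => by
    obtain ⟨N, i, t, h⟩ := F.add_eq_of_onFace_three hr hs hβ hp
    refine Compatible.of_add hadd hp (onFace_nsmul hη3 N) ?_ (c3η.nsmul h0 hadd hη3 N)
    rw [h]
    exact Compatible.add hadd (onFace_nsmul F.onFace_w₃ i) (onFace_nsmul hη3 t)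
      (c3w.nsmul h0 hadd F.onFace_w₃ i) (c3η.nsmul h0 hadd hη3 t)
  have c0x : F.Compatible F' hr hs χ 0 F.x₀ := by
    have := c1 F.x₀ (F.fst_spec 1).1
    rw [Compatible, monoidEquiv_x₀, F'.coef_x₀, F.coef_x₀] at *
    exact this
  have c0y : F.Compatible F' hr hs χ 0 F.y₀ := by
    have := c3 F.y₀ (F.fst_spec 3).1
    rw [Compatible, monoidEquiv_y₀, F'.coef_y₀, F.coef_y₀] at *
    exact this
  have c0 : ∀ p, D.OnFace 0 p → F.Compatible F' hr hs χ 0 p := fun p hp => by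
    rw [F.eq_combination hr hs rfl hp]
    exact Compatible.add hadd (onFace_nsmul hx0 _) (onFace_nsmul hy0 _)
      (c0x.nsmul h0 hadd hx0 _) (c0y.nsmul h0 hadd hy0 _)
  have c2 : ∀ p, D.OnFace 2 p → F.Compatible F' hr hs χ 2 p := fun p hp => by
    rw [F.eq_combination hr hs rfl hp]
    exact Compatible.add hadd (onFace_nsmul hξ2 _) (onFace_nsmul hη2 _)
      (c2ξ.nsmul h0 hadd hξ2 _) (c2η.nsmul h0 hadd hη2 _)
  have call : ∀ j p, D.OnFace j p → F.Compatible F' hr hs χ j p := fun j => by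
    fin_cases j
    exacts [c0, c1, c2, c3]
  refine ⟨twistedEquiv e χ h0 hadd hne, fun p => ⟨e p, χ p, twistedEquiv_mono _ _ _ _ _ p⟩,
    ⟨χ D.A, hne _, ?_⟩, ⟨χ D.B, hne _, ?_⟩, fun f => ?_⟩
  · rw [twistedEquiv_mono, he, monoidEquiv_A]
  · rw [twistedEquiv_mono, he, monoidEquiv_B]
  · have : D'.restrict.comp (twistedEquiv e χ h0 hadd hne).toAlgHom = D.restrict := by
      refine algHom_ext_mono fun p => Subtype.ext (funext fun j => ?_)
      rw [AlgHom.comp_apply]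
      change (D'.restrict (twistedEquiv e χ h0 hadd hne (mono p))).1 j = D.comp p j
      rw [twistedEquiv_mono, map_smul]
      change χ p • D'.comp (e p) j = D.comp p j
      by_cases hp : D.OnFace j p
      · rw [comp_eq, comp_eq, (F.onFace_monoidEquiv F' hr hs hp).2, MvPolynomial.smul_monomial]
        exact congrArg _ (call j p hp)
      · have h1 : ¬ D'.OnFace j (e p) := by rwa [he, onFace_monoidEquiv_iff]
        rw [OnFace, not_not] at hp h1
        rw [hp, h1, smul_zero]
    exact DFunLike.congr_fun this f

end Frame

end ToricDeformation

end Tent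

end

/-! ### Arithmetic of the matrices -/

noncomputable section

namespace Tent

/-- The off-diagonal entries of the matrices. -/
def entryPairs (r α s β : ℕ) : Set (ℤ × ℤ) :=
  {p | (r : ℤ) * s - p.1 * p.2 = 1 ∧ 0 ≤ p.1 ∧ 0 ≤ p.2 ∧ p.1 ≡ α [ZMOD r] ∧ p.2 ≡ β [ZMOD s]}

lemma exists_mem_matrices_iff {r α s β : ℕ} {a b : ℤ} :
    (∃ g ∈ matrices r α s β, g 0 1 = a ∧ g 1 0 = b) ↔ (a, b) ∈ entryPairs r α s β := by
  constructor
  · rintro ⟨g, ⟨h00, h11, h01, h10, hα, hβ⟩, rfl, rfl⟩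
    have := g.det_coe
    rw [Matrix.det_fin_two] at this
    refine ⟨?_, h01, h10, hα, hβ⟩
    rw [← h00, ← h11]
    exact this
  · rintro ⟨hdet, ha, hb, hα, hβ⟩
    exact ⟨⟨!![(r : ℤ), a; b, s], by rw [Matrix.det_fin_two_of]; exact hdet⟩,
      ⟨rfl, rfl, ha, hb, hα, hβ⟩, rfl, rfl⟩

lemma encard_matrices (r α s β : ℕ) : (matrices r α s β).encard = (entryPairs r α s β).encard := by
  have himg : (fun g : Matrix.SpecialLinearGroup (Fin 2) ℤ => (g 0 1, g 1 0)) '' matrices r α s β =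
      entryPairs r α s β := by
    ext ⟨a, b⟩
    rw [← exists_mem_matrices_iff]
    simp [Prod.ext_iff]
  rw [← himg, Set.InjOn.encard_image]
  rintro g ⟨h00, h11, -⟩ g' ⟨h00', h11', -⟩ h
  obtain ⟨h1, h2⟩ := Prod.ext_iff.1 h
  ext i j
  fin_cases i <;> fin_cases j
  exacts [h00.trans h00'.symm, h1, h2, h11.trans h11'.symm]

/-- For `r ≥ 2` coprimality excludes `α = r`, so `α` is the reduced residue. -/
lemma eq_of_modEq_of_lt {r α : ℕ} {a : ℤ} (hr : 2 ≤ r) (hα : α ≤ r) (hc : Nat.Coprime α r)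
    (ha : 0 ≤ a) (har : a < r) (h : a ≡ α [ZMOD r]) : a = α := by
  have hαr : α ≠ r := by
    rintro rfl
    rw [Nat.coprime_self] at hc
    omega
  have h1 : a % r = α % r := h
  rwa [Int.emod_eq_of_lt ha har, Int.emod_eq_of_lt (by positivity) (by omega)] at h1

lemma mem_entryPairs_iff {r α s β : ℕ} (hr : 1 ≤ r) (hs : 1 ≤ s) (hα : α ≤ r) (hβ : β ≤ s)
    (hcα : Nat.Coprime α r) (hcβ : Nat.Coprime β s) (hrs : ¬ (r = 1 ∧ s = 1)) {a b : ℤ} :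
    (a, b) ∈ entryPairs r α s β ↔
      (a = α ∧ (α : ℤ) ∣ r * s - 1 ∧ b = (r * s - 1) / α ∧ b ≡ β [ZMOD s]) ∨
      (b = β ∧ (β : ℤ) ∣ r * s - 1 ∧ a = (r * s - 1) / β ∧ a ≡ α [ZMOD r]) := by
  have hpos : (0 : ℤ) < r * s - 1 := by
    have : 2 ≤ r * s := by
      by_contra h
      have h1 : r * s = 1 := by
        have := Nat.mul_pos hr hs
        omega
      exact hrs (mul_eq_one.1 h1)
    zify at this
    omega
  constructor
  · rintro ⟨hdet, ha, hb, ha', hb'⟩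
    have hab : a * b = r * s - 1 := by linarith
    have ha0 : 0 < a := lt_of_le_of_ne ha (by rintro rfl; omega)
    have hb0 : 0 < b := lt_of_le_of_ne hb (by rintro rfl; omega)
    -- If both `a ≥ r` and `b ≥ s`, then `ab ≥ rs`, contrary to `ab = rs - 1`. The strict bound on a
    -- positive entry also gives `r ≥ 2`, respectively `s ≥ 2`.
    by_cases har : a < r
    · left
      have := eq_of_modEq_of_lt (by omega) hα hcα ha har ha'
      subst this
      exact ⟨rfl, ⟨b, hab.symm⟩, by rw [← hab, Int.mul_ediv_cancel_left _ ha0.ne'], hb'⟩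
    · right
      have hbs : b < s := by
        by_contra hbs
        push Not at har hbs
        have := mul_le_mul har hbs (by positivity) ha
        omega
      have := eq_of_modEq_of_lt (by omega) hβ hcβ hb hbs hb'
      subst this
      exact ⟨rfl, ⟨a, by rw [← hab, mul_comm]⟩, by rw [← hab, Int.mul_ediv_cancel _ hb0.ne'], ha'⟩
  · rintro (⟨rfl, hdvd, rfl, hb⟩ | ⟨rfl, hdvd, rfl, ha⟩)
    · exact ⟨by rw [Int.mul_ediv_cancel' hdvd]; ring, by positivity,
        Int.ediv_nonneg hpos.le (by positivity), rfl, hb⟩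
    · exact ⟨by rw [Int.ediv_mul_cancel hdvd]; ring, Int.ediv_nonneg hpos.le (by positivity),
        by positivity, ha, rfl⟩

lemma encard_matrices_le_two {r α s β : ℕ} (hr : 1 ≤ r) (hs : 1 ≤ s) (hα : α ≤ r) (hβ : β ≤ s)
    (hcα : Nat.Coprime α r) (hcβ : Nat.Coprime β s) (hrs : ¬ (r = 1 ∧ s = 1)) :
    (matrices r α s β).encard ≤ 2 := by
  rw [encard_matrices]
  have hpair : ({((α : ℤ), ((r : ℤ) * s - 1) / α), (((r : ℤ) * s - 1) / β, (β : ℤ))} :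
      Set (ℤ × ℤ)).encard ≤ 2 :=
    (Set.encard_insert_le _ _).trans (by rw [Set.encard_singleton]; norm_num)
  refine (Set.encard_le_encard ?_).trans hpair
  rintro ⟨a, b⟩ h
  rw [mem_entryPairs_iff hr hs hα hβ hcα hcβ hrs] at h
  rcases h with ⟨rfl, -, rfl, -⟩ | ⟨rfl, -, rfl, -⟩ <;> simp

lemma exists_encard_matrices_eq (n : ℕ) (hn : n ≤ 2) :
    ∃ r α s β : ℕ, 1 ≤ r ∧ 1 ≤ s ∧ α ≤ r ∧ β ≤ s ∧ Nat.Coprime α r ∧ Nat.Coprime β s ∧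
      ¬ (r = 1 ∧ s = 1) ∧ (matrices r α s β).encard = n := by
  interval_cases n
  -- Here `rs - 1 = 24`: the candidates `(2, 12)` and `(8, 3)` both violate the congruence for the
  -- large entry.
  · refine ⟨5, 2, 5, 3, by norm_num, by norm_num, by norm_num, by norm_num, by norm_num,
      by norm_num, by norm_num, ?_⟩
    rw [encard_matrices, Nat.cast_zero, Set.encard_eq_zero, Set.eq_empty_iff_forall_notMem]
    rintro ⟨a, b⟩ h
    rw [mem_entryPairs_iff (by norm_num) (by norm_num) (by norm_num) (by norm_num) (by norm_num)
      (by norm_num) (by norm_num)] at h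
    rcases h with ⟨-, -, rfl, h⟩ | ⟨-, -, rfl, h⟩ <;> revert h <;> decide
  -- Here `rs - 1 = 1`, and `α = 0` does not divide it; only the second alternative remains.
  · refine ⟨1, 0, 2, 1, by norm_num, by norm_num, by norm_num, by norm_num, by norm_num,
      by norm_num, by norm_num, ?_⟩
    have : entryPairs 1 0 2 1 = {((1 : ℤ), (1 : ℤ))} := by
      ext ⟨a, b⟩
      rw [mem_entryPairs_iff (by norm_num) (by norm_num) (by norm_num) (by norm_num) (by norm_num)
        (by norm_num) (by norm_num), Set.mem_singleton_iff, Prod.mk.injEq]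
      constructor
      · rintro (⟨-, h, -⟩ | ⟨rfl, -, rfl, -⟩)
        · norm_num at h
        · norm_num
      · rintro ⟨rfl, rfl⟩
        right
        refine ⟨rfl, ?_, ?_, ?_⟩ <;> decide
    rw [encard_matrices, this, Set.encard_singleton, Nat.cast_one]
  · refine ⟨2, 1, 2, 1, by norm_num, by norm_num, by norm_num, by norm_num, by norm_num,
      by norm_num, by norm_num, ?_⟩
    have : entryPairs 2 1 2 1 = {((1 : ℤ), (3 : ℤ)), ((3 : ℤ), (1 : ℤ))} := by
      ext ⟨a, b⟩
      rw [mem_entryPairs_iff (by norm_num) (by norm_num) (by norm_num) (by norm_num) (by norm_num)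
        (by norm_num) (by norm_num), Set.mem_insert_iff, Set.mem_singleton_iff, Prod.mk.injEq,
        Prod.mk.injEq]
      constructor
      · rintro (⟨rfl, -, rfl, -⟩ | ⟨rfl, -, rfl, -⟩)
        · left; norm_num
        · right; norm_num
      · rintro (⟨rfl, rfl⟩ | ⟨rfl, rfl⟩)
        · left; refine ⟨rfl, ?_, ?_, ?_⟩ <;> decide
        · right; refine ⟨rfl, ?_, ?_, ?_⟩ <;> decide
    rw [encard_matrices, this, Set.encard_pair (by simp)]
    rfl

end Tent

end

/-! ### The cone of a matrix, its inequalities and its four faces -/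

noncomputable section

namespace Tent

section Model

variable {r s : ℕ} {a b : ℤ}

/-- The monomial cone of the toric variety `V_{AB}` belonging to the matrix `(r a; b s)`, in
coordinates with respect to the basis `ξ, η, A, B` of `𝕄`. -/
def modelCone (r s : ℕ) (a b : ℤ) : PointedCone ℝ (Fin 4 → ℝ) :=
  PointedCone.hull ℝ (toReal '' {(![1, 0, 0, 0] : Lattice), ![0, 1, 0, 0], ![0, 0, 1, 0],
    ![0, 0, 0, 1], (![a, -r, r, 0] : Lattice), (![-s, b, 0, s] : Lattice)})

/-- The inequalities of the facets of the cone `modelCone r s a b`. -/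
structure FacetIneq (r s : ℕ) (a b : ℤ) (p : Lattice) : Prop where
  A₁ : 0 ≤ p 2
  A₂ : 0 ≤ p 1 + p 2
  A₃ : 0 ≤ r * b * p 0 + r * s * p 1 + p 2
  B₁ : 0 ≤ p 3
  B₂ : 0 ≤ p 0 + p 3
  B₃ : 0 ≤ r * s * p 0 + a * s * p 1 + p 3

/-- The functional that is nonnegative on `modelCone r s a b` and vanishes precisely on the face
of the monomials not restricting to zero on the component `S_j`. -/
def faceFun (r s : ℕ) (a b : ℤ) (j : Fin 4) (p : Lattice) : ℤ :=
  ![(r * b * p 0 + r * s * p 1 + p 2) + (r * s * p 0 + a * s * p 1 + p 3),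
    (p 1 + p 2) + p 3, p 2 + p 3, p 2 + (p 0 + p 3)] j

/-- The exponents of the restriction to `S_j` of the monomials on the corresponding face. -/
def faceExp (r s : ℕ) (a b : ℤ) (j : Fin 4) (i : Fin 2) (p : Lattice) : ℤ :=
  ![![-(b * p 0 + s * p 1), -(r * p 0 + a * p 1)], ![p 2, r * p 0 - a * p 2], ![p 0, p 1],
    ![p 3, s * p 1 - b * p 3]] j i

lemma faceFun_add (j : Fin 4) (p q : Lattice) :
    faceFun r s a b j (p + q) = faceFun r s a b j p + faceFun r s a b j q := by
  fin_cases j <;> simp [faceFun] <;> ring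

lemma faceExp_add (j : Fin 4) (i : Fin 2) (p q : Lattice) :
    faceExp r s a b j i (p + q) = faceExp r s a b j i p + faceExp r s a b j i q := by
  fin_cases j <;> fin_cases i <;> simp [faceExp] <;> ring

lemma faceFun_zero (j : Fin 4) : faceFun r s a b j 0 = 0 := by
  fin_cases j <;> simp [faceFun]

lemma faceExp_zero (j : Fin 4) (i : Fin 2) : faceExp r s a b j i 0 = 0 := by
  fin_cases j <;> fin_cases i <;> simp [faceExp]

lemma FacetIneq.faceFun_nonneg {p : Lattice} (h : FacetIneq r s a b p) (j : Fin 4) :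
    0 ≤ faceFun r s a b j p := by
  obtain ⟨h1, h2, h3, h4, h5, h6⟩ := h
  fin_cases j <;> simp [faceFun] <;> linarith

lemma dotProduct_nonneg_of_mem_hull {G : Set Lattice} {c : Lattice}
    (hc : ∀ g ∈ G, 0 ≤ c ⬝ᵥ g) {p : Lattice}
    (hp : p ∈ latticePoints (PointedCone.hull ℝ (toReal '' G))) : 0 ≤ c ⬝ᵥ p := by
  have hcast : ∀ q : Lattice, toReal c ⬝ᵥ toReal q = ((c ⬝ᵥ q : ℤ) : ℝ) := fun q => by
    simp [dotProduct, toReal]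
  have key : ∀ v ∈ PointedCone.hull ℝ (toReal '' G), 0 ≤ toReal c ⬝ᵥ v := by
    intro v hv
    induction hv using Submodule.span_induction with
    | mem v hv =>
      obtain ⟨g, hg, rfl⟩ := hv
      rw [hcast]
      exact_mod_cast hc g hg
    | zero => simp
    | add v w _ _ hv hw => rw [dotProduct_add]; exact add_nonneg hv hw
    | smul t v _ hv =>
      change 0 ≤ toReal c ⬝ᵥ ((t : ℝ) • v)
      rw [dotProduct_smul]
      exact mul_nonneg t.2 hv
  have := key _ hp
  rw [hcast] at this
  exact_mod_cast this

/-- Each linear form need only be tested on the six generators; for the third form of either kind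
the determinant condition makes it vanish on `x₀` and `y₀`. -/
lemma facetIneq_of_mem (hdet : r * s - a * b = 1) (ha : 0 ≤ a) (hb : 0 ≤ b) {p : Lattice}
    (hp : p ∈ latticePoints (modelCone r s a b)) : FacetIneq r s a b p := by
  have hrs : (0 : ℤ) ≤ r * s := by positivity
  have key : ∀ c : Lattice, 0 ≤ c 0 → 0 ≤ c 1 → 0 ≤ c 2 → 0 ≤ c 3 →
      0 ≤ c 0 * a - c 1 * r + c 2 * r → 0 ≤ -(c 0 * s) + c 1 * b + c 3 * s →
      0 ≤ c 0 * p 0 + c 1 * p 1 + c 2 * p 2 + c 3 * p 3 := by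
    intro c h0 h1 h2 h3 h4 h5
    have := dotProduct_nonneg_of_mem_hull (c := c) ?_ hp
    · simpa [dotProduct, Fin.sum_univ_four] using this
    · rintro g (rfl | rfl | rfl | rfl | rfl | rfl) <;>
        simp [dotProduct, Fin.sum_univ_four] <;> linarith
  have hr' : (0 : ℤ) ≤ r := by positivity
  have hs' : (0 : ℤ) ≤ s := by positivity
  have k1 := key ![0, 0, 1, 0] (by simp) (by simp) (by simp) (by simp) (by simp) (by simp)
  have k2 := key ![0, 1, 1, 0] (by simp) (by simp) (by simp) (by simp) (by simp)
    (by simpa using hb)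
  have k3 := key ![r * b, r * s, 1, 0] (by simp; positivity) (by simpa using hrs) (by simp)
    (by simp) (by simp; linear_combination (r : ℤ) * hdet) (by simp; apply le_of_eq; ring)
  have k4 := key ![0, 0, 0, 1] (by simp) (by simp) (by simp) (by simp) (by simp) (by simp)
  have k5 := key ![1, 0, 0, 1] (by simp) (by simp) (by simp) (by simp) (by simpa using ha)
    (by simp)
  have k6 := key ![r * s, a * s, 0, 1] (by simpa using hrs) (by simp; positivity) (by simp)
    (by simp) (by simp; apply le_of_eq; ring) (by simp; linear_combination (s : ℤ) * hdet)
  simp at k1 k2 k3 k4 k5 k6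
  exact ⟨k1, k2, k3, k4, k5, k6⟩

/-- Subtracting `A` lowers the three `A`-forms by one and leaves the `B`-forms alone, and vice
versa. If neither subtraction is possible, some `A`-form and some `B`-form vanish. Four of the nine
combinations define the faces; the other five are reduced to these. -/
lemma FacetIneq.face_or_sub (hdet : r * s - a * b = 1) (ha : 0 ≤ a) (hb : 0 ≤ b) {p : Lattice}
    (h : FacetIneq r s a b p) :
    (∃ j, faceFun r s a b j p = 0) ∨ FacetIneq r s a b (p - ![0, 0, 1, 0]) ∨
      FacetIneq r s a b (p - ![0, 0, 0, 1]) := by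
  obtain ⟨h1, h2, h3, h4, h5, h6⟩ := h
  have hr' : (0 : ℤ) ≤ r := by positivity
  have hs' : (0 : ℤ) ≤ s := by positivity
  -- With `ℓ = r p₀ + a p₁` and `ℓ' = b p₀ + s p₁`, the form `A₃` is both `bℓ + A₂` and `rℓ' + A₁`,
  -- and `B₃` is both `aℓ' + B₂` and `sℓ + B₁`. The mixed cases follow from the signs of `ℓ` and
  -- `ℓ'`.
  have e3 : r * b * p 0 + r * s * p 1 + p 2 = b * (r * p 0 + a * p 1) + (p 1 + p 2) := by
    linear_combination p 1 * hdet
  have e3' : r * b * p 0 + r * s * p 1 + p 2 = r * (b * p 0 + s * p 1) + p 2 := by ring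
  have e6 : r * s * p 0 + a * s * p 1 + p 3 = a * (b * p 0 + s * p 1) + (p 0 + p 3) := by
    linear_combination p 0 * hdet
  have e6' : r * s * p 0 + a * s * p 1 + p 3 = s * (r * p 0 + a * p 1) + p 3 := by ring
  by_cases hA : 1 ≤ p 2 ∧ 1 ≤ p 1 + p 2 ∧ 1 ≤ r * b * p 0 + r * s * p 1 + p 2
  · obtain ⟨k1, k2, k3⟩ := hA
    exact Or.inr (Or.inl ⟨by simp; linarith, by simp; linarith, by simp; linarith,
      by simpa using h4, by simpa using h5, by simpa using h6⟩)
  by_cases hB : 1 ≤ p 3 ∧ 1 ≤ p 0 + p 3 ∧ 1 ≤ r * s * p 0 + a * s * p 1 + p 3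
  · obtain ⟨k1, k2, k3⟩ := hB
    exact Or.inr (Or.inr ⟨by simpa using h1, by simpa using h2, by simpa using h3,
      by simp; linarith, by simp; linarith, by simp; linarith⟩)
  left
  have hA' : p 2 = 0 ∨ p 1 + p 2 = 0 ∨ r * b * p 0 + r * s * p 1 + p 2 = 0 := by omega
  have hB' : p 3 = 0 ∨ p 0 + p 3 = 0 ∨ r * s * p 0 + a * s * p 1 + p 3 = 0 := by omega
  have F0 : r * b * p 0 + r * s * p 1 + p 2 = 0 → r * s * p 0 + a * s * p 1 + p 3 = 0 →
      ∃ j, faceFun r s a b j p = 0 := fun u v => ⟨0, by simp [faceFun, u, v]⟩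
  have F1 : p 1 + p 2 = 0 → p 3 = 0 → ∃ j, faceFun r s a b j p = 0 :=
    fun u v => ⟨1, by simp [faceFun, u, v]⟩
  have F2 : p 2 = 0 → p 3 = 0 → ∃ j, faceFun r s a b j p = 0 :=
    fun u v => ⟨2, by simp [faceFun, u, v]⟩
  have F3 : p 2 = 0 → p 0 + p 3 = 0 → ∃ j, faceFun r s a b j p = 0 :=
    fun u v => ⟨3, by simp [faceFun, u, v]⟩
  have hr1 : (0 : ℤ) < r := lt_of_le_of_ne hr' fun h0 => by
    rw [← h0] at hdet
    have := mul_nonneg ha hb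
    linarith
  have hs1 : (0 : ℤ) < s := lt_of_le_of_ne hs' fun h0 => by
    rw [← h0] at hdet
    have := mul_nonneg ha hb
    linarith
  rcases hA' with u | u | u <;> rcases hB' with v | v | v
  · exact F2 u v
  · exact F3 u v
  · rw [e3', u, add_zero] at h3
    have := mul_nonneg ha (nonneg_of_mul_nonneg_right h3 hr1)
    exact F3 u (by linarith)
  · exact F1 u v
  · have h0 : p 0 ≤ 0 := by linarith
    have h0' : p 1 ≤ 0 := by linarith
    have k1 := mul_nonneg_of_nonpos_of_nonpos (neg_nonpos.2 hb)
      (add_nonpos (mul_nonpos_of_nonneg_of_nonpos hr' h0) (mul_nonpos_of_nonneg_of_nonpos ha h0'))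
    have k2 := mul_nonneg_of_nonpos_of_nonpos (neg_nonpos.2 ha)
      (add_nonpos (mul_nonpos_of_nonneg_of_nonpos hb h0) (mul_nonpos_of_nonneg_of_nonpos hs' h0'))
    exact F0 (by linarith) (by linarith)
  · have h0 : r * p 0 + a * p 1 ≤ 0 := by
      by_contra h0
      have := mul_pos hs1 (not_le.1 h0)
      linarith
    have := mul_nonneg_of_nonpos_of_nonpos (neg_nonpos.2 hb) h0
    exact F0 (by linarith) v
  · rw [e6', v, add_zero] at h6
    have := mul_nonneg hb (nonneg_of_mul_nonneg_right h6 hs1)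
    exact F1 (by linarith) v
  · have h0 : b * p 0 + s * p 1 ≤ 0 := by
      by_contra h0
      have := mul_pos hr1 (not_le.1 h0)
      linarith
    have := mul_nonneg_of_nonpos_of_nonpos (neg_nonpos.2 ha) h0
    exact F0 u (by linarith)
  · exact F0 u v

/-- The primitive exponents on the two axes of the component `S_j`. -/
def axisVec (r s : ℕ) (a b : ℤ) (j : Fin 4) (i : Fin 2) : Lattice :=
  ![![![a, -r, r, 0], ![-s, b, 0, s]], ![![a, -r, r, 0], ![1, 0, 0, 0]],
    ![![1, 0, 0, 0], ![0, 1, 0, 0]], ![![-s, b, 0, s], ![0, 1, 0, 0]]] j i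

lemma FacetIneq.faceFun_eq_zero_iff {p : Lattice} (h : FacetIneq r s a b p) {j : Fin 4} :
    faceFun r s a b j p = 0 ↔
      ![r * b * p 0 + r * s * p 1 + p 2 = 0 ∧ r * s * p 0 + a * s * p 1 + p 3 = 0,
        p 1 + p 2 = 0 ∧ p 3 = 0, p 2 = 0 ∧ p 3 = 0, p 2 = 0 ∧ p 0 + p 3 = 0] j := by
  obtain ⟨h1, h2, h3, h4, h5, h6⟩ := h
  fin_cases j <;> simp [faceFun]
  · exact add_eq_zero_iff_of_nonneg h3 h6
  · exact add_eq_zero_iff_of_nonneg h2 h4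
  · exact add_eq_zero_iff_of_nonneg h1 h4
  · exact add_eq_zero_iff_of_nonneg h1 h5

lemma FacetIneq.axisDeg_smul (hdet : r * s - a * b = 1) {p : Lattice} (h : FacetIneq r s a b p)
    {j : Fin 4} (hj : faceFun r s a b j p = 0) :
    (axisDeg r s j : ℤ) • p = faceExp r s a b j 0 p • axisVec r s a b j 0 +
      faceExp r s a b j 1 p • axisVec r s a b j 1 := by
  rw [h.faceFun_eq_zero_iff] at hj
  funext i
  fin_cases j
  · obtain ⟨u, v⟩ : r * b * p 0 + r * s * p 1 + p 2 = 0 ∧ r * s * p 0 + a * s * p 1 + p 3 = 0 := hj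
    fin_cases i <;> simp [axisDeg, faceExp, axisVec]
    · linear_combination (-p 0) * hdet
    · linear_combination (-p 1) * hdet
    · linear_combination u
    · linear_combination v
  · obtain ⟨u, v⟩ : p 1 + p 2 = 0 ∧ p 3 = 0 := hj
    fin_cases i <;> simp [axisDeg, faceExp, axisVec]
    · ring
    · linear_combination (r : ℤ) * u
    · ring
    · exact Or.inr v
  · obtain ⟨u, v⟩ : p 2 = 0 ∧ p 3 = 0 := hj
    fin_cases i <;> simp [axisDeg, faceExp, axisVec, u, v]
  · obtain ⟨u, v⟩ : p 2 = 0 ∧ p 0 + p 3 = 0 := hj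
    fin_cases i <;> simp [axisDeg, faceExp, axisVec]
    · linear_combination (s : ℤ) * v
    · ring
    · exact Or.inr u
    · ring

lemma pos_of_det (hdet : r * s - a * b = 1) (ha : 0 ≤ a) (hb : 0 ≤ b) :
    (0 : ℤ) < r ∧ (0 : ℤ) < s := by
  have := mul_nonneg ha hb
  constructor <;> refine lt_of_le_of_ne (by positivity) fun h0 => ?_ <;> rw [← h0] at hdet <;>
    linarith

lemma FacetIneq.faceExp_nonneg (hdet : r * s - a * b = 1) (ha : 0 ≤ a) (hb : 0 ≤ b) {p : Lattice}
    (h : FacetIneq r s a b p) {j : Fin 4} (hj : faceFun r s a b j p = 0) (i : Fin 2) :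
    0 ≤ faceExp r s a b j i p := by
  obtain ⟨hr, hs⟩ := pos_of_det hdet ha hb
  rw [h.faceFun_eq_zero_iff] at hj
  obtain ⟨h1, h2, h3, h4, h5, h6⟩ := h
  fin_cases j
  · obtain ⟨u, v⟩ : r * b * p 0 + r * s * p 1 + p 2 = 0 ∧ r * s * p 0 + a * s * p 1 + p 3 = 0 := hj
    fin_cases i <;> simp only [faceExp] <;> simp
    · have := nonneg_of_mul_nonneg_right (b := -(b * p 0 + s * p 1)) (by linarith) hr
      linarith
    · have := nonneg_of_mul_nonneg_right (b := -(r * p 0 + a * p 1)) (by linarith) hs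
      linarith
  · obtain ⟨u, v⟩ : p 1 + p 2 = 0 ∧ p 3 = 0 := hj
    fin_cases i <;> simp [faceExp]
    · exact h1
    · have := nonneg_of_mul_nonneg_right (b := r * p 0 + a * p 1) (by linarith) hs
      have u' : p 2 = - p 1 := by linarith
      rw [u']
      linarith
  · obtain ⟨u, v⟩ : p 2 = 0 ∧ p 3 = 0 := hj
    fin_cases i <;> simp [faceExp] <;> linarith
  · obtain ⟨u, v⟩ : p 2 = 0 ∧ p 0 + p 3 = 0 := hj
    fin_cases i <;> simp [faceExp]
    · exact h4
    · have := nonneg_of_mul_nonneg_right (b := b * p 0 + s * p 1) (by linarith) hr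
      have u' : p 3 = - p 0 := by linarith
      rw [u']
      linarith

lemma axisVec_mem (j : Fin 4) (i : Fin 2) :
    axisVec r s a b j i ∈ latticePoints (modelCone r s a b) := by
  refine Submodule.subset_span ⟨_, ?_, rfl⟩
  fin_cases j <;> fin_cases i <;> simp [axisVec]

lemma axisDeg_ne_zero (hr : 1 ≤ r) (hs : 1 ≤ s) (j : Fin 4) : axisDeg r s j ≠ 0 := by
  fin_cases j <;> simp [axisDeg] <;> omega

/-- Subtracting `A` and `B` as long as possible ends on a face, where a multiple of the point is a
nonnegative combination of two axis vectors. The sum `p 2 + p 3` of two of the forms measures the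
descent. -/
lemma mem_latticePoints_of_facetIneq (hdet : r * s - a * b = 1) (ha : 0 ≤ a) (hb : 0 ≤ b)
    {p : Lattice} (h : FacetIneq r s a b p) : p ∈ latticePoints (modelCone r s a b) := by
  obtain ⟨hr, hs⟩ := pos_of_det hdet ha hb
  induction hn : (p 2 + p 3).toNat using Nat.strong_induction_on generalizing p with
  | _ n ih =>
    subst hn
    rcases h.face_or_sub hdet ha hb with ⟨j, hj⟩ | h' | h'
    · suffices hm : axisDeg r s j • p ∈ latticePoints (modelCone r s a b) from
        mem_latticePoints.2 <| mem_cone_of_nsmul (axisDeg_ne_zero (Nat.cast_pos.1 hr) (Nat.cast_pos.1 hs) j) hm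
      rw [← natCast_zsmul, h.axisDeg_smul hdet hj]
      obtain ⟨m, hm⟩ := Int.eq_ofNat_of_zero_le (h.faceExp_nonneg hdet ha hb hj 0)
      obtain ⟨n, hn⟩ := Int.eq_ofNat_of_zero_le (h.faceExp_nonneg hdet ha hb hj 1)
      rw [hm, hn, natCast_zsmul, natCast_zsmul]
      exact add_mem (nsmul_mem (axisVec_mem j 0) m) (nsmul_mem (axisVec_mem j 1) n)
    · have h1 := h'.A₁
      have h2 := h'.B₁
      simp at h1 h2
      have := ih _ (by simp; omega) h' rfl
      rw [← sub_add_cancel p ![0, 0, 1, 0]]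
      exact add_mem this (Submodule.subset_span ⟨_, by simp, rfl⟩)
    · have h1 := h'.A₁
      have h2 := h'.B₁
      simp at h1 h2
      have := ih _ (by simp; omega) h' rfl
      rw [← sub_add_cancel p ![0, 0, 0, 1]]
      exact add_mem this (Submodule.subset_span ⟨_, by simp, rfl⟩)

end Model

end Tent

end

/-! ### Regular sequences of monomials and the restriction map of the model -/

noncomputable section

namespace Tent

open MvPolynomial

section Regular

variable {σ : PointedCone ℝ (Fin 4 → ℝ)}

lemma coeff_mono_mul_add (p q : latticePoints σ) (f : toricRing σ) :
    (mono p * f).coeff (p + q) = f.coeff q := by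
  rw [mono, AddMonoidAlgebra.coeff_single_mul_add, one_mul]

/-- Ideals generated by monomials are tested on supports, so `B` is a nonzerodivisor modulo `A` as
soon as `A` divides every monomial `p` for which it divides `B + p`. The remaining hypotheses keep
`A` and `B` from being units. -/
lemma isRegular_mono {A B : latticePoints σ}
    (h : ∀ p q : latticePoints σ, B + p = A + q → ∃ q', p = A + q')
    (hA : ∀ q : latticePoints σ, A + q ≠ 0) (hB : ∀ q : latticePoints σ, B + q ≠ 0) :
    RingTheory.Sequence.IsRegular (toricRing σ) [(mono A : toricRing σ), mono B] := by
  rw [RingTheory.Sequence.isRegular_iff, RingTheory.Sequence.isWeaklyRegular_cons_iff,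
    RingTheory.Sequence.isWeaklyRegular_singleton_iff]
  refine ⟨⟨fun f g hfg => ?_, fun f g hfg => ?_⟩, fun htop => ?_⟩
  · have hfg' : mono A * f = mono A * g := hfg
    refine AddMonoidAlgebra.ext (Finsupp.ext fun p => ?_)
    rw [← coeff_mono_mul_add A p f, hfg', coeff_mono_mul_add]
  · obtain ⟨f, rfl⟩ := Submodule.Quotient.mk_surjective _ f
    obtain ⟨g, rfl⟩ := Submodule.Quotient.mk_surjective _ g
    have hfg' : Submodule.Quotient.mk (mono B • f) =
      (Submodule.Quotient.mk (mono B • g) : QuotSMulTop (mono A : toricRing σ) (toricRing σ)) := hfg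
    rw [Submodule.Quotient.eq, ← smul_sub, Submodule.mem_smul_pointwise_iff_exists] at hfg'
    obtain ⟨u, -, hu⟩ := hfg'
    have hmem : f - g ∈ Ideal.span {(mono A : toricRing σ)} := by
      have hmem' : mono B * (f - g) ∈ Ideal.span {(mono A : toricRing σ)} :=
        Ideal.mem_span_singleton'.2 ⟨u, by rw [mul_comm]; exact hu⟩
      rw [mem_span_singleton] at hmem' ⊢
      intro p hp
      obtain ⟨q, hq⟩ := hmem' (B + p) (by
        rw [Finsupp.mem_support_iff] at hp ⊢
        rwa [coeff_mono_mul_add])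
      exact h p q hq
    obtain ⟨v, hv⟩ := Ideal.mem_span_singleton'.1 hmem
    rw [Submodule.Quotient.eq, Submodule.mem_smul_pointwise_iff_exists]
    exact ⟨v, trivial, by rw [← hv, smul_eq_mul, mul_comm]⟩
  · have h1 : (1 : toricRing σ) ∈ Ideal.ofList [(mono A : toricRing σ), mono B] := by
      have : (1 : toricRing σ) ∈ (⊤ : Submodule (toricRing σ) (toricRing σ)) := trivial
      rwa [htop, smul_eq_mul, Ideal.mul_top] at this
    have hspan : Ideal.ofList [(mono A : toricRing σ), mono B] = Ideal.span {mono A, mono B} := by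
      rw [Ideal.ofList]
      congr 1
      ext x
      simp
    rw [hspan, ← mono_zero, mem_span_pair] at h1
    rcases h1 0 (by rw [support_mono]; simp) with ⟨q, hq⟩ | ⟨q, hq⟩
    · exact hA q hq.symm
    · exact hB q hq.symm

end Regular

section Model

variable {r α s β : ℕ} {a b : ℤ}

/-- The exponent of the restriction to `S_j` of the monomial with exponent `p`. -/
def modelExpo (r s : ℕ) (a b : ℤ) (j : Fin 4) (p : Lattice) : Fin 2 →₀ ℕ :=
  expVec (faceExp r s a b j 0 p).toNat (faceExp r s a b j 1 p).toNat

/-- The restriction to `T` of the monomial with exponent `p`. -/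
def modelRestr (r s : ℕ) (a b : ℤ) (p : Lattice) : Fin 4 → Poly2 := fun j =>
  if faceFun r s a b j p = 0 then monomial (modelExpo r s a b j p) 1 else 0

lemma modelRestr_zero : modelRestr r s a b 0 = 1 := by
  funext j
  simp [modelRestr, faceFun_zero, modelExpo, faceExp_zero, expVec]

/-- `faceFun` is additive and nonnegative, so a sum lies on a face only if both summands do, and
there the exponents add up. -/
lemma modelRestr_add (hdet : r * s - a * b = 1) (ha : 0 ≤ a) (hb : 0 ≤ b) {p q : Lattice}
    (hp : FacetIneq r s a b p) (hq : FacetIneq r s a b q) :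
    modelRestr r s a b (p + q) = modelRestr r s a b p * modelRestr r s a b q := by
  funext j
  simp only [modelRestr, Pi.mul_apply, faceFun_add]
  by_cases h : faceFun r s a b j p + faceFun r s a b j q = 0
  · obtain ⟨h1, h2⟩ := (add_eq_zero_iff_of_nonneg (hp.faceFun_nonneg j) (hq.faceFun_nonneg j)).1 h
    rw [if_pos h, if_pos h1, if_pos h2, monomial_mul, one_mul]
    refine congrArg (fun m => monomial m (1 : ℂ)) (expVec_ext ?_ ?_) <;>
      simp only [modelExpo, faceExp_add, Finsupp.add_apply, expVec_zero, expVec_one] <;>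
      exact Int.toNat_add (hp.faceExp_nonneg hdet ha hb h1 _) (hq.faceExp_nonneg hdet ha hb h2 _)
  · rw [if_neg h]
    symm
    by_cases h1 : faceFun r s a b j p = 0
    · have h2 : faceFun r s a b j q ≠ 0 := fun h2 => h (by rw [h1, h2, add_zero])
      rw [if_neg h2, mul_zero]
    · rw [if_neg h1, zero_mul]

/-- The faces of two components `S_j`, `S_j'` meet along a common axis, with coordinate the `i`th
coordinate of `S_j` and the `i'`th coordinate of `S_j'`, the former being an `n`th root of
the latter. -/
structure Edge (r s : ℕ) (a b : ℤ) (n : ℕ) (j : Fin 4) (i k : Fin 2) (j' : Fin 4) (i' k' : Fin 2)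
    (p : Lattice) : Prop where
  left : faceFun r s a b j p = 0 → faceFun r s a b j' p = 0 → faceExp r s a b j k p = 0
  right : faceFun r s a b j p = 0 → faceFun r s a b j' p = 0 → faceExp r s a b j' k' p = 0
  exp_eq : faceFun r s a b j p = 0 → faceFun r s a b j' p = 0 →
    faceExp r s a b j i p = n * faceExp r s a b j' i' p
  of_left : faceFun r s a b j p = 0 → faceExp r s a b j k p = 0 → faceFun r s a b j' p = 0
  of_right : faceFun r s a b j' p = 0 → faceExp r s a b j' k' p = 0 → faceFun r s a b j p = 0

lemma FacetIneq.edge_x₀ (hdet : r * s - a * b = 1) (ha : 0 ≤ a) (hb : 0 ≤ b) {p : Lattice}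
    (hp : FacetIneq r s a b p) : Edge r s a b r 1 0 1 0 0 1 p := by
  obtain ⟨hr, hs⟩ := pos_of_det hdet ha hb
  have e1 : faceFun r s a b 1 p = 0 ↔ p 1 + p 2 = 0 ∧ p 3 = 0 := hp.faceFun_eq_zero_iff
  have e0 : faceFun r s a b 0 p = 0 ↔ r * b * p 0 + r * s * p 1 + p 2 = 0 ∧
    r * s * p 0 + a * s * p 1 + p 3 = 0 := hp.faceFun_eq_zero_iff
  have x11 : faceExp r s a b 1 1 p = r * p 0 - a * p 2 := rfl
  have x10 : faceExp r s a b 1 0 p = p 2 := rfl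
  have x00 : faceExp r s a b 0 0 p = -(b * p 0 + s * p 1) := rfl
  have x01 : faceExp r s a b 0 1 p = -(r * p 0 + a * p 1) := rfl
  rw [← sub_eq_zero] at hdet
  have key : p 3 = 0 → r * s * p 0 + a * s * p 1 + p 3 = 0 → r * p 0 + a * p 1 = 0 := fun u v =>
    (mul_eq_zero_iff_left hs.ne').1 (by rw [u] at v; linear_combination v)
  constructor
  · rw [e0, e1, x11]
    rintro ⟨u, v⟩ ⟨w, z⟩
    linear_combination key v z - a * u
  · rw [e0, e1, x01]
    rintro ⟨u, v⟩ ⟨w, z⟩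
    linear_combination -key v z
  · rw [e0, e1, x10, x00]
    rintro ⟨u, v⟩ ⟨w, z⟩
    linear_combination w
  · rw [e0, e1, x11]
    rintro ⟨u, v⟩ w
    exact ⟨by linear_combination p 1 * hdet + (1 + a * b) * u + b * w,
      by linear_combination s * w + a * s * u + v⟩
  · rw [e0, e1, x01]
    rintro ⟨u, v⟩ w
    exact ⟨by linear_combination u + b * w - p 1 * hdet, by linear_combination v + s * w⟩

lemma FacetIneq.edge_ξ {p : Lattice} (hp : FacetIneq r s a b p) :
    Edge r s a b r 1 1 0 2 0 1 p := by
  have e1 : faceFun r s a b 1 p = 0 ↔ p 1 + p 2 = 0 ∧ p 3 = 0 := hp.faceFun_eq_zero_iff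
  have e2 : faceFun r s a b 2 p = 0 ↔ p 2 = 0 ∧ p 3 = 0 := hp.faceFun_eq_zero_iff
  have x11 : faceExp r s a b 1 1 p = r * p 0 - a * p 2 := rfl
  have x10 : faceExp r s a b 1 0 p = p 2 := rfl
  have x20 : faceExp r s a b 2 0 p = p 0 := rfl
  have x21 : faceExp r s a b 2 1 p = p 1 := rfl
  constructor <;> simp only [e1, e2, x11, x10, x20, x21]
  · exact fun _ h => h.1
  · exact fun h h' => by linarith [h.1, h'.1]
  · exact fun _ h => by rw [h.1]; ring
  · exact fun h h' => ⟨h', h.2⟩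
  · exact fun h h' => ⟨by rw [h', h.1, add_zero], h.2⟩

lemma FacetIneq.edge_η {p : Lattice} (hp : FacetIneq r s a b p) :
    Edge r s a b s 3 1 0 2 1 0 p := by
  have e3 : faceFun r s a b 3 p = 0 ↔ p 2 = 0 ∧ p 0 + p 3 = 0 := hp.faceFun_eq_zero_iff
  have e2 : faceFun r s a b 2 p = 0 ↔ p 2 = 0 ∧ p 3 = 0 := hp.faceFun_eq_zero_iff
  have x31 : faceExp r s a b 3 1 p = s * p 1 - b * p 3 := rfl
  have x30 : faceExp r s a b 3 0 p = p 3 := rfl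
  have x20 : faceExp r s a b 2 0 p = p 0 := rfl
  have x21 : faceExp r s a b 2 1 p = p 1 := rfl
  constructor <;> simp only [e3, e2, x31, x30, x20, x21]
  · exact fun _ h => h.2
  · exact fun h h' => by linarith [h.2, h'.2]
  · exact fun _ h => by rw [h.2]; ring
  · exact fun h h' => ⟨h.1, h'⟩
  · exact fun h h' => ⟨h.1, by rw [h', h.2, add_zero]⟩

lemma FacetIneq.edge_y₀ (hdet : r * s - a * b = 1) (ha : 0 ≤ a) (hb : 0 ≤ b) {p : Lattice}
    (hp : FacetIneq r s a b p) : Edge r s a b s 3 0 1 0 1 0 p := by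
  obtain ⟨hr, hs⟩ := pos_of_det hdet ha hb
  have e3 : faceFun r s a b 3 p = 0 ↔ p 2 = 0 ∧ p 0 + p 3 = 0 := hp.faceFun_eq_zero_iff
  have e0 : faceFun r s a b 0 p = 0 ↔ r * b * p 0 + r * s * p 1 + p 2 = 0 ∧
    r * s * p 0 + a * s * p 1 + p 3 = 0 := hp.faceFun_eq_zero_iff
  have x31 : faceExp r s a b 3 1 p = s * p 1 - b * p 3 := rfl
  have x30 : faceExp r s a b 3 0 p = p 3 := rfl
  have x00 : faceExp r s a b 0 0 p = -(b * p 0 + s * p 1) := rfl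
  have x01 : faceExp r s a b 0 1 p = -(r * p 0 + a * p 1) := rfl
  rw [← sub_eq_zero] at hdet
  have key : p 2 = 0 → r * b * p 0 + r * s * p 1 + p 2 = 0 → b * p 0 + s * p 1 = 0 := fun u v =>
    (mul_eq_zero_iff_left hr.ne').1 (by rw [u] at v; linear_combination v)
  constructor
  · rw [e0, e3, x31]
    rintro ⟨u, v⟩ ⟨w, z⟩
    linear_combination key u w - b * v
  · rw [e0, e3, x00]
    rintro ⟨u, v⟩ ⟨w, z⟩
    linear_combination -key u w
  · rw [e0, e3, x30, x01]
    rintro ⟨u, v⟩ ⟨w, z⟩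
    linear_combination z
  · rw [e0, e3, x31]
    rintro ⟨u, v⟩ w
    exact ⟨by linear_combination r * w + r * b * v + u,
      by linear_combination p 0 * hdet + (1 + a * b) * v + a * w⟩
  · rw [e0, e3, x00]
    rintro ⟨u, v⟩ w
    exact ⟨by linear_combination u + r * w, by linear_combination v + a * w - p 0 * hdet⟩

lemma Edge.ite_eq {n : ℕ} {j : Fin 4} {i k : Fin 2} {j' : Fin 4} {i' k' : Fin 2} {p : Lattice}
    (h : Edge r s a b n j i k j' i' k' p)
    (hnn : faceFun r s a b j' p = 0 → 0 ≤ faceExp r s a b j' i' p) :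
    (if faceFun r s a b j p = 0 ∧ faceExp r s a b j k p = 0 then
      Polynomial.monomial (1 * (faceExp r s a b j i p).toNat) (1 : ℂ) else 0) =
    if faceFun r s a b j' p = 0 ∧ faceExp r s a b j' k' p = 0 then
      Polynomial.monomial (n * (faceExp r s a b j' i' p).toNat) 1 else 0 := by
  have hiff : (faceFun r s a b j p = 0 ∧ faceExp r s a b j k p = 0) ↔
      (faceFun r s a b j' p = 0 ∧ faceExp r s a b j' k' p = 0) :=
    ⟨fun u => ⟨h.of_left u.1 u.2, h.right u.1 (h.of_left u.1 u.2)⟩,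
      fun u => ⟨h.of_right u.1 u.2, h.left (h.of_right u.1 u.2) u.1⟩⟩
  by_cases u : faceFun r s a b j p = 0 ∧ faceExp r s a b j k p = 0
  · rw [if_pos u, if_pos (hiff.1 u), one_mul, h.exp_eq u.1 (hiff.1 u).1,
      Int.toNat_mul (by simp) (hnn (hiff.1 u).1), Int.toNat_natCast]
  · rw [if_neg u, if_neg fun v => u (hiff.2 v)]

lemma toNat_eq_zero_iff {m : ℤ} (h : 0 ≤ m) : m.toNat = 0 ↔ m = 0 := by omega

lemma restrFst_modelRestr (hdet : r * s - a * b = 1) (ha : 0 ≤ a) (hb : 0 ≤ b) {p : Lattice}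
    (hp : FacetIneq r s a b p) (n : ℕ) (j : Fin 4) : restrFst n (modelRestr r s a b p j) =
      if faceFun r s a b j p = 0 ∧ faceExp r s a b j 1 p = 0 then
        Polynomial.monomial (n * (faceExp r s a b j 0 p).toNat) 1 else 0 := by
  rw [modelRestr]
  by_cases h : faceFun r s a b j p = 0
  · simp only [h, if_true, true_and]
    rw [restrFst_monomial, modelExpo, expVec_zero, expVec_one]
    simp only [toNat_eq_zero_iff (hp.faceExp_nonneg hdet ha hb h 1)]
  · simp [h]

lemma restrSnd_modelRestr (hdet : r * s - a * b = 1) (ha : 0 ≤ a) (hb : 0 ≤ b) {p : Lattice}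
    (hp : FacetIneq r s a b p) (n : ℕ) (j : Fin 4) : restrSnd n (modelRestr r s a b p j) =
      if faceFun r s a b j p = 0 ∧ faceExp r s a b j 0 p = 0 then
        Polynomial.monomial (n * (faceExp r s a b j 1 p).toNat) 1 else 0 := by
  rw [modelRestr]
  by_cases h : faceFun r s a b j p = 0
  · simp only [h, if_true, true_and]
    rw [restrSnd_monomial, modelExpo, expVec_zero, expVec_one]
    simp only [toNat_eq_zero_iff (hp.faceExp_nonneg hdet ha hb h 0)]
  · simp [h]

/-- The second exponent is `-c` times the first modulo `n`, and `c ≡ γ`: this is the invariance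
condition. Here the congruences for `a` and `b` enter. -/
lemma cyclicAction_modelRestr {n : ℕ} (hn : 1 ≤ n) {γ : ℕ} {c : ℤ} (hc : c ≡ γ [ZMOD n])
    {p : Lattice} {j : Fin 4} (k : ℤ)
    (h1 : faceExp r s a b j 1 p = n * k - c * faceExp r s a b j 0 p)
    (h : faceFun r s a b j p = 0 → ∀ i, 0 ≤ faceExp r s a b j i p) :
    cyclicAction n γ (modelRestr r s a b p j) = modelRestr r s a b p j := by
  rw [modelRestr]
  split_ifs with h0
  · refine cyclicAction_monomial_of_dvd hn ?_ 1
    rw [modelExpo, expVec_zero, expVec_one]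
    zify
    rw [Int.toNat_of_nonneg (h h0 0), Int.toNat_of_nonneg (h h0 1), h1]
    obtain ⟨t, ht⟩ := hc.dvd
    exact ⟨t * faceExp r s a b j 0 p + k, by linear_combination faceExp r s a b j 0 p * ht⟩
  · rw [map_zero]

lemma modelRestr_mem (h : (a, b) ∈ entryPairs r α s β) {p : Lattice}
    (hp : FacetIneq r s a b p) : modelRestr r s a b p ∈ tentRing r α s β := by
  obtain ⟨hdet, ha, hb, hα, hβ⟩ : (r : ℤ) * s - a * b = 1 ∧ 0 ≤ a ∧ 0 ≤ b ∧ a ≡ α [ZMOD r] ∧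
    b ≡ β [ZMOD s] := h
  obtain ⟨hr, hs⟩ := pos_of_det hdet ha hb
  refine ⟨cyclicAction_modelRestr (Nat.cast_pos.1 hr) hα (p 0) rfl fun u i =>
      hp.faceExp_nonneg hdet ha hb u i,
    cyclicAction_modelRestr (Nat.cast_pos.1 hs) hβ (p 1) rfl fun u i =>
      hp.faceExp_nonneg hdet ha hb u i, ?_, ?_, ?_, ?_⟩ <;>
    simp only [restrFst_modelRestr hdet ha hb hp, restrSnd_modelRestr hdet ha hb hp]
  · exact (hp.edge_x₀ hdet ha hb).ite_eq fun u => hp.faceExp_nonneg hdet ha hb u _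
  · exact hp.edge_ξ.ite_eq fun u => hp.faceExp_nonneg hdet ha hb u _
  · exact hp.edge_η.ite_eq fun u => hp.faceExp_nonneg hdet ha hb u _
  · exact (hp.edge_y₀ hdet ha hb).ite_eq fun u => hp.faceExp_nonneg hdet ha hb u _

/-- The restriction of functions from `V_{AB}` to `T`. -/
def modelRestrict (h : (a, b) ∈ entryPairs r α s β) :
    toricRing (modelCone r s a b) →ₐ[ℂ] tentRing r α s β :=
  AlgHom.codRestrict (AddMonoidAlgebra.lift ℂ (Fin 4 → Poly2) (latticePoints (modelCone r s a b))
    { toFun := fun p => modelRestr r s a b p.toAdd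
      map_one' := modelRestr_zero
      map_mul' := fun p q => modelRestr_add h.1 h.2.1 h.2.2.1
        (facetIneq_of_mem h.1 h.2.1 h.2.2.1 p.toAdd.2)
        (facetIneq_of_mem h.1 h.2.1 h.2.2.1 q.toAdd.2) }) _ fun f => by
    rw [AddMonoidAlgebra.lift_apply]
    refine Subalgebra.sum_mem _ fun p _ => Subalgebra.smul_mem _ ?_ _
    exact modelRestr_mem h (facetIneq_of_mem h.1 h.2.1 h.2.2.1 p.2)

lemma modelRestrict_mono (h : (a, b) ∈ entryPairs r α s β)
    (p : latticePoints (modelCone r s a b)) :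
    (modelRestrict h (mono p) : Fin 4 → Poly2) = modelRestr r s a b p := by
  rw [modelRestrict, AlgHom.coe_codRestrict, mono, AddMonoidAlgebra.lift_single, one_smul]
  rfl

end Model

end Tent

end

/-! ### The restriction map is onto -/

noncomputable section

namespace Tent

open MvPolynomial

section Model

variable {r α s β : ℕ} {a b : ℤ}

lemma FacetIneq.toNat_faceExp (h : (a, b) ∈ entryPairs r α s β) {p : Lattice}
    (hp : FacetIneq r s a b p) {j : Fin 4} (hj : faceFun r s a b j p = 0) (i : Fin 2) :
    (modelExpo r s a b j p i : ℤ) = faceExp r s a b j i p := by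
  have := hp.faceExp_nonneg h.1 h.2.1 h.2.2.1 hj i
  fin_cases i <;> simpa [modelExpo] using this

lemma modelExpo_injective (h : (a, b) ∈ entryPairs r α s β) {p q : Lattice}
    (hp : FacetIneq r s a b p) (hq : FacetIneq r s a b q) {j : Fin 4}
    (hjp : faceFun r s a b j p = 0) (hjq : faceFun r s a b j q = 0)
    (he : modelExpo r s a b j p = modelExpo r s a b j q) : p = q := by
  obtain ⟨hr, hs⟩ := pos_of_det h.1 h.2.1 h.2.2.1
  have h1 : (axisDeg r s j : ℤ) • p = (axisDeg r s j : ℤ) • q := by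
    rw [hp.axisDeg_smul h.1 hjp, hq.axisDeg_smul h.1 hjq, ← hp.toNat_faceExp h hjp,
      ← hp.toNat_faceExp h hjp, he, hq.toNat_faceExp h hjq, hq.toNat_faceExp h hjq]
  have h2 := axisDeg_ne_zero (Nat.cast_pos.1 hr) (Nat.cast_pos.1 hs) j
  exact smul_right_injective Lattice (Nat.cast_ne_zero.2 h2) h1

lemma exists_modelExpo_eq (h : (a, b) ∈ entryPairs r α s β) {j : Fin 4} {m : Fin 2 →₀ ℕ}
    (hm : Invariant r α s β j m) : ∃ p : Lattice, FacetIneq r s a b p ∧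
      faceFun r s a b j p = 0 ∧ modelExpo r s a b j p = m := by
  obtain ⟨hdet, ha, hb, hα, hβ⟩ : (r : ℤ) * s - a * b = 1 ∧ 0 ≤ a ∧ 0 ≤ b ∧ a ≡ α [ZMOD r] ∧
    b ≡ β [ZMOD s] := h
  obtain ⟨hr, hs⟩ := pos_of_det hdet ha hb
  suffices ∃ p : Lattice, (axisDeg r s j : ℤ) • p = (m 0 : ℤ) • axisVec r s a b j 0 +
      (m 1 : ℤ) • axisVec r s a b j 1 ∧ faceFun r s a b j p = 0 ∧
      faceExp r s a b j 0 p = m 0 ∧ faceExp r s a b j 1 p = m 1 by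
    obtain ⟨p, h1, h2, h3, h4⟩ := this
    refine ⟨p, facetIneq_of_mem hdet ha hb (mem_latticePoints.2 <| mem_cone_of_nsmul
      (axisDeg_ne_zero (Nat.cast_pos.1 hr) (Nat.cast_pos.1 hs) j) (mem_latticePoints.1 ?_)), h2,
      expVec_ext (by simp [modelExpo, h3]) (by simp [modelExpo, h4])⟩
    rw [← natCast_zsmul, h1, natCast_zsmul, natCast_zsmul]
    exact add_mem (nsmul_mem (axisVec_mem j 0) _) (nsmul_mem (axisVec_mem j 1) _)
  obtain ⟨m1, m3⟩ := hm
  fin_cases j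
  · refine ⟨![a * m 0 - s * m 1, -r * m 0 + b * m 1, r * m 0, s * m 1], ?_, ?_, ?_, ?_⟩
    · funext i
      fin_cases i <;> simp [axisDeg, axisVec] <;> ring
    · simp [faceFun]
      linear_combination (-r * m 0 - s * m 1 : ℤ) * hdet
    · simp [faceExp]
      linear_combination (m 0 : ℤ) * hdet
    · simp [faceExp]
      linear_combination (m 1 : ℤ) * hdet
  · obtain ⟨t, ht⟩ := m1 rfl
    obtain ⟨u, hu⟩ := hα.symm.dvd
    zify at ht
    -- The first coordinate is `(a m₀ + m₁) / r`, an integer because `a - α = ru` and `α m₀ + m₁ =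
    -- rt`.
    refine ⟨![t + u * m 0, -m 0, m 0, 0], ?_, ?_, ?_, ?_⟩
    · funext i
      fin_cases i <;> simp [axisDeg, axisVec]
      · linear_combination (-(m 0 : ℤ)) * hu - ht
      · ring
      · ring
    · simp [faceFun]
    · simp [faceExp]
    · simp [faceExp]
      linear_combination (-(m 0 : ℤ)) * hu - ht
  · refine ⟨![m 0, m 1, 0, 0], ?_, ?_, ?_, ?_⟩
    · funext i
      fin_cases i <;> simp [axisDeg, axisVec]
    · simp [faceFun]
    · simp [faceExp]
    · simp [faceExp]
  · obtain ⟨t, ht⟩ := m3 rfl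
    obtain ⟨u, hu⟩ := hβ.symm.dvd
    zify at ht
    refine ⟨![-m 0, t + u * m 0, 0, m 0], ?_, ?_, ?_, ?_⟩
    · funext i
      fin_cases i <;> simp [axisDeg, axisVec]
      · ring
      · linear_combination (-(m 0 : ℤ)) * hu - ht
      · ring
    · simp [faceFun]
    · simp [faceExp]
    · simp [faceExp]
      linear_combination (-(m 0 : ℤ)) * hu - ht

lemma Edge.modelExpo_eq {n : ℕ} {j : Fin 4} {i k : Fin 2} {j' : Fin 4} {i' k' : Fin 2}
    {p : Lattice} (he : Edge r s a b n j i k j' i' k' p) (h : (a, b) ∈ entryPairs r α s β)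
    (hp : FacetIneq r s a b p) (hj : faceFun r s a b j p = 0) (hj' : faceFun r s a b j' p = 0) :
    modelExpo r s a b j p k = 0 ∧ modelExpo r s a b j' p k' = 0 ∧
      modelExpo r s a b j p i = n * modelExpo r s a b j' p i' := by
  zify
  simp only [hp.toNat_faceExp h hj, hp.toNat_faceExp h hj']
  exact ⟨he.left hj hj', he.right hj hj', he.exp_eq hj hj'⟩

/-- The restrictions of a function on the tent to its components have the same coefficients at
the monomials given by a common exponent. -/
lemma coeff_modelExpo_eq (h : (a, b) ∈ entryPairs r α s β) {F : Fin 4 → Poly2}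
    (hF : F ∈ tentRing r α s β) {p : Lattice} (hp : FacetIneq r s a b p) {j j' : Fin 4}
    (hj : faceFun r s a b j p = 0) (hj' : faceFun r s a b j' p = 0) :
    coeff (modelExpo r s a b j p) (F j) = coeff (modelExpo r s a b j' p) (F j') := by
  obtain ⟨hdet, ha, hb, -, -⟩ : (r : ℤ) * s - a * b = 1 ∧ 0 ≤ a ∧ 0 ≤ b ∧ a ≡ α [ZMOD r] ∧
    b ≡ β [ZMOD s] := id h
  obtain ⟨hr, hs⟩ := pos_of_det hdet ha hb
  have hr' : 1 ≤ r := Nat.cast_pos.1 hr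
  have hs' : 1 ≤ s := Nat.cast_pos.1 hs
  set c : Fin 4 → ℂ := fun j => coeff (modelExpo r s a b j p) (F j) with hc
  have h10 : faceFun r s a b 1 p = 0 → faceFun r s a b 0 p = 0 → c 1 = c 0 := fun u v => by
    obtain ⟨k1, k2, k3⟩ := (hp.edge_x₀ hdet ha hb).modelExpo_eq h hp u v
    rw [hc]
    dsimp only
    rw [← expVec_eta (modelExpo r s a b 1 p), ← expVec_eta (modelExpo r s a b 0 p), k1, k2, k3,
      coeff_x₀_axis hr' hF]
  have h12 : faceFun r s a b 1 p = 0 → faceFun r s a b 2 p = 0 → c 1 = c 2 := fun u v => by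
    obtain ⟨k1, k2, k3⟩ := hp.edge_ξ.modelExpo_eq h hp u v
    rw [hc]
    dsimp only
    rw [← expVec_eta (modelExpo r s a b 1 p), ← expVec_eta (modelExpo r s a b 2 p), k1, k2, k3,
      coeff_ξ_axis hr' hF]
  have h32 : faceFun r s a b 3 p = 0 → faceFun r s a b 2 p = 0 → c 3 = c 2 := fun u v => by
    obtain ⟨k1, k2, k3⟩ := hp.edge_η.modelExpo_eq h hp u v
    rw [hc]
    dsimp only
    rw [← expVec_eta (modelExpo r s a b 3 p), ← expVec_eta (modelExpo r s a b 2 p), k1, k2, k3,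
      coeff_η_axis hs' hF]
  have h30 : faceFun r s a b 3 p = 0 → faceFun r s a b 0 p = 0 → c 3 = c 0 := fun u v => by
    obtain ⟨k1, k2, k3⟩ := (hp.edge_y₀ hdet ha hb).modelExpo_eq h hp u v
    rw [hc]
    dsimp only
    rw [← expVec_eta (modelExpo r s a b 3 p), ← expVec_eta (modelExpo r s a b 0 p), k1, k2, k3,
      coeff_y₀_axis hs' hF]
  -- Exponents common to opposite components also lie on a component between them, so they are
  -- compared in two steps.
  have e13 : faceFun r s a b 1 p = 0 → faceFun r s a b 3 p = 0 → faceFun r s a b 2 p = 0 := by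
    rw [hp.faceFun_eq_zero_iff, hp.faceFun_eq_zero_iff, hp.faceFun_eq_zero_iff]
    exact fun u v => ⟨v.1, u.2⟩
  have e02 : faceFun r s a b 0 p = 0 → faceFun r s a b 2 p = 0 → faceFun r s a b 1 p = 0 := by
    intro u v
    have := hp.axisDeg_smul hdet u
    rw [hp.faceFun_eq_zero_iff] at u v
    obtain ⟨u1, u2⟩ : r * b * p 0 + r * s * p 1 + p 2 = 0 ∧ r * s * p 0 + a * s * p 1 + p 3 = 0 := u
    obtain ⟨v1, v2⟩ : p 2 = 0 ∧ p 3 = 0 := v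
    rw [v1, add_zero] at u1
    rw [v2, add_zero] at u2
    have w1 : b * p 0 + s * p 1 = 0 := (mul_eq_zero_iff_left hr.ne').1 (by linear_combination u1)
    have w2 : r * p 0 + a * p 1 = 0 := (mul_eq_zero_iff_left hs.ne').1 (by linear_combination u2)
    rw [hp.faceFun_eq_zero_iff]
    refine ⟨?_, v2⟩
    linear_combination r * w1 - b * w2 - p 1 * hdet + v1
  change c j = c j'
  fin_cases j <;> fin_cases j' <;> first | rfl | skip
  · exact (h10 hj' hj).symm
  · exact (h10 (e02 hj hj') hj).symm.trans (h12 (e02 hj hj') hj')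
  · exact (h30 hj' hj).symm
  · exact h10 hj hj'
  · exact h12 hj hj'
  · exact (h12 hj (e13 hj hj')).trans (h32 hj' (e13 hj hj')).symm
  · exact ((h10 (e02 hj' hj) hj').symm.trans (h12 (e02 hj' hj) hj)).symm
  · exact (h12 hj' hj).symm
  · exact (h32 hj' hj).symm
  · exact h30 hj hj'
  · exact ((h12 hj' (e13 hj' hj)).trans (h32 hj (e13 hj' hj)).symm).symm
  · exact h32 hj hj'

lemma modelRestrict_apply (h : (a, b) ∈ entryPairs r α s β)
    (f : toricRing (modelCone r s a b)) (j : Fin 4) :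
    (modelRestrict h f : Fin 4 → Poly2) j =
      ∑ p ∈ f.coeff.support, f.coeff p • modelRestr r s a b p j := by
  conv_lhs => rw [sum_coeff_mono f]
  rw [map_sum, AddSubmonoidClass.coe_finsetSum, Finset.sum_apply]
  refine Finset.sum_congr rfl fun p _ => ?_
  rw [map_smul, ← modelRestrict_mono h]
  rfl

lemma coeff_modelRestrict (h : (a, b) ∈ entryPairs r α s β)
    (f : toricRing (modelCone r s a b)) {j : Fin 4} {p : latticePoints (modelCone r s a b)}
    (hj : faceFun r s a b j p = 0) :
    coeff (modelExpo r s a b j p) ((modelRestrict h f : Fin 4 → Poly2) j) = f.coeff p := by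
  rw [modelRestrict_apply, coeff_sum, Finset.sum_eq_single p]
  · rw [modelRestr, if_pos hj, coeff_smul, coeff_monomial, if_pos rfl, smul_eq_mul, mul_one]
  · intro q _ hq
    rw [modelRestr]
    split_ifs with hjq
    · rw [coeff_smul, coeff_monomial, if_neg, smul_zero]
      exact fun he => hq (Subtype.ext (modelExpo_injective h
        (facetIneq_of_mem h.1 h.2.1 h.2.2.1 q.2) (facetIneq_of_mem h.1 h.2.1 h.2.2.1 p.2)
        hjq hj he))
    · simp
  · intro hp
    rw [Finsupp.notMem_support_iff.1 hp, zero_smul, coeff_zero]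

/-- Coefficients at invariant exponents belong to lattice points of the face; all other coefficients
vanish on both sides. -/
lemma coeff_modelRestrict_eq (h : (a, b) ∈ entryPairs r α s β) {F : Fin 4 → Poly2}
    (hF : F ∈ tentRing r α s β) {f : toricRing (modelCone r s a b)}
    (hf : ∀ (p : latticePoints (modelCone r s a b)) (j : Fin 4), faceFun r s a b j p = 0 →
      f.coeff p = coeff (modelExpo r s a b j p) (F j)) :
    (modelRestrict h f : Fin 4 → Poly2) = F := by
  obtain ⟨hr, hs⟩ := pos_of_det h.1 h.2.1 h.2.2.1
  have hr' : 1 ≤ r := Nat.cast_pos.1 hr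
  have hs' : 1 ≤ s := Nat.cast_pos.1 hs
  funext j
  ext m
  by_cases hm : Invariant r α s β j m
  · obtain ⟨p, hp, hj, rfl⟩ := exists_modelExpo_eq h hm
    have := coeff_modelRestrict h f
      (p := ⟨p, mem_latticePoints_of_facetIneq h.1 h.2.1 h.2.2.1 hp⟩) hj
    rw [this, hf _ j hj]
  · rw [not_imp_comm.1 (invariant_of_coeff_ne_zero hr' hs' hF) hm,
      not_imp_comm.1 (invariant_of_coeff_ne_zero hr' hs' (modelRestrict h f).2) hm]

open Classical in
lemma modelRestrict_surjective (h : (a, b) ∈ entryPairs r α s β) :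
    Function.Surjective (modelRestrict h) := by
  rintro ⟨F, hF⟩
  -- The lift has at `p` the coefficient of `F` on any component where `p` survives;
  -- `coeff_modelExpo_eq` makes this independent of the component.
  set c : latticePoints (modelCone r s a b) → ℂ := fun p =>
    if hp : ∃ j, faceFun r s a b j p = 0 then coeff (modelExpo r s a b hp.choose p) (F hp.choose)
    else 0 with hc
  have hc' : ∀ (p : latticePoints (modelCone r s a b)) (j : Fin 4), faceFun r s a b j p = 0 →
      c p = coeff (modelExpo r s a b j p) (F j) := fun p j hj => by
    have hp : ∃ j, faceFun r s a b j p = 0 := ⟨j, hj⟩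
    rw [hc]
    dsimp only
    rw [dif_pos hp]
    exact coeff_modelExpo_eq h hF (facetIneq_of_mem h.1 h.2.1 h.2.2.1 p.2) hp.choose_spec hj
  have hfin : (Function.support c).Finite := by
    have hsub : Function.support c ⊆ ⋃ j : Fin 4, {p | faceFun r s a b j p = 0 ∧
        modelExpo r s a b j p ∈ (F j).support} := fun p hp => by
      have hp' : ∃ j, faceFun r s a b j p = 0 := by
        by_contra hne
        exact hp (by rw [hc]; dsimp only; rw [dif_neg hne])
      obtain ⟨j, hj⟩ := hp'
      refine Set.mem_iUnion.2 ⟨j, hj, ?_⟩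
      rw [mem_support_iff, ← hc' p j hj]
      exact hp
    refine Set.Finite.subset (Set.finite_iUnion fun j => ?_) hsub
    refine Set.Finite.of_finite_image (f := fun p => modelExpo r s a b j p)
      ((F j).support.finite_toSet.subset ?_) ?_
    · rintro - ⟨p, ⟨-, hp⟩, rfl⟩
      exact hp
    · rintro p ⟨hp, -⟩ q ⟨hq, -⟩ he
      exact Subtype.ext (modelExpo_injective h (facetIneq_of_mem h.1 h.2.1 h.2.2.1 p.2)
        (facetIneq_of_mem h.1 h.2.1 h.2.2.1 q.2) hp hq he)
  refine ⟨AddMonoidAlgebra.ofCoeff (Finsupp.ofSupportFinite c hfin), Subtype.ext ?_⟩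
  exact coeff_modelRestrict_eq h hF hc'

end Model

end Tent

end

/-! ### The model as a toric deformation -/

noncomputable section

namespace Tent

section Model

variable {r α s β : ℕ} {a b : ℤ}

lemma modelCone_rational (r s : ℕ) (a b : ℤ) : ∃ G : Finset Lattice,
    modelCone r s a b = PointedCone.hull ℝ (toReal '' (G : Set Lattice)) :=
  ⟨{![1, 0, 0, 0], ![0, 1, 0, 0], ![0, 0, 1, 0], ![0, 0, 0, 1], (![a, -r, r, 0] : Lattice),
    (![-s, b, 0, s] : Lattice)}, by simp [modelCone]⟩

lemma single_mem_latticePoints (i : Fin 4) :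
    (Pi.single i 1 : Lattice) ∈ latticePoints (modelCone r s a b) := by
  refine Submodule.subset_span ⟨_, ?_, rfl⟩
  have : (Pi.single i 1 : Lattice) =
      ![![1, 0, 0, 0], ![0, 1, 0, 0], ![0, 0, 1, 0], ![0, 0, 0, 1]] i := by
    funext k
    fin_cases i <;> fin_cases k <;> rfl
  rw [this]
  fin_cases i <;> simp

lemma modelCone_span_eq_top (r s : ℕ) (a b : ℤ) :
    Submodule.span ℝ (modelCone r s a b : Set (Fin 4 → ℝ)) = ⊤ := by
  rw [eq_top_iff, ← (Pi.basisFun ℝ (Fin 4)).span_eq, Submodule.span_le]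
  rintro - ⟨i, rfl⟩
  refine Submodule.subset_span ?_
  have h := single_mem_latticePoints (r := r) (s := s) (a := a) (b := b) i
  have heq : toReal (Pi.single i 1) = Pi.basisFun ℝ (Fin 4) i := by
    funext k
    simp [toReal, Pi.single_apply]
  rw [mem_latticePoints, heq] at h
  exact h

lemma faceFun_single_two (j : Fin 4) : faceFun r s a b j ![0, 0, 1, 0] = 1 := by
  fin_cases j <;> simp [faceFun]

lemma faceFun_single_three (j : Fin 4) : faceFun r s a b j ![0, 0, 0, 1] = 1 := by
  fin_cases j <;> simp [faceFun]

/-- The monomial with a given exponent in the basis `ξ, η, A, B`. -/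
def modelPoint (h : (a, b) ∈ entryPairs r α s β) (p : Lattice) (hp : FacetIneq r s a b p) :
    latticePoints (modelCone r s a b) :=
  ⟨p, mem_latticePoints_of_facetIneq h.1 h.2.1 h.2.2.1 hp⟩

lemma facetIneq_coe (h : (a, b) ∈ entryPairs r α s β) (p : latticePoints (modelCone r s a b)) :
    FacetIneq r s a b p :=
  facetIneq_of_mem h.1 h.2.1 h.2.2.1 p.2

/-- The parameter `A` on `V_{AB}`. -/
def modelA (r s : ℕ) (a b : ℤ) : latticePoints (modelCone r s a b) :=
  ⟨![0, 0, 1, 0], Submodule.subset_span ⟨_, by simp, rfl⟩⟩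

/-- The parameter `B` on `V_{AB}`. -/
def modelB (r s : ℕ) (a b : ℤ) : latticePoints (modelCone r s a b) :=
  ⟨![0, 0, 0, 1], Submodule.subset_span ⟨_, by simp, rfl⟩⟩

lemma exists_faceFun_eq_zero_iff (h : (a, b) ∈ entryPairs r α s β)
    (p : latticePoints (modelCone r s a b)) : (∃ j, faceFun r s a b j p = 0) ↔
      ¬ ((∃ q, p = modelA r s a b + q) ∨ ∃ q, p = modelB r s a b + q) := by
  constructor
  · rintro ⟨j, hj⟩ (⟨q, rfl⟩ | ⟨q, rfl⟩) <;>
      rw [AddSubmonoid.coe_add, faceFun_add] at hj <;>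
      have := (facetIneq_coe h q).faceFun_nonneg j
    · have h1 : faceFun r s a b j (modelA r s a b) = 1 := faceFun_single_two j
      omega
    · have h1 : faceFun r s a b j (modelB r s a b) = 1 := faceFun_single_three j
      omega
  · intro hp
    rcases (facetIneq_coe h p).face_or_sub h.1 h.2.1 h.2.2.1 with hj | hA | hB
    · exact hj
    · exact absurd (Or.inl ⟨modelPoint h _ hA, Subtype.ext (add_sub_cancel _ _).symm⟩) hp
    · exact absurd (Or.inr ⟨modelPoint h _ hB, Subtype.ext (add_sub_cancel _ _).symm⟩) hp

/-- The toric deformation `T ⊂ V_{AB}` belonging to the matrix `(r a; b s)`. -/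
def modelDeformation (h : (a, b) ∈ entryPairs r α s β) : ToricDeformation r α s β where
  cone := modelCone r s a b
  rational := modelCone_rational r s a b
  fullDim := modelCone_span_eq_top r s a b
  A := modelA r s a b
  B := modelB r s a b
  restrict := modelRestrict h
  restrict_surjective := modelRestrict_surjective h
  ker_restrict := by
    ext f
    rw [RingHom.mem_ker, mem_span_pair]
    constructor
    · intro hf p hp
      by_contra hne
      obtain ⟨j, hj⟩ := (exists_faceFun_eq_zero_iff h p).2 hne
      have := coeff_modelRestrict h f hj
      rw [hf] at this
      exact Finsupp.mem_support_iff.1 hp this.symm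
    · intro hf
      refine Subtype.ext (coeff_modelRestrict_eq h (Subalgebra.zero_mem _) fun p j hj => ?_)
      rw [Pi.zero_apply, MvPolynomial.coeff_zero]
      by_contra hne
      exact (exists_faceFun_eq_zero_iff h p).1 ⟨j, hj⟩ (hf p (Finsupp.mem_support_iff.2 hne))
  regular := by
    have hne : ∀ q : latticePoints (modelCone r s a b), ¬ ((∃ q', q = modelA r s a b + q') ∨
        ∃ q', q = modelB r s a b + q') ∨ q ≠ 0 := fun q => by
      by_cases hq : q = 0
      · subst hq
        exact Or.inl ((exists_faceFun_eq_zero_iff h 0).1 ⟨0, faceFun_zero 0⟩)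
      · exact Or.inr hq
    refine isRegular_mono (fun p q hpq => ?_)
      (fun q => (hne _).resolve_left (not_not.2 (Or.inl ⟨q, rfl⟩)))
      (fun q => (hne _).resolve_left (not_not.2 (Or.inr ⟨q, rfl⟩)))
    -- The `A`-forms of `p - A` are those of `q`, since `B` does not affect them, and its `B`-forms
    -- are those of `p`. Thus all six inequalities hold for `p - A`.
    have hq : (q : Lattice) = (p : Lattice) + ![0, 0, 0, 1] - ![0, 0, 1, 0] := by
      rw [eq_sub_iff_add_eq, add_comm, add_comm (p : Lattice)]
      exact (congrArg Subtype.val hpq).symm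
    have h3 : FacetIneq r s a b ((p : Lattice) - ![0, 0, 1, 0]) := by
      obtain ⟨u1, u2, u3, -, -, -⟩ := facetIneq_coe h q
      obtain ⟨-, -, -, v1, v2, v3⟩ := facetIneq_coe h p
      rw [hq] at u1 u2 u3
      simp only [Pi.sub_apply, Pi.add_apply] at u1 u2 u3
      exact ⟨by simpa using u1, by simpa using u2, by simpa using u3, by simpa using v1,
        by simpa using v2, by simpa using v3⟩
    exact ⟨modelPoint h _ h3, Subtype.ext (add_sub_cancel _ _).symm⟩
  equivariant := fun p j => by
    rw [modelRestrict_mono, modelRestr]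
    split_ifs
    · exact ⟨_, _, rfl⟩
    · exact ⟨0, 0, (map_zero _).symm⟩

end Model

end Tent

end

/-! ### A smoothness criterion for monomial hypersurfaces -/

noncomputable section

namespace Tent

section Smooth

/-- Formal smoothness of the localization at the kernel of a point, from lifts of homomorphisms
along square-zero extensions that need not be defined on the localization. -/
lemma smoothAtPoint_of_exists_lift {S : Type} [CommRing S] [Algebra ℂ S] (x : S →ₐ[ℂ] ℂ)
    (H : ∀ (C : Type) [CommRing C] [Algebra ℂ C] (I : Ideal C), I ^ 2 = ⊥ →
      ∀ g : S →ₐ[ℂ] C ⧸ I, (∀ f, x f ≠ 0 → IsUnit (g f)) →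
      ∃ f : S →ₐ[ℂ] C, (Ideal.Quotient.mkₐ ℂ I).comp f = g) : SmoothAtPoint x := by
  have hp : (RingHom.ker x).IsPrime := RingHom.ker_isPrime x
  change Algebra.FormallySmooth ℂ (Localization.AtPrime (RingHom.ker x))
  refine Algebra.FormallySmooth.of_comp_surjective fun C _ _ I hI g => ?_
  set ι : S →ₐ[ℂ] Localization.AtPrime (RingHom.ker x) := IsScalarTower.toAlgHom ℂ _ _ with hι
  have hunit : ∀ f, x f ≠ 0 → IsUnit (ι f) := fun f hf =>
    IsLocalization.map_units (M := (RingHom.ker x).primeCompl) _ ⟨f, hf⟩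
  obtain ⟨f, hf⟩ := H C I hI (g.comp ι) fun f hf => (hunit f hf).map g
  -- Units lift along the nilpotent ideal `I`, so the lift extends to the localization
  -- automatically.
  have hfunit : ∀ y : (RingHom.ker x).primeCompl, IsUnit (f y) := fun y => by
    rw [← IsNilpotent.isUnit_quotient_mk_iff (I := I) ⟨2, hI⟩]
    have : Ideal.Quotient.mk I (f y) = g (ι y) := DFunLike.congr_fun hf (y : S)
    rw [this]
    exact (hunit y y.2).map g
  refine ⟨IsLocalization.liftAlgHom (M := (RingHom.ker x).primeCompl) (f := f) hfunit, ?_⟩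
  refine IsLocalization.algHom_ext (RingHom.ker x).primeCompl ?_
  refine AlgHom.ext fun y => ?_
  change Ideal.Quotient.mk I (IsLocalization.lift hfunit (algebraMap S _ y)) = g (ι y)
  rw [IsLocalization.lift_eq]
  exact DFunLike.congr_fun hf y

variable {σ : PointedCone ℝ (Fin 4 → ℝ)}

/-- A hypersurface `B = 0` in a toric variety is smooth at a point where `ξ` does not vanish if
all monomials have nonnegative exponents with respect to the other members of a basis
`ξ, η, w, B` of `𝕄`. -/
lemma smoothAtPoint_of_coordinates {B ξ η w : latticePoints σ}
    (x : (toricRing σ ⧸ Ideal.span {(mono B : toricRing σ)}) →ₐ[ℂ] ℂ)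
    (hx : x (Ideal.Quotient.mk _ (mono ξ)) ≠ 0)
    (n : latticePoints σ →+ ℤ) (n₁ n₂ n₃ : latticePoints σ →+ ℕ) (hB : n₃ B ≠ 0)
    (hn : ∀ p : latticePoints σ, (p : Lattice) =
      n p • (ξ : Lattice) + n₁ p • (η : Lattice) + n₂ p • (w : Lattice) + n₃ p • (B : Lattice)) :
    SmoothAtPoint x := by
  refine smoothAtPoint_of_exists_lift x fun C _ _ I hI g hg => ?_
  set γ : latticePoints σ → C ⧸ I := fun p => g (Ideal.Quotient.mk _ (mono p)) with hγ
  have hγadd : ∀ p q, γ (p + q) = γ p * γ q := fun p q => by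
    rw [hγ]; dsimp only; rw [mono_add, map_mul, map_mul]
  have hγn : ∀ (k : ℕ) p, γ (k • p) = γ p ^ k := fun k p => by
    rw [hγ]; dsimp only; rw [mono_nsmul, map_pow, map_pow]
  have hγB : γ B = 0 := by
    rw [hγ]; dsimp only
    rw [Ideal.Quotient.eq_zero_iff_mem.2 (Ideal.subset_span (Set.mem_singleton _)), map_zero]
  obtain ⟨u, hu⟩ := Ideal.Quotient.mk_surjective (γ ξ)
  obtain ⟨v₁, hv₁⟩ := Ideal.Quotient.mk_surjective (γ η)
  obtain ⟨v₂, hv₂⟩ := Ideal.Quotient.mk_surjective (γ w)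
  have huu : IsUnit u := by
    rw [← IsNilpotent.isUnit_quotient_mk_iff (I := I) ⟨2, hI⟩, hu]
    exact hg _ hx
  obtain ⟨u, rfl⟩ := huu
  -- The values at `ξ, η, w` are lifted freely, that at `ξ` to a unit, and `B` is sent to `0`; with
  -- `0 ^ 0 = 1` only monomials involving `B` are killed.
  set f₀ : toricRing σ →ₐ[ℂ] C := AddMonoidAlgebra.lift ℂ C (latticePoints σ)
    { toFun := fun p => ((u ^ n p.toAdd : Cˣ) : C) * v₁ ^ n₁ p.toAdd * v₂ ^ n₂ p.toAdd *
        0 ^ n₃ p.toAdd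
      map_one' := by simp
      map_mul' := fun p q => by
        simp only [toAdd_mul, map_add, zpow_add, pow_add, Units.val_mul]
        ring } with hf₀
  have hf₀m : ∀ p, f₀ (mono p) = ((u ^ n p : Cˣ) : C) * v₁ ^ n₁ p * v₂ ^ n₂ p * 0 ^ n₃ p :=
    fun p => by
      rw [hf₀, mono, AddMonoidAlgebra.lift_single, one_smul]
      rfl
  have hker : ∀ y ∈ Ideal.span {(mono B : toricRing σ)}, f₀ y = 0 := by
    intro y hy
    obtain ⟨z, rfl⟩ := Ideal.mem_span_singleton'.1 hy
    rw [map_mul, hf₀m, zero_pow hB, mul_zero, mul_zero]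
  refine ⟨Ideal.Quotient.liftₐ _ f₀ hker, ?_⟩
  refine AlgHom.ext fun y => ?_
  obtain ⟨y, rfl⟩ := Ideal.Quotient.mk_surjective y
  suffices ((Ideal.Quotient.mkₐ ℂ I).comp f₀) =
      g.comp (Ideal.Quotient.mkₐ ℂ (Ideal.span {(mono B : toricRing σ)})) from
    DFunLike.congr_fun this y
  refine algHom_ext_mono fun p => ?_
  change Ideal.Quotient.mk I (f₀ (mono p)) = γ p
  -- The exponent of `ξ` may be negative, so the expansion of `p` is first multiplied by a power of
  -- `ξ`. Its image is a unit and is cancelled at the end.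
  have hp : p + (-n p).toNat • ξ = (n p).toNat • ξ + n₁ p • η + n₂ p • w + n₃ p • B := by
    refine Subtype.ext ?_
    simp only [AddSubmonoid.coe_add, AddSubmonoidClass.coe_nsmul]
    conv_lhs => rw [hn p]
    have : (n p).toNat • (ξ : Lattice) = n p • (ξ : Lattice) + (-n p).toNat • (ξ : Lattice) := by
      rw [← natCast_zsmul, ← natCast_zsmul, ← add_smul]
      congr 1
      omega
    rw [this]
    abel
  have hU : ∀ k : ℤ, Ideal.Quotient.mk I ((u ^ k : Cˣ) : C) * γ ξ ^ (-k).toNat =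
      γ ξ ^ k.toNat := fun k => by
    rw [← hu, ← map_pow, ← map_mul, ← map_pow, ← Units.val_pow_eq_pow_val,
      ← Units.val_pow_eq_pow_val, ← Units.val_mul]
    congr 2
    rw [← zpow_natCast, ← zpow_natCast, ← zpow_add]
    congr 1
    omega
  have hγu : IsUnit (γ ξ ^ (-n p).toNat) := (hg _ hx).pow _
  have h1 : γ p * γ ξ ^ (-n p).toNat =
      γ ξ ^ (n p).toNat * γ η ^ n₁ p * γ w ^ n₂ p * γ B ^ n₃ p := by
    rw [← hγn, ← hγadd, hp, hγadd, hγadd, hγadd, hγn, hγn, hγn, hγn]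
  refine hγu.mul_right_cancel ?_
  rw [h1, hγB, ← hU (n p), hf₀m]
  simp only [map_mul, map_pow, map_zero, hv₁, hv₂]
  ring

end Smooth

end Tent

end

/-! ### The model smooths the top axes and has the given matrix -/

noncomputable section

namespace Tent

section Model

variable {r α s β : ℕ} {a b : ℤ}

lemma exists_natHom (h : (a, b) ∈ entryPairs r α s β) (φ : Lattice → ℤ)
    (hφ : ∀ p, FacetIneq r s a b p → 0 ≤ φ p) (hadd : ∀ p q, φ (p + q) = φ p + φ q) :
    ∃ n : latticePoints (modelCone r s a b) →+ ℕ, ∀ p, (n p : ℤ) = φ p := by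
  have h0 : φ 0 = 0 := by simpa using hadd 0 0
  refine ⟨{ toFun := fun p => (φ p).toNat, map_zero' := ?_, map_add' := fun p q => ?_ }, fun p =>
    Int.toNat_of_nonneg (hφ _ (facetIneq_coe h p))⟩
  · rw [AddSubmonoid.coe_zero, h0, Int.toNat_zero]
  · rw [AddSubmonoid.coe_add, hadd,
      Int.toNat_add (hφ _ (facetIneq_coe h p)) (hφ _ (facetIneq_coe h q))]

/-- The monomial `ξ` on `V_{AB}`. -/
def modelXi (r s : ℕ) (a b : ℤ) : latticePoints (modelCone r s a b) :=
  ⟨![1, 0, 0, 0], Submodule.subset_span ⟨_, by simp, rfl⟩⟩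

/-- The monomial `η` on `V_{AB}`. -/
def modelEta (r s : ℕ) (a b : ℤ) : latticePoints (modelCone r s a b) :=
  ⟨![0, 1, 0, 0], Submodule.subset_span ⟨_, by simp, rfl⟩⟩

/-- The monomial `x₀` on `V_{AB}`. -/
def modelX0 (r s : ℕ) (a b : ℤ) : latticePoints (modelCone r s a b) :=
  ⟨![a, -r, r, 0], Submodule.subset_span ⟨_, by simp, rfl⟩⟩

/-- The monomial `y₀` on `V_{AB}`. -/
def modelY0 (r s : ℕ) (a b : ℤ) : latticePoints (modelCone r s a b) :=
  ⟨![-s, b, 0, s], Submodule.subset_span ⟨_, by simp, rfl⟩⟩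

lemma modelRestr_modelXi (hr : (0 : ℤ) < r) (hs : (0 : ℤ) < s) (hb : 0 ≤ b) :
    modelRestr r s a b (modelXi r s a b) = coordXi r := by
  have h0 : (r : ℤ) * b + r * s ≠ 0 := by positivity
  funext j
  fin_cases j <;>
    simp [modelRestr, modelXi, faceFun, coordXi, modelExpo, faceExp, monomial_expVec, h0]

lemma modelRestr_modelEta (hr : (0 : ℤ) < r) (hs : (0 : ℤ) < s) (ha : 0 ≤ a) :
    modelRestr r s a b (modelEta r s a b) = coordEta s := by
  have h0 : (r : ℤ) * s + a * s ≠ 0 := by positivity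
  funext j
  fin_cases j <;>
    simp [modelRestr, modelEta, faceFun, coordEta, modelExpo, faceExp, monomial_expVec, h0]

lemma modelRestr_modelX0 (hr : (0 : ℤ) < r) (ha : 0 ≤ a) (hdet : r * s - a * b = 1) :
    modelRestr r s a b (modelX0 r s a b) = coordX0 r := by
  have f0 : faceFun r s a b 0 (modelX0 r s a b) = 0 := by
    simp [faceFun, modelX0]; linear_combination -(r : ℤ) * hdet
  have f1 : faceFun r s a b 1 (modelX0 r s a b) = 0 := by simp [faceFun, modelX0]
  have f2 : faceFun r s a b 2 (modelX0 r s a b) ≠ 0 := by simp [faceFun, modelX0]; omega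
  have f3 : faceFun r s a b 3 (modelX0 r s a b) ≠ 0 := by simp [faceFun, modelX0]; omega
  have e00 : faceExp r s a b 0 0 (modelX0 r s a b) = 1 := by
    simp [faceExp, modelX0]; linear_combination hdet
  have e01 : faceExp r s a b 0 1 (modelX0 r s a b) = 0 := by simp [faceExp, modelX0]; ring
  have e10 : faceExp r s a b 1 0 (modelX0 r s a b) = r := by simp [faceExp, modelX0]
  have e11 : faceExp r s a b 1 1 (modelX0 r s a b) = 0 := by simp [faceExp, modelX0]; ring
  funext j
  fin_cases j
  · simp [modelRestr, f0, modelExpo, e00, e01, coordX0, monomial_expVec]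
  · simp [modelRestr, f1, modelExpo, e10, e11, coordX0, monomial_expVec]
  · simp [modelRestr, f2, coordX0]
  · simp [modelRestr, f3, coordX0]

lemma modelRestr_modelY0 (hs : (0 : ℤ) < s) (hb : 0 ≤ b) (hdet : r * s - a * b = 1) :
    modelRestr r s a b (modelY0 r s a b) = coordY0 s := by
  have f0 : faceFun r s a b 0 (modelY0 r s a b) = 0 := by
    simp [faceFun, modelY0]; linear_combination -(s : ℤ) * hdet
  have f3 : faceFun r s a b 3 (modelY0 r s a b) = 0 := by simp [faceFun, modelY0]
  have f1 : faceFun r s a b 1 (modelY0 r s a b) ≠ 0 := by simp [faceFun, modelY0]; omega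
  have f2 : faceFun r s a b 2 (modelY0 r s a b) ≠ 0 := by simp [faceFun, modelY0]; omega
  have e00 : faceExp r s a b 0 0 (modelY0 r s a b) = 0 := by simp [faceExp, modelY0]; ring
  have e01 : faceExp r s a b 0 1 (modelY0 r s a b) = 1 := by
    simp [faceExp, modelY0]; linear_combination hdet
  have e30 : faceExp r s a b 3 0 (modelY0 r s a b) = s := by simp [faceExp, modelY0]
  have e31 : faceExp r s a b 3 1 (modelY0 r s a b) = 0 := by simp [faceExp, modelY0]; ring
  funext j
  fin_cases j
  · simp [modelRestr, f0, modelExpo, e00, e01, coordY0, monomial_expVec]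
  · simp [modelRestr, f1, coordY0]
  · simp [modelRestr, f2, coordY0]
  · simp [modelRestr, f3, modelExpo, e30, e31, coordY0, monomial_expVec]

lemma modelDeformation_smoothsXi (h : (a, b) ∈ entryPairs r α s β) :
    (modelDeformation h).SmoothsXi := by
  obtain ⟨hr, hs⟩ := pos_of_det h.1 h.2.1 h.2.2.1
  obtain ⟨hdet, ha, hb, -, -⟩ : (r : ℤ) * s - a * b = 1 ∧ 0 ≤ a ∧ 0 ≤ b ∧ a ≡ α [ZMOD r] ∧
    b ≡ β [ZMOD s] := id h
  intro t ht x hx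
  -- This is `w = A η⁻¹ ξ^a`. In the basis `ξ, η, w, B` a point `p` has the coordinates `p₀ - a p₂,
  -- p₁ + p₂, p₂, p₃`, and the last three are forms that are nonnegative on the cone.
  have hw : FacetIneq r s a b ![a, -1, 1, 0] := by
    have h1 : 0 ≤ (r - 1) * (a * b) := mul_nonneg (by linarith) (mul_nonneg ha hb)
    have h2 : 0 ≤ (r - 1) * (a * s) := mul_nonneg (by linarith) (mul_nonneg ha hs.le)
    refine ⟨by simp, by simp, ?_, by simp, by simpa using ha, ?_⟩ <;> simp <;> linarith
  obtain ⟨n₁, hn₁⟩ := exists_natHom h (fun p => p 1 + p 2) (fun p hp => hp.A₂) fun p q => by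
    simp only [Pi.add_apply]; ring
  obtain ⟨n₂, hn₂⟩ := exists_natHom h (fun p => p 2) (fun p hp => hp.A₁) fun p q => rfl
  obtain ⟨n₃, hn₃⟩ := exists_natHom h (fun p => p 3) (fun p hp => hp.B₁) fun p q => rfl
  have hξ : evalXiAxis t (modelRestrict h (mono (modelXi r s a b))) ≠ 0 := by
    rw [modelRestrict_mono, modelRestr_modelXi hr hs hb]
    simpa [evalXiAxis, coordXi] using ht
  refine smoothAtPoint_of_coordinates (B := modelB r s a b) (ξ := modelXi r s a b)
    (η := modelEta r s a b) (w := modelPoint h _ hw) x (fun h0 => hξ ((hx _).symm.trans h0))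
    (((Pi.evalAddMonoidHom (fun _ => ℤ) 0 - a • Pi.evalAddMonoidHom (fun _ => ℤ) 2 :
      Lattice →+ ℤ)).comp (latticePoints (modelCone r s a b)).subtype) n₁ n₂ n₃ ?_ fun p => ?_
  · rw [← Nat.cast_ne_zero (R := ℤ), hn₃]
    exact one_ne_zero
  · simp only [← natCast_zsmul, hn₁, hn₂, hn₃]
    funext i
    fin_cases i <;> simp [modelXi, modelEta, modelB, modelPoint, mul_comm]

lemma modelDeformation_smoothsEta (h : (a, b) ∈ entryPairs r α s β) :
    (modelDeformation h).SmoothsEta := by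
  obtain ⟨hr, hs⟩ := pos_of_det h.1 h.2.1 h.2.2.1
  obtain ⟨hdet, ha, hb, -, -⟩ : (r : ℤ) * s - a * b = 1 ∧ 0 ≤ a ∧ 0 ≤ b ∧ a ≡ α [ZMOD r] ∧
    b ≡ β [ZMOD s] := id h
  intro t ht x hx
  -- Symmetrically, `w = B ξ⁻¹ η^b` completes `η, ξ, A` to a basis.
  have hw : FacetIneq r s a b ![-1, b, 0, 1] := by
    have h1 : 0 ≤ (s - 1) * (a * b) := mul_nonneg (by linarith) (mul_nonneg ha hb)
    have h2 : 0 ≤ (s - 1) * (b * r) := mul_nonneg (by linarith) (mul_nonneg hb hr.le)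
    refine ⟨by simp, by simpa using hb, ?_, by simp, by simp, ?_⟩ <;> simp <;> linarith
  obtain ⟨n₁, hn₁⟩ := exists_natHom h (fun p => p 0 + p 3) (fun p hp => hp.B₂) fun p q => by
    simp only [Pi.add_apply]; ring
  obtain ⟨n₂, hn₂⟩ := exists_natHom h (fun p => p 3) (fun p hp => hp.B₁) fun p q => rfl
  obtain ⟨n₃, hn₃⟩ := exists_natHom h (fun p => p 2) (fun p hp => hp.A₁) fun p q => rfl
  have hη : evalEtaAxis t (modelRestrict h (mono (modelEta r s a b))) ≠ 0 := by
    rw [modelRestrict_mono, modelRestr_modelEta hr hs ha]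
    simpa [evalEtaAxis, coordEta] using ht
  refine smoothAtPoint_of_coordinates (B := modelA r s a b) (ξ := modelEta r s a b)
    (η := modelXi r s a b) (w := modelPoint h _ hw) x (fun h0 => hη ((hx _).symm.trans h0))
    (((Pi.evalAddMonoidHom (fun _ => ℤ) 1 - b • Pi.evalAddMonoidHom (fun _ => ℤ) 3 :
      Lattice →+ ℤ)).comp (latticePoints (modelCone r s a b)).subtype) n₁ n₂ n₃ ?_ fun p => ?_
  · rw [← Nat.cast_ne_zero (R := ℤ), hn₃]
    exact one_ne_zero
  · simp only [← natCast_zsmul, hn₁, hn₂, hn₃]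
    funext i
    fin_cases i <;> simp [modelXi, modelEta, modelA, modelPoint, mul_comm]

lemma modelDeformation_hasMatrix (h : (a, b) ∈ entryPairs r α s β)
    {g : Matrix.SpecialLinearGroup (Fin 2) ℤ} (h00 : g 0 0 = r) (h01 : g 0 1 = a)
    (h10 : g 1 0 = b) (h11 : g 1 1 = s) : (modelDeformation h).HasMatrix g := by
  obtain ⟨hr, hs⟩ := pos_of_det h.1 h.2.1 h.2.2.1
  obtain ⟨hdet, ha, hb, -, -⟩ : (r : ℤ) * s - a * b = 1 ∧ 0 ≤ a ∧ 0 ≤ b ∧ a ≡ α [ZMOD r] ∧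
    b ≡ β [ZMOD s] := id h
  have hbasis : ![(![1, 0, 0, 0] : Lattice), ![0, 1, 0, 0], ![0, 0, 1, 0], ![0, 0, 0, 1]] =
      Pi.basisFun ℤ (Fin 4) := by
    funext i k
    fin_cases i <;> fin_cases k <;> simp
  refine ⟨modelX0 r s a b, modelY0 r s a b, modelXi r s a b, modelEta r s a b,
    ⟨1, one_ne_zero, (modelRestrict_mono h _).trans ?_⟩,
    ⟨1, one_ne_zero, (modelRestrict_mono h _).trans ?_⟩,
    ⟨1, one_ne_zero, (modelRestrict_mono h _).trans ?_⟩,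
    ⟨1, one_ne_zero, (modelRestrict_mono h _).trans ?_⟩, ?_, ?_, ?_, ?_, rfl⟩
  · rw [modelRestr_modelX0 hr ha hdet, one_smul]
  · rw [modelRestr_modelY0 hs hb hdet, one_smul]
  · rw [modelRestr_modelXi hr hs hb, one_smul]
  · rw [modelRestr_modelEta hr hs ha, one_smul]
  · change LinearIndependent ℤ
      ![(![1, 0, 0, 0] : Lattice), ![0, 1, 0, 0], ![0, 0, 1, 0], ![0, 0, 0, 1]]
    rw [hbasis]
    exact (Pi.basisFun ℤ (Fin 4)).linearIndependent
  · change Submodule.span ℤ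
      {(![1, 0, 0, 0] : Lattice), ![0, 1, 0, 0], ![0, 0, 1, 0], ![0, 0, 0, 1]} = ⊤
    rw [← range_vec4, hbasis]
    exact (Pi.basisFun ℤ (Fin 4)).span_eq
  · change (![a, -r, r, 0] : Lattice) =
      g 0 0 • ((![0, 0, 1, 0] : Lattice) - ![0, 1, 0, 0]) + g 0 1 • (![1, 0, 0, 0] : Lattice)
    rw [h00, h01]
    funext i
    fin_cases i <;> simp
  · change (![-s, b, 0, s] : Lattice) =
      g 1 0 • (![0, 1, 0, 0] : Lattice) + g 1 1 • ((![0, 0, 0, 1] : Lattice) - ![1, 0, 0, 0])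
    rw [h10, h11]
    funext i
    fin_cases i <;> simp

end Model

end Tent

end

/-! ### The classification -/

noncomputable section

namespace Tent

variable {r α s β : ℕ}

lemma ToricDeformation.Iso.refl (D : ToricDeformation r α s β) : D.Iso D :=
  ⟨AlgEquiv.refl, fun p => ⟨p, 1, (one_smul _ _).symm⟩, ⟨1, one_ne_zero, (one_smul _ _).symm⟩,
    ⟨1, one_ne_zero, (one_smul _ _).symm⟩, fun _ => rfl⟩

lemma exists_classification (hr : 1 ≤ r) (hs : 1 ≤ s) (hα : α ≤ r) (hβ : β ≤ s) :
    ∃ Ψ : TopSmoothing r α s β → matrices r α s β,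
      (∀ D : TopSmoothing r α s β, D.1.HasMatrix (Ψ D).1) ∧
      (∀ D D' : TopSmoothing r α s β, Ψ D = Ψ D' ↔ D.1.Iso D'.1) ∧
      Function.Surjective Ψ := by
  choose a b hF using fun D : TopSmoothing r α s β =>
    ToricDeformation.exists_frame hr hs hα hβ D.2.1 D.2.2
  let F : ∀ D : TopSmoothing r α s β, D.1.Frame (a D) (b D) := fun D => (hF D).some
  have hmat : ∀ D : TopSmoothing r α s β, D.1.HasMatrix (F D).matrix := fun D =>
    (F D).hasMatrix hr hs rfl rfl rfl rfl
  refine ⟨fun D => ⟨(F D).matrix, (F D).matrix_mem⟩, hmat, fun D D' => ⟨fun h => ?_, fun h => ?_⟩,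
    fun g => ?_⟩
  · have h' : (F D).matrix = (F D').matrix := congrArg Subtype.val h
    have ha : a D = a D' :=
      congrArg (fun g : Matrix.SpecialLinearGroup (Fin 2) ℤ => g 0 1) h'
    have hb : b D = b D' :=
      congrArg (fun g : Matrix.SpecialLinearGroup (Fin 2) ℤ => g 1 0) h'
    have F' : D'.1.Frame (a D) (b D) := by
      rw [ha, hb]
      exact F D'
    exact (F D).iso hr hs hα hβ F'
  · exact Subtype.ext (ToricDeformation.HasMatrix.unique_of_iso hr hs (F D).matrix_mem
      (F D').matrix_mem (hmat D) (hmat D') h)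
  · obtain ⟨g, hg⟩ := g
    have h : (g 0 1, g 1 0) ∈ entryPairs r α s β := exists_mem_matrices_iff.1 ⟨g, hg, rfl, rfl⟩
    set D : TopSmoothing r α s β :=
      ⟨modelDeformation h, modelDeformation_smoothsXi h, modelDeformation_smoothsEta h⟩ with hD
    -- The model has the matrix `g` by construction and `Ψ D` by the choice of a frame; uniqueness
    -- applied to the identity shows that they agree.
    exact ⟨D, Subtype.ext (ToricDeformation.HasMatrix.unique_of_iso hr hs (F D).matrix_mem hg
      (hmat D) (modelDeformation_hasMatrix h hg.1 rfl rfl hg.2.1)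
      (ToricDeformation.Iso.refl _))⟩

end Tent

end

theorem theorem2p9 :
    (∀ r α s β : ℕ, 1 ≤ r → 1 ≤ s → α ≤ r → β ≤ s → Nat.Coprime α r → Nat.Coprime β s →
      (∃ Ψ : Tent.TopSmoothing r α s β → Tent.matrices r α s β,
        (∀ D : Tent.TopSmoothing r α s β, D.1.HasMatrix (Ψ D).1) ∧
        (∀ D D' : Tent.TopSmoothing r α s β, Ψ D = Ψ D' ↔ D.1.Iso D'.1) ∧
        Function.Surjective Ψ) ∧
      (¬ (r = 1 ∧ s = 1) →
        (∀ a b : ℤ, (∃ g ∈ Tent.matrices r α s β, g 0 1 = a ∧ g 1 0 = b) ↔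
          (a = α ∧ (α : ℤ) ∣ r * s - 1 ∧ b = (r * s - 1) / α ∧ b ≡ β [ZMOD s]) ∨
          (b = β ∧ (β : ℤ) ∣ r * s - 1 ∧ a = (r * s - 1) / β ∧ a ≡ α [ZMOD r])) ∧
        (Tent.matrices r α s β).encard ≤ 2)) ∧
    (∀ n : ℕ, n ≤ 2 → ∃ r α s β : ℕ, 1 ≤ r ∧ 1 ≤ s ∧ α ≤ r ∧ β ≤ s ∧
      Nat.Coprime α r ∧ Nat.Coprime β s ∧ ¬ (r = 1 ∧ s = 1) ∧
      (Tent.matrices r α s β).encard = n) :=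
  ⟨fun _ _ _ _ hr hs hα hβ hcα hcβ =>
    ⟨Tent.exists_classification hr hs hα hβ, fun hrs =>
      ⟨fun _ _ => Tent.exists_mem_matrices_iff.trans
        (Tent.mem_entryPairs_iff hr hs hα hβ hcα hcβ hrs),
        Tent.encard_matrices_le_two hr hs hα hβ hcα hcβ hrs⟩⟩,
    Tent.exists_encard_matrices_eq⟩
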